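/- Let $n\ge 1$ and $0<\sigma<1$. Let $K_n^+=\{\lambda\in\mathbb R^n:\lambda_i>0 \text{ for all } i\}$ and let $f$ be a symmetric function, smooth on $K_n^+$ and continuous on $\overline{K_n^+}$, with $f_i=\partial f/\partial\lambda_i>0$, $f>0$ and $f$ concave in $K_n^+$, $f=0$ on $\partial K_n^+$, $f(1,\dots,1)=1$, $f$ homogeneous of degree one, and, for some $\varepsilon_0',\delta_0>0$, $\lim_{R\to\infty}f(\lambda_1,\dots,\lambda_{n-1},\lambda_n+R)\ge 1+\varepsilon_0'$ uniformly for $\lambda\in K_n^+$ in the ball of radius $\delta_0$ about $(1,\dots,1)$. Use the half-space model $\mathbb H^{n+1}=\{(x,x_{n+1}):x_{n+1}>0\}$ with metric $x_{n+1}^{-2}\sum dx_i^2$. Let $\Omega\subset\mathbb R^n$ be a domain (open, connected, nonempty), let $u\in C^\infty(\Omega)$, $u>0$, and let $\Sigma=\{(x,u(x)):x\in\Omega\}$. Suppose that, with respect to the upward normal, $\Sigma$ is strictly locally convex, i.e. its hyperbolic principal curvatures $\kappa=(\kappa_1,\dots,\kappa_n)$ are all positive, and that $f(\kappa)=\sigma$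 on $\Sigma$. Let $\nu^{n+1}=1/\sqrt{1+|\nabla u|^2}$ be the last component of the upward Euclidean unit normal and put $\eta=(\sigma-\nu^{n+1})/u$. Let $\nabla$ be the Levi-Civita connection of the induced hyperbolic metric on $\Sigma$. In an orthonormal frame let $(h_{ij})$ be the hyperbolic second fundamental form and let $F^{ij}=\frac{\partial F}{\partial a_{ij}}(h)$, where $F(A)=f(\text{eigenvalues of }A)$ for symmetric matrices $A$ (so $(F^{ij})$ is the symmetric matrix representing the derivative of $F$ at $h$ on symmetric matrices). Then: 1. On $\Sigma$, in every orthonormal frame, the derivatives $F^{ij}$ exist and $$F^{ij}\nabla_{ij}\eta\ \ge\ \sigma(1-\sigma)\,\frac{\sum f_i(\kappa)-1}{u}\ \ge\ 0 .$$ 2. If $\Omega$ is bounded and $\eta$, regarded as a function on $\Omega$, extends continuously to $\overline\Omega$, then the extension attains its maximum over $\overline\Omega$ at a point of $\partial\Omega$; in particular $\eta\le\sup_{\partial\Omega}\eta$ on $\Omega$. 3. If $\Omega$ is bounded with smooth boundary, there is $\epsilon_0>0$ depending only on $\Omega$ (not on $f,\sigma,u$) such that, whenever in addition $u\in C^\infty(\overline\Omega)$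 and $u=\epsilon$ on $\partial\Omega$ with $0<\epsilon\le\epsilon_0$, $$\eta\ \le\ \frac{\sqrt{1-\sigma^2}}{r_1}+\frac{\epsilon(1+\sigma)}{r_1^2}\qquad\text{on }\Omega$$ for every $r_1>0$ such that $\partial\Omega$ has exterior tangent spheres of radius $r_1$, that is, such that every point of $\partial\Omega$ lies on a sphere of radius $r_1$ bounding an open ball disjoint from $\Omega$. In particular this holds for the maximal such $r_1$ (and $\eta\le 0$ if the radii are unbounded, as for convex $\Omega$). -/

import Mathlib

open scoped ContDiff Matrix

/-- Euclidean space `ℝᵐ`. -/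
abbrev Euc (m : ℕ) : Type := EuclideanSpace ℝ (Fin m)

/-! ### Riemannian metrics in coordinates -/

/-- The partial derivative `∂v/∂xᵢ`. -/
noncomputable def pd {m : ℕ} (i : Fin m) (v : Euc m → ℝ) (x : Euc m) : ℝ :=
  fderiv ℝ v x (EuclideanSpace.single i 1)

/-- Christoffel symbols `Γᵏᵢⱼ` of the Levi-Civita connection of the metric `g`. -/
noncomputable def christoffel {m : ℕ} (g : Euc m → Matrix (Fin m) (Fin m) ℝ) (x : Euc m)
    (k i j : Fin m) : ℝ :=
  (1 / 2) * ∑ l, (g x)⁻¹ k l *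
    (pd i (fun z => g z j l) x + pd j (fun z => g z i l) x - pd l (fun z => g z i j) x)

/-- The Hessian `∂ᵢ∂ⱼv - Γᵏᵢⱼ ∂ₖv` of `v` for the Levi-Civita connection of `g`, in the
coordinate frame. -/
noncomputable def covHess {m : ℕ} (g : Euc m → Matrix (Fin m) (Fin m) ℝ) (v : Euc m → ℝ)
    (x : Euc m) : Matrix (Fin m) (Fin m) ℝ :=
  Matrix.of fun i j => pd i (pd j v) x - ∑ k, christoffel g x k i j * pd k v x

/-- The metric of hyperbolic space in the half-space model `{y ∈ ℝⁿ⁺¹ : yₙ₊₁ > 0}`. -/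
noncomputable def hypMetric (n : ℕ) (y : Euc (n + 1)) :
    Matrix (Fin (n + 1)) (Fin (n + 1)) ℝ :=
  Matrix.of fun a b => (if a = b then 1 else 0) / (y (Fin.last n)) ^ 2

/-! ### The graph of `u` as a hypersurface of hyperbolic space -/

/-- The parametrization `x ↦ (x, u x)` of the graph. -/
noncomputable def graphMap {n : ℕ} (u : Euc n → ℝ) (x : Euc n) : Euc (n + 1) :=
  WithLp.toLp 2 (Fin.snoc (α := fun _ => ℝ) (fun i => x i) (u x))

/-- The components of the coordinate tangent vector `Xᵢ` of the graph. -/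
noncomputable def tangentVec {n : ℕ} (u : Euc n → ℝ) (i : Fin n) (x : Euc n)
    (a : Fin (n + 1)) : ℝ :=
  pd i (fun z => graphMap u z a) x

/-- `w = √(1 + |∇u|²)`. -/
noncomputable def slopeW {n : ℕ} (u : Euc n → ℝ) (x : Euc n) : ℝ :=
  √(1 + ∑ i, (pd i u x) ^ 2)

/-- The upward Euclidean unit normal `ν = (-∇u, 1) / w`. -/
noncomputable def eucNormal {n : ℕ} (u : Euc n → ℝ) (x : Euc n) : Fin (n + 1) → ℝ :=
  Fin.snoc (α := fun _ => ℝ) (fun i => -pd i u x / slopeW u x) (1 / slopeW u x)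

/-- The upward hyperbolic unit normal `u ν`. -/
noncomputable def hypNormal {n : ℕ} (u : Euc n → ℝ) (x : Euc n) (a : Fin (n + 1)) : ℝ :=
  u x * eucNormal u x a

/-- The induced hyperbolic metric `gᵢⱼ = ⟨Xᵢ, Xⱼ⟩`. -/
noncomputable def firstForm {n : ℕ} (u : Euc n → ℝ) (x : Euc n) : Matrix (Fin n) (Fin n) ℝ :=
  Matrix.of fun i j => ∑ a, ∑ b,
    hypMetric n (graphMap u x) a b * tangentVec u i x a * tangentVec u j x b

/-- The components of the ambient hyperbolic covariant derivative `D_{Xᵢ} Xⱼ`. -/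
noncomputable def ambientDeriv {n : ℕ} (u : Euc n → ℝ) (x : Euc n) (i j : Fin n)
    (c : Fin (n + 1)) : ℝ :=
  pd i (fun z => tangentVec u j z c) x + ∑ a, ∑ b,
    christoffel (hypMetric n) (graphMap u x) c a b * tangentVec u i x a * tangentVec u j x b

/-- The second fundamental form `hᵢⱼ = ⟨D_{Xᵢ} Xⱼ, u ν⟩`. -/
noncomputable def secondForm {n : ℕ} (u : Euc n → ℝ) (x : Euc n) : Matrix (Fin n) (Fin n) ℝ :=
  Matrix.of fun i j => ∑ a, ∑ b,
    hypMetric n (graphMap u x) a b * ambientDeriv u x i j a * hypNormal u x b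

/-- `κ` lists the hyperbolic principal curvatures at `(x, u x)`: the roots, with multiplicity,
of `det (h - t g) = 0`. -/
def IsPrincipalCurvatures {n : ℕ} (u : Euc n → ℝ) (x : Euc n) (κ : Fin n → ℝ) : Prop :=
  ∀ t : ℝ, (secondForm u x - t • firstForm u x).det = (firstForm u x).det * ∏ i, (κ i - t)

/-- The columns of `P` are the coordinates, in the frame `X₁, …, Xₙ`, of a `g`-orthonormal frame
`τ₁, …, τₙ` of the tangent space at `(x, u x)`. -/
def IsOrthonormalFrame {n : ℕ} (u : Euc n → ℝ) (x : Euc n) (P : Matrix (Fin n) (Fin n) ℝ) :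
    Prop :=
  Pᵀ * firstForm u x * P = 1

/-- The matrix of a bilinear form `B` in the frame given by the columns of `P`. -/
def inFrame {n : ℕ} (P B : Matrix (Fin n) (Fin n) ℝ) : Matrix (Fin n) (Fin n) ℝ :=
  Pᵀ * B * P

/-- `η = (σ - νⁿ⁺¹) / u`. -/
noncomputable def eta {n : ℕ} (σ : ℝ) (u : Euc n → ℝ) (x : Euc n) : ℝ :=
  (σ - eucNormal u x (Fin.last n)) / u x

/-! ### Curvature functions -/

/-- The open positive cone `Kₙ⁺`. -/
def posCone (n : ℕ) : Set (Fin n → ℝ) := {lam | ∀ i, 0 < lam i}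

/-- The partial derivative `fᵢ = ∂f/∂λᵢ`. -/
noncomputable def fpd {n : ℕ} (f : (Fin n → ℝ) → ℝ) (i : Fin n) (lam : Fin n → ℝ) : ℝ :=
  fderiv ℝ f lam (Pi.single i 1)

/-- The standing structure conditions on the curvature function `f`. -/
structure IsCurvatureFunction {n : ℕ} (f : (Fin n → ℝ) → ℝ) : Prop where
  smooth : ContDiffOn ℝ ∞ f (posCone n)
  continuous : ContinuousOn f (closure (posCone n))
  symmetric : ∀ (π : Equiv.Perm (Fin n)), ∀ lam ∈ posCone n, f (fun i => lam (π i)) = f lam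
  fpd_pos : ∀ lam ∈ posCone n, ∀ i, 0 < fpd f i lam
  concave : ConcaveOn ℝ (posCone n) f
  pos : ∀ lam ∈ posCone n, 0 < f lam
  zero_frontier : ∀ lam ∈ frontier (posCone n), f lam = 0
  normalized : f (fun _ => 1) = 1
  homogeneous : ∀ t : ℝ, 0 < t → ∀ lam ∈ posCone n, f (t • lam) = t * f lam
  /-- `lim_{R → ∞} f (λ₁, …, λₙ₋₁, λₙ + R) ≥ 1 + ε₀` uniformly for `λ` near `(1, …, 1)`. -/
  growth : ∃ ε₀ : ℝ, 0 < ε₀ ∧ ∃ δ₀ : ℝ, 0 < δ₀ ∧ ∀ ε' : ℝ, ε' < ε₀ → ∃ R₀ : ℝ, ∀ R : ℝ, R₀ ≤ R →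
    ∀ lam ∈ Metric.ball (fun _ => 1) δ₀ ∩ posCone n, ∀ i : Fin n, (i : ℕ) + 1 = n →
      1 + ε' ≤ f (Function.update lam i (lam i + R))

open Classical in
/-- `F(A) = f(λ(A))` for a symmetric matrix `A` with eigenvalues `λ(A)`. -/
noncomputable def spectralF {n : ℕ} (f : (Fin n → ℝ) → ℝ) (A : Matrix (Fin n) (Fin n) ℝ) : ℝ :=
  if h : A.IsHermitian then f h.eigenvalues else 0

/-- `Φ = (Fⁱʲ(A))`, `Fⁱʲ = ∂F/∂aᵢⱼ`: the symmetric matrix that represents the derivative of `F`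
at `A` in the space of symmetric matrices. -/
def IsFGradient {n : ℕ} (f : (Fin n → ℝ) → ℝ) (A Φ : Matrix (Fin n) (Fin n) ℝ) : Prop :=
  Φ.IsSymm ∧ ∀ S : Matrix (Fin n) (Fin n) ℝ, S.IsSymm →
    HasDerivAt (fun t : ℝ => spectralF f (A + t • S)) (∑ i, ∑ j, Φ i j * S i j) 0

/-- The graph of `u` over `Ω` is a smooth strictly locally convex hypersurface of hyperbolic
space (all principal curvatures positive for the upward normal) with `f(κ) = σ`. -/
structure IsConvexGraph {n : ℕ} (f : (Fin n → ℝ) → ℝ) (σ : ℝ) (Ω : Set (Euc n))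
    (u : Euc n → ℝ) : Prop where
  smooth : ContDiffOn ℝ ∞ u Ω
  pos : ∀ x ∈ Ω, 0 < u x
  convex : ∀ x ∈ Ω, ∀ κ, IsPrincipalCurvatures u x κ → ∀ i, 0 < κ i
  curvature_eq : ∀ x ∈ Ω, ∀ κ, IsPrincipalCurvatures u x κ → f κ = σ

/-! ### Domains -/

/-- `Ω` has smooth boundary: near each boundary point it is a sublevel set `{ρ < 0}` of a smooth
function `ρ` with nonvanishing differential there. -/
def HasSmoothBoundary {n : ℕ} (Ω : Set (Euc n)) : Prop :=
  ∀ x₀ ∈ frontier Ω, ∃ U : Set (Euc n), IsOpen U ∧ x₀ ∈ U ∧ ∃ ρ : Euc n → ℝ,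
    ContDiffOn ℝ ∞ ρ U ∧ fderiv ℝ ρ x₀ ≠ 0 ∧ Ω ∩ U = {x ∈ U | ρ x < 0}

/-- `∂Ω` has exterior tangent spheres of radius `r`: every boundary point of `Ω` lies on a sphere
of radius `r` bounding a ball outside `Ω`. -/
def HasExteriorSpheres {n : ℕ} (Ω : Set (Euc n)) (r : ℝ) : Prop :=
  ∀ x₀ ∈ frontier Ω, ∃ c : Euc n, dist x₀ c = r ∧ Disjoint (Metric.ball c r) Ω

/-!
The quantity `η = (σ - ν) / u` is a combination of the two ambient functions `1 / u` and `ν / u`,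
which on a hypersurface of hyperbolic space satisfy
`∇²(1/u) = (g - ν h) / u` and `∇²(ν/u) = ∇h(·, ·, ∇(1/u)) + (h - ν h²) / u`.
Contracting with `Fⁱʲ`, the term in `∇h` disappears because `F(h) = σ` is constant
(`IsConvexGraph.sum_fpd_mul_deriv_eq_zero`), and for every constant `c`
`Fⁱʲ ∇ᵢⱼ((c - ν)/u) = (c (∑ fᵢ - σ ν) - σ + ν ∑ fᵢ κᵢ²) / u`
(`IsConvexGraph.sum_fpd_mul_quad_covHess_eta`). For `c = σ` the Cauchy-Schwarz inequality
`σ² = (∑ fᵢ κᵢ)² ≤ ∑ fᵢ ∑ fᵢ κᵢ²` and `∑ fᵢ ≥ 1` (concavity and homogeneity of `f`) give the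
differential inequality. The Hessians are computed in graph coordinates and evaluated on principal
vectors (`quad_covHess_eta`), where the eigenvector equation reduces the Euclidean Hessian of `u`
to a scalar.

The function `F` of a matrix is differentiated without differentiating eigenvalues. Schur's
inequality `f(λ(A)) ≤ f(diag(Rᵀ A R))` for orthogonal `R` (`IsDiagonalization.le_diag`, from
Birkhoff's theorem and concavity) bounds `F(A + tS) - F(A)` above in the eigenbasis of `A` and below
in that of `A + tS`; the two bounds agree to first order since eigenbases are compact and
`U diag(fᵢ(λ)) Uᵀ` does not depend on the choice of the eigenbasis.

For `c > σ` the function `(c - ν) / u = η + (c - σ) / u` is a strict subsolution. This perturbation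
gives the maximum principle (`IsConvexGraph.eta_le_of_frontier`) without any bounds on the
coefficients of the operator near the boundary.

At the boundary the graph is compared with spheres. The Euclidean ball of radius `t` about a point
at height `s t` has all principal curvatures `s`, so for `s < σ` its lower part cannot touch the
graph from outside at an interior point (`IsConvexGraph.not_touch_lower_cap`). Expanding such balls
from the centre of an exterior tangent ball (`IsConvexGraph.cap_comparison`), up to the one that
meets the height `ε` over the tangent sphere, and using `u ≥ ε`, bounds the gradient of `u` at the
boundary; then `s → σ`.
-/

/-! ### Partial derivatives -/

theorem hasDerivAt_line {m : ℕ} {v : Euc m → ℝ} {x : Euc m} (hv : DifferentiableAt ℝ v x)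
    (e : Euc m) : HasDerivAt (fun t : ℝ => v (x + t • e)) (fderiv ℝ v x e) 0 := by
  have h1 : HasDerivAt (fun t : ℝ => x + t • e) e 0 := by
    simpa using ((hasDerivAt_id (0 : ℝ)).smul_const e).const_add x
  have h2 : HasFDerivAt v (fderiv ℝ v x) (x + (0 : ℝ) • e) := by simpa using hv.hasFDerivAt
  exact h2.comp_hasDerivAt 0 h1

theorem fderiv_apply_eq_sum {m : ℕ} (v : Euc m → ℝ) (x e : Euc m) :
    fderiv ℝ v x e = ∑ i, e i * pd i v x := by
  have : e = ∑ i, e i • EuclideanSpace.single i (1 : ℝ) := by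
    ext j
    simp [Finset.sum_apply, Pi.single_apply]
  conv_lhs => rw [this]
  simp [map_sum, pd]

theorem hasDerivAt_pd {m : ℕ} {v : Euc m → ℝ} {x : Euc m} (hv : DifferentiableAt ℝ v x)
    (i : Fin m) :
    HasDerivAt (fun t : ℝ => v (x + t • EuclideanSpace.single i 1)) (pd i v x) 0 :=
  hasDerivAt_line hv _

theorem hasDerivAt_line_sum {m : ℕ} {v : Euc m → ℝ} {x : Euc m} (hv : DifferentiableAt ℝ v x)
    (e : Euc m) :
    HasDerivAt (fun t : ℝ => v (x + t • e)) (∑ i, e i * pd i v x) 0 := by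
  rw [← fderiv_apply_eq_sum]
  exact hasDerivAt_line hv e

theorem pd_eq_of_hasDerivAt {m : ℕ} {v : Euc m → ℝ} {x : Euc m} (hv : DifferentiableAt ℝ v x)
    {i : Fin m} {d : ℝ}
    (h : HasDerivAt (fun t : ℝ => v (x + t • EuclideanSpace.single i 1)) d 0) : pd i v x = d :=
  (hasDerivAt_pd hv i).unique h

theorem pd_congr {m : ℕ} {v v' : Euc m → ℝ} {x : Euc m} (h : v =ᶠ[nhds x] v') (i : Fin m) :
    pd i v x = pd i v' x := by
  simp only [pd, h.fderiv_eq]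

theorem pd_coord {m : ℕ} (i k : Fin m) (x : Euc m) :
    pd i (fun z => z k) x = if k = i then 1 else 0 := by
  apply pd_eq_of_hasDerivAt (by fun_prop)
  have := ((hasDerivAt_id (0 : ℝ)).mul_const (if k = i then (1 : ℝ) else 0)).const_add (x k)
  simpa [Pi.single_apply] using this

theorem ContDiffOn.pd {m : ℕ} {v : Euc m → ℝ} {s : Set (Euc m)} (hv : ContDiffOn ℝ ∞ v s)
    (hs : IsOpen s) (i : Fin m) : ContDiffOn ℝ ∞ (pd i v) s := by
  have := hv.fderiv_of_isOpen (m := ∞) hs (by simp)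
  exact this.clm_apply contDiffOn_const

theorem ContDiffOn.differentiableAt_of_isOpen {m : ℕ} {v : Euc m → ℝ} {s : Set (Euc m)}
    (hv : ContDiffOn ℝ ∞ v s) (hs : IsOpen s) {x : Euc m} (hx : x ∈ s) :
    DifferentiableAt ℝ v x :=
  (hv.differentiableOn (by simp)).differentiableAt (hs.mem_nhds hx)

theorem pd_pd_eq {m : ℕ} {v : Euc m → ℝ} {s : Set (Euc m)} (hv : ContDiffOn ℝ ∞ v s)
    (hs : IsOpen s) {x : Euc m} (hx : x ∈ s) (i j : Fin m) :
    pd i (pd j v) x = fderiv ℝ (fderiv ℝ v) x (EuclideanSpace.single i 1)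
      (EuclideanSpace.single j 1) := by
  have h1 : DifferentiableAt ℝ (fderiv ℝ v) x :=
    ((hv.fderiv_of_isOpen (m := ∞) hs (by simp)).differentiableOn (by simp)).differentiableAt
      (hs.mem_nhds hx)
  have : HasFDerivAt (fun z => fderiv ℝ v z (EuclideanSpace.single j 1)) _ x :=
    h1.hasFDerivAt.clm_apply (hasFDerivAt_const _ _)
  unfold _root_.pd
  rw [this.fderiv]
  simp

theorem pd_comm {m : ℕ} {v : Euc m → ℝ} {s : Set (Euc m)} (hv : ContDiffOn ℝ ∞ v s)
    (hs : IsOpen s) {x : Euc m} (hx : x ∈ s) (i j : Fin m) :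
    pd i (pd j v) x = pd j (pd i v) x := by
  rw [pd_pd_eq hv hs hx, pd_pd_eq hv hs hx]
  have h2 : (2 : WithTop ℕ∞) ≤ ∞ := WithTop.coe_le_coe.2 (le_top : (2 : ℕ∞) ≤ ⊤)
  exact ((hv.contDiffAt (hs.mem_nhds hx)).isSymmSndFDerivAt (by simpa using h2)) _ _

theorem pd_pd_pd_comm {m : ℕ} {v : Euc m → ℝ} {s : Set (Euc m)} (hv : ContDiffOn ℝ ∞ v s)
    (hs : IsOpen s) {x : Euc m} (hx : x ∈ s) (i j k : Fin m) :
    pd i (pd j (pd k v)) x = pd k (pd i (pd j v)) x := by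
  rw [pd_congr (v' := _root_.pd k (_root_.pd j v)) _ i]
  · exact pd_comm (hv.pd hs j) hs hx i k
  · filter_upwards [hs.mem_nhds hx] with y hy using pd_comm hv hs hy j k

/-! ### Second order conditions at an extremum -/

/-- Were the second derivative positive, the point would also be a local minimum by the second
derivative test, and the function would be locally constant. -/
theorem deriv_deriv_nonpos_of_isLocalMax {φ : ℝ → ℝ} {t : ℝ} (hφ : ContinuousAt φ t)
    (h : IsLocalMax φ t) : deriv (deriv φ) t ≤ 0 := by
  by_contra! hpos
  have hmin := isLocalMin_of_deriv_deriv_pos hpos h.deriv_eq_zero hφ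
  have hc : φ =ᶠ[nhds t] fun _ => φ t := by
    filter_upwards [h, hmin] with s h1 h2 using le_antisymm h1 h2
  have h1 : deriv φ =ᶠ[nhds t] fun _ => 0 := by
    filter_upwards [hc.eventuallyEq_nhds] with s hs
    rw [hs.deriv_eq]; simp
  rw [h1.deriv_eq] at hpos
  simp at hpos

theorem pd_eq_zero_of_isLocalMax {m : ℕ} {v : Euc m → ℝ} {x : Euc m} (h : IsLocalMax v x)
    (i : Fin m) : pd i v x = 0 := by
  simp [pd, h.fderiv_eq_zero]

theorem sum_pd_pd_nonpos_of_isLocalMax {m : ℕ} {v : Euc m → ℝ} {s : Set (Euc m)}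
    (hv : ContDiffOn ℝ ∞ v s) (hs : IsOpen s) {x : Euc m} (hx : x ∈ s) (h : IsLocalMax v x)
    (e : Euc m) : ∑ i, ∑ j, e i * e j * pd i (pd j v) x ≤ 0 := by
  have hc : ContinuousAt (fun t : ℝ => x + t • e) 0 := by fun_prop
  have hc0 : Filter.Tendsto (fun t : ℝ => x + t • e) (nhds 0) (nhds x) := by
    simpa using hc.tendsto
  have hmax : IsLocalMax (fun t : ℝ => v (x + t • e)) 0 := by
    filter_upwards [hc0.eventually h] with t ht
    simpa using ht
  have hcont : ContinuousAt (fun t : ℝ => v (x + t • e)) 0 :=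
    (hasDerivAt_line (hv.differentiableAt_of_isOpen hs hx) e).continuousAt
  have hd : deriv (fun t : ℝ => v (x + t • e)) =ᶠ[nhds 0]
      fun t => ∑ j, e j * pd j v (x + t • e) := by
    filter_upwards [hc0.eventually (hs.mem_nhds hx)] with t ht
    have := hasDerivAt_line_sum (hv.differentiableAt_of_isOpen hs ht) e
    have h2 : HasDerivAt (fun r : ℝ => r - t) 1 t := by
      simpa using (hasDerivAt_id t).sub_const t
    have h3 : HasDerivAt (fun t' : ℝ => v (x + t • e + t' • e))
        (∑ j, e j * pd j v (x + t • e)) ((fun r : ℝ => r - t) t) := by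
      simpa using this
    have h4 := HasDerivAt.comp (h₂ := fun t' : ℝ => v (x + t • e + t' • e))
      (h := fun r : ℝ => r - t)
      t h3 h2
    rw [mul_one] at h4
    refine HasDerivAt.deriv (h4.congr_of_eventuallyEq (Filter.Eventually.of_forall fun r => ?_))
    simp only [Function.comp]
    congr 1
    module
  have h1 := deriv_deriv_nonpos_of_isLocalMax hcont hmax
  rw [hd.deriv_eq] at h1
  have h2 : HasDerivAt (fun t : ℝ => ∑ j, e j * pd j v (x + t • e))
      (∑ j, e j * ∑ i, e i * pd i (pd j v) x) 0 :=
    HasDerivAt.fun_sum fun j _ =>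
      (hasDerivAt_line_sum ((hv.pd hs j).differentiableAt_of_isOpen hs hx) e).const_mul (e j)
  rw [h2.deriv] at h1
  rw [Finset.sum_comm]
  convert h1 using 3 with j _
  rw [Finset.mul_sum]
  exact Finset.sum_congr rfl fun i _ => by ring

/-! ### The fundamental forms of a graph -/

theorem graphMap_castSucc {n : ℕ} (u : Euc n → ℝ) (x : Euc n) (k : Fin n) :
    graphMap u x k.castSucc = x k := by
  simp [graphMap]

theorem graphMap_last {n : ℕ} (u : Euc n → ℝ) (x : Euc n) :
    graphMap u x (Fin.last n) = u x := by
  simp [graphMap]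

theorem tangentVec_castSucc {n : ℕ} (u : Euc n → ℝ) (i : Fin n) (x : Euc n) (k : Fin n) :
    tangentVec u i x k.castSucc = if k = i then 1 else 0 := by
  simp only [tangentVec, graphMap_castSucc, pd_coord]

theorem tangentVec_last {n : ℕ} (u : Euc n → ℝ) (i : Fin n) (x : Euc n) :
    tangentVec u i x (Fin.last n) = pd i u x := by
  simp only [tangentVec, graphMap_last]

theorem firstForm_apply {n : ℕ} (u : Euc n → ℝ) (x : Euc n) (i j : Fin n) :
    firstForm u x i j = ((if i = j then 1 else 0) + pd i u x * pd j u x) / (u x) ^ 2 := by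
  simp only [firstForm, Matrix.of_apply, hypMetric, graphMap_last]
  simp only [ite_div, zero_div, ite_mul, zero_mul, Finset.sum_ite_eq, Finset.mem_univ, if_true]
  rw [Fin.sum_univ_castSucc]
  simp only [tangentVec_castSucc, tangentVec_last, mul_ite, mul_zero, mul_one,
    Finset.sum_ite_eq', Finset.mem_univ, if_true]
  by_cases h : i = j
  · subst h; simp; ring
  · have h' : ¬ j = i := fun e => h e.symm
    simp [h, h']; ring

theorem pd_hypMetric {n : ℕ} {y : Euc (n + 1)} (hy : y (Fin.last n) ≠ 0) (a b c : Fin (n + 1)) :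
    pd a (fun z => hypMetric n z b c) y =
      if b = c then (if a = Fin.last n then -2 / (y (Fin.last n)) ^ 3 else 0) else 0 := by
  by_cases hbc : b = c
  · simp only [hypMetric, Matrix.of_apply, hbc, if_true]
    have hd : DifferentiableAt ℝ (fun z : Euc (n + 1) => z (Fin.last n)) y := by fun_prop
    have h1 := hasDerivAt_pd hd a
    rw [pd_coord] at h1
    have h2 := (h1.fun_pow 2).fun_inv (by simpa using hy)
    have hd2 : DifferentiableAt ℝ (fun z : Euc (n + 1) => ((z (Fin.last n)) ^ 2)⁻¹) y :=
      (hd.fun_pow 2).fun_inv (by simpa using hy)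
    simp only [one_div]
    refine pd_eq_of_hasDerivAt hd2 (h2.congr_deriv ?_)
    by_cases ha : a = Fin.last n
    · simp [ha]; field_simp
    · simp [ha, Ne.symm ha]
  · simp only [hypMetric, Matrix.of_apply, hbc, if_false, zero_div]
    simp [pd]

theorem hypMetric_inv {n : ℕ} {y : Euc (n + 1)} (hy : y (Fin.last n) ≠ 0) (a b : Fin (n + 1)) :
    (hypMetric n y)⁻¹ a b = if a = b then (y (Fin.last n)) ^ 2 else 0 := by
  have h1 : hypMetric n y = (1 / (y (Fin.last n)) ^ 2) • (1 : Matrix _ _ ℝ) := by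
    ext a b
    simp [hypMetric, Matrix.one_apply, div_eq_mul_inv]
  have h2 : (hypMetric n y)⁻¹ = ((y (Fin.last n)) ^ 2) • (1 : Matrix _ _ ℝ) := by
    apply Matrix.inv_eq_right_inv
    rw [h1, Matrix.smul_mul, Matrix.mul_smul, smul_smul]
    simp [hy]
  rw [h2]
  simp [Matrix.one_apply]

theorem christoffel_hypMetric {n : ℕ} {y : Euc (n + 1)} (hy : y (Fin.last n) ≠ 0)
    (c a b : Fin (n + 1)) :
    christoffel (hypMetric n) y c a b = (1 / y (Fin.last n)) *
      (-(if b = c then (if a = Fin.last n then 1 else 0) else 0)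
        - (if a = c then (if b = Fin.last n then 1 else 0) else 0)
        + (if a = b then (if c = Fin.last n then 1 else 0) else 0)) := by
  simp only [christoffel, hypMetric_inv hy, pd_hypMetric hy, ite_mul, zero_mul,
    Finset.sum_ite_eq, Finset.mem_univ, if_true]
  split_ifs <;> field_simp <;> ring

theorem ambientDeriv_castSucc {n : ℕ} {u : Euc n → ℝ} {x : Euc n} (hu : u x ≠ 0)
    (i j k : Fin n) : ambientDeriv u x i j k.castSucc =
      -(1 / u x) * ((if k = j then pd i u x else 0) + (if k = i then pd j u x else 0)) := by
  have h0 : pd i (fun z => tangentVec u j z k.castSucc) x = 0 := by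
    simp only [tangentVec_castSucc]
    simp [pd]
  have hu' : graphMap u x (Fin.last n) ≠ 0 := by rwa [graphMap_last]
  have hk : k.castSucc ≠ Fin.last n := (Fin.castSucc_lt_last k).ne
  simp only [ambientDeriv, h0, christoffel_hypMetric hu', graphMap_last, hk, if_false, ite_self,
    add_zero, zero_add]
  simp only [mul_sub, sub_mul, Finset.sum_sub_distrib, mul_neg, neg_mul, Finset.sum_neg_distrib,
    mul_ite, ite_mul, mul_zero, zero_mul, mul_one, Finset.sum_ite_eq',
    Finset.mem_univ, if_true, tangentVec_castSucc, tangentVec_last]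
  simp only [Finset.sum_ite_irrel, Finset.sum_ite_eq', Finset.mem_univ, if_true,
    Finset.sum_const_zero, tangentVec_last, tangentVec_castSucc]
  split_ifs <;> ring

theorem ambientDeriv_last {n : ℕ} {u : Euc n → ℝ} {x : Euc n} (hu : u x ≠ 0)
    (i j : Fin n) : ambientDeriv u x i j (Fin.last n) =
      pd i (pd j u) x + (1 / u x) * ((if i = j then 1 else 0) - pd i u x * pd j u x) := by
  have h0 : pd i (fun z => tangentVec u j z (Fin.last n)) x = pd i (pd j u) x := by
    simp only [tangentVec_last]
  have hu' : graphMap u x (Fin.last n) ≠ 0 := by rwa [graphMap_last]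
  have h1 : ∑ a, tangentVec u i x a * tangentVec u j x a =
      (if i = j then 1 else 0) + pd i u x * pd j u x := by
    rw [Fin.sum_univ_castSucc]
    simp [tangentVec_castSucc, tangentVec_last, eq_comm]
  simp only [ambientDeriv, h0, christoffel_hypMetric hu', graphMap_last, if_true]
  simp only [mul_sub, sub_mul, mul_add, add_mul, Finset.sum_add_distrib, Finset.sum_sub_distrib,
    mul_neg, neg_mul, Finset.sum_neg_distrib,
    mul_ite, ite_mul, mul_zero, zero_mul, mul_one, Finset.sum_ite_eq, Finset.sum_ite_eq',
    Finset.mem_univ, if_true, tangentVec_last]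
  simp only [Finset.sum_ite_irrel, Finset.sum_ite_eq', Finset.mem_univ, if_true,
    Finset.sum_const_zero, tangentVec_last, mul_assoc, ← Finset.mul_sum, h1]
  split_ifs <;> ring

theorem slopeW_pos {n : ℕ} (u : Euc n → ℝ) (x : Euc n) : 0 < slopeW u x := by
  unfold slopeW
  positivity

theorem slopeW_sq {n : ℕ} (u : Euc n → ℝ) (x : Euc n) :
    slopeW u x ^ 2 = 1 + ∑ i, pd i u x * pd i u x := by
  unfold slopeW
  rw [Real.sq_sqrt (by positivity)]
  simp [sq]

theorem one_le_slopeW {n : ℕ} (u : Euc n → ℝ) (x : Euc n) : 1 ≤ slopeW u x := by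
  unfold slopeW
  rw [Real.one_le_sqrt]
  have : 0 ≤ ∑ i, (pd i u x) ^ 2 := by positivity
  linarith

theorem eta_eq {n : ℕ} (s : ℝ) (u : Euc n → ℝ) (x : Euc n) :
    eta s u x = (s - 1 / slopeW u x) / u x := by
  simp [eta, eucNormal]

theorem secondForm_apply {n : ℕ} {u : Euc n → ℝ} {x : Euc n} (hu : u x ≠ 0) (i j : Fin n) :
    secondForm u x i j = pd i (pd j u) x / (u x * slopeW u x) +
      ((if i = j then 1 else 0) + pd i u x * pd j u x) / (u x ^ 2 * slopeW u x) := by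
  have hw := (slopeW_pos u x).ne'
  simp only [secondForm, Matrix.of_apply, hypMetric, graphMap_last]
  simp only [ite_div, zero_div, ite_mul, zero_mul, Finset.sum_ite_eq, Finset.mem_univ, if_true]
  rw [Fin.sum_univ_castSucc]
  simp only [ambientDeriv_castSucc hu, ambientDeriv_last hu, hypNormal, eucNormal,
    Fin.snoc_castSucc, Fin.snoc_last]
  simp only [mul_add, add_mul, mul_ite, ite_mul, mul_zero, zero_mul, Finset.sum_add_distrib,
    Finset.sum_ite_eq', Finset.mem_univ, if_true]
  split_ifs <;> field_simp <;> ring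

/-! ### The covariant Hessian of `η` in graph coordinates -/

/-- The Euclidean gradient `∇u`, as a coordinate vector. -/
noncomputable def gradVec {n : ℕ} (u : Euc n → ℝ) (x : Euc n) : Fin n → ℝ :=
  fun i => pd i u x

/-- The Euclidean Hessian `D²u`. -/
noncomputable def hessMat {n : ℕ} (u : Euc n → ℝ) (x : Euc n) : Matrix (Fin n) (Fin n) ℝ :=
  Matrix.of fun i j => pd i (pd j u) x

/-- The derivative of the Hessian `D²u` in the direction `∇u`. -/
noncomputable def hessGradMat {n : ℕ} (u : Euc n → ℝ) (x : Euc n) :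
    Matrix (Fin n) (Fin n) ℝ :=
  Matrix.of fun i j => ∑ k, gradVec u x k * pd k (pd i (pd j u)) x

/-- The value `X(τ, τ)` of the bilinear form `X`, as a linear function of `X`. -/
def quad {n : ℕ} (τ : Fin n → ℝ) : Matrix (Fin n) (Fin n) ℝ →ₗ[ℝ] ℝ where
  toFun X := ∑ i, ∑ j, τ i * τ j * X i j
  map_add' X Y := by simp [mul_add, Finset.sum_add_distrib]
  map_smul' c X := by
    simp only [Matrix.smul_apply, smul_eq_mul, RingHom.id_apply, Finset.mul_sum]
    exact Finset.sum_congr rfl fun i _ => Finset.sum_congr rfl fun j _ => by ring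

theorem quad_apply {n : ℕ} (τ : Fin n → ℝ) (X : Matrix (Fin n) (Fin n) ℝ) :
    quad τ X = ∑ i, ∑ j, τ i * τ j * X i j := rfl

theorem quad_eq_dotProduct {n : ℕ} (τ : Fin n → ℝ) (X : Matrix (Fin n) (Fin n) ℝ) :
    quad τ X = τ ⬝ᵥ X *ᵥ τ := by
  simp only [quad_apply, dotProduct, Matrix.mulVec, Finset.mul_sum]
  exact Finset.sum_congr rfl fun i _ => Finset.sum_congr rfl fun j _ => by ring

theorem quad_vecMulVec {n : ℕ} (τ a b : Fin n → ℝ) :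
    quad τ (Matrix.vecMulVec a b) = (τ ⬝ᵥ a) * (τ ⬝ᵥ b) := by
  simp only [quad_apply, Matrix.vecMulVec_apply, dotProduct, Finset.sum_mul_sum]
  exact Finset.sum_congr rfl fun i _ => Finset.sum_congr rfl fun j _ => by ring

theorem quad_one {n : ℕ} (τ : Fin n → ℝ) : quad τ 1 = τ ⬝ᵥ τ := by
  simp [quad_eq_dotProduct]

theorem firstForm_eq {n : ℕ} (u : Euc n → ℝ) (x : Euc n) :
    firstForm u x = (1 / u x ^ 2) • (1 + Matrix.vecMulVec (gradVec u x) (gradVec u x)) := by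
  ext i j
  simp [firstForm_apply, Matrix.one_apply, Matrix.vecMulVec_apply, gradVec]
  ring

theorem secondForm_eq {n : ℕ} {u : Euc n → ℝ} {x : Euc n} (hu : u x ≠ 0) :
    secondForm u x = (1 / (u x * slopeW u x)) • hessMat u x +
      (1 / slopeW u x) • firstForm u x := by
  ext i j
  simp [secondForm_apply hu, firstForm_apply, hessMat]
  ring

theorem slopeW_sq' {n : ℕ} (u : Euc n → ℝ) (x : Euc n) :
    slopeW u x ^ 2 = 1 + gradVec u x ⬝ᵥ gradVec u x :=
  slopeW_sq u x

theorem vecMulVec_mul_self {n : ℕ} (p : Fin n → ℝ) :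
    Matrix.vecMulVec p p * Matrix.vecMulVec p p = (p ⬝ᵥ p) • Matrix.vecMulVec p p := by
  rw [Matrix.vecMulVec_mul_vecMulVec, Matrix.vecMulVec_smul]

theorem firstForm_inv {n : ℕ} {u : Euc n → ℝ} {x : Euc n} (hu : u x ≠ 0) :
    (firstForm u x)⁻¹ = (u x ^ 2) •
      (1 - (1 / slopeW u x ^ 2) • Matrix.vecMulVec (gradVec u x) (gradVec u x)) := by
  apply Matrix.inv_eq_right_inv
  have hw := (slopeW_pos u x).ne'
  have hS := slopeW_sq' u x
  rw [firstForm_eq, Matrix.smul_mul, Matrix.mul_smul, smul_smul,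
    show (1 / u x ^ 2 * u x ^ 2) = 1 by field_simp, one_smul]
  simp only [Matrix.mul_smul, add_mul, mul_sub, one_mul, mul_one, vecMulVec_mul_self, smul_smul]
  rw [show gradVec u x ⬝ᵥ gradVec u x = slopeW u x ^ 2 - 1 by linarith,
    show (1 / slopeW u x ^ 2 * (slopeW u x ^ 2 - 1)) = 1 - 1 / slopeW u x ^ 2 by field_simp]
  module

section Smooth

variable {n : ℕ} {u : Euc n → ℝ} {s : Set (Euc n)} {x : Euc n}

theorem hasDerivAt_line_pd (hu : ContDiffOn ℝ ∞ u s) (hs : IsOpen s) (hx : x ∈ s) (e : Euc n)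
    (k : Fin n) :
    HasDerivAt (fun t : ℝ => pd k u (x + t • e)) (fderiv ℝ (pd k u) x e) 0 :=
  hasDerivAt_line ((hu.pd hs k).differentiableAt_of_isOpen hs hx) e

theorem hasDerivAt_line_slopeW (hu : ContDiffOn ℝ ∞ u s) (hs : IsOpen s) (hx : x ∈ s)
    (e : Euc n) :
    HasDerivAt (fun t : ℝ => slopeW u (x + t • e))
      ((∑ k, pd k u x * fderiv ℝ (pd k u) x e) / slopeW u x) 0 := by
  have h1 : HasDerivAt (fun t : ℝ => 1 + ∑ k, pd k u (x + t • e) ^ 2)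
      (∑ k, 2 * pd k u x * fderiv ℝ (pd k u) x e) 0 := by
    refine HasDerivAt.const_add _ (HasDerivAt.fun_sum fun k _ => ?_)
    simpa using (hasDerivAt_line_pd hu hs hx e k).fun_pow 2
  have h2 := h1.sqrt (by positivity)
  refine h2.congr_deriv ?_
  have hw := (slopeW_pos u x).ne'
  simp only [zero_smul, add_zero]
  rw [show √(1 + ∑ k, pd k u x ^ 2) = slopeW u x from rfl]
  simp only [mul_assoc, ← Finset.mul_sum]
  field_simp

theorem differentiableAt_slopeW (hu : ContDiffOn ℝ ∞ u s) (hs : IsOpen s) (hx : x ∈ s) :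
    DifferentiableAt ℝ (slopeW u) x := by
  have h : DifferentiableAt ℝ (fun z => 1 + ∑ k, pd k u z ^ 2) x := by
    refine DifferentiableAt.const_add _ (DifferentiableAt.fun_sum fun k _ => ?_)
    exact ((hu.pd hs k).differentiableAt_of_isOpen hs hx).fun_pow 2
  exact h.sqrt (by positivity)

theorem contDiffOn_slopeW (hu : ContDiffOn ℝ ∞ u s) (hs : IsOpen s) :
    ContDiffOn ℝ ∞ (slopeW u) s := by
  have h : ContDiffOn ℝ ∞ (fun z => 1 + ∑ k, pd k u z ^ 2) s :=
    contDiffOn_const.add (ContDiffOn.sum fun k _ => (hu.pd hs k).pow 2)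
  exact h.sqrt fun z _ => by positivity

theorem contDiffOn_eta (c : ℝ) (hu : ContDiffOn ℝ ∞ u s) (hs : IsOpen s)
    (h0 : ∀ z ∈ s, u z ≠ 0) : ContDiffOn ℝ ∞ (eta c u) s := by
  have : ContDiffOn ℝ ∞ (fun z => (c - 1 / slopeW u z) / u z) s :=
    (contDiffOn_const.sub (contDiffOn_const.div (contDiffOn_slopeW hu hs)
      fun z _ => (slopeW_pos u z).ne')).div hu h0
  exact this.congr fun z _ => eta_eq c u z

theorem hasDerivAt_line_firstForm (hu : ContDiffOn ℝ ∞ u s) (hs : IsOpen s) (hx : x ∈ s)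
    (h0 : u x ≠ 0) (e : Euc n) (i j : Fin n) :
    HasDerivAt (fun t : ℝ => firstForm u (x + t • e) i j)
      ((fderiv ℝ (pd i u) x e * pd j u x + pd i u x * fderiv ℝ (pd j u) x e) / u x ^ 2
        - 2 * fderiv ℝ u x e * ((if i = j then 1 else 0) + pd i u x * pd j u x) / u x ^ 3) 0 := by
  simp only [firstForm_apply]
  have h1 := hasDerivAt_line (hu.differentiableAt_of_isOpen hs hx) e
  have hi := hasDerivAt_line_pd hu hs hx e i
  have hj := hasDerivAt_line_pd hu hs hx e j
  have h2 := ((hi.fun_mul hj).const_add (if i = j then (1 : ℝ) else 0)).fun_div (h1.fun_pow 2)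
    (by simpa using h0)
  refine h2.congr_deriv ?_
  simp only [zero_smul, add_zero]
  field_simp
  ring

theorem hasDerivAt_line_secondForm (hu : ContDiffOn ℝ ∞ u s) (hs : IsOpen s) (hx : x ∈ s)
    (h0 : u x ≠ 0) (e : Euc n) (i j : Fin n) :
    HasDerivAt (fun t : ℝ => secondForm u (x + t • e) i j)
      (fderiv ℝ (pd i (pd j u)) x e / (u x * slopeW u x)
        - pd i (pd j u) x * (fderiv ℝ u x e * slopeW u x
            + u x * ((∑ k, pd k u x * fderiv ℝ (pd k u) x e) / slopeW u x))
            / (u x * slopeW u x) ^ 2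
        + (fderiv ℝ (pd i u) x e * pd j u x + pd i u x * fderiv ℝ (pd j u) x e)
            / (u x ^ 2 * slopeW u x)
        - ((if i = j then 1 else 0) + pd i u x * pd j u x) *
            (2 * u x * fderiv ℝ u x e * slopeW u x
              + u x ^ 2 * ((∑ k, pd k u x * fderiv ℝ (pd k u) x e) / slopeW u x))
            / (u x ^ 2 * slopeW u x) ^ 2) 0 := by
  have hw := (slopeW_pos u x).ne'
  have h1 := hasDerivAt_line (hu.differentiableAt_of_isOpen hs hx) e
  have hi := hasDerivAt_line_pd hu hs hx e i
  have hj := hasDerivAt_line_pd hu hs hx e j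
  have hij := hasDerivAt_line_pd (hu.pd hs j) hs hx e i
  have hW := hasDerivAt_line_slopeW hu hs hx e
  have h2 := (hij.fun_div (h1.fun_mul hW) (by simpa using ⟨h0, hw⟩)).fun_add
    (((hi.fun_mul hj).const_add (if i = j then (1 : ℝ) else 0)).fun_div
      ((h1.fun_pow 2).fun_mul hW) (by simpa using ⟨h0, hw⟩))
  have hev : (fun t : ℝ => secondForm u (x + t • e) i j) =ᶠ[nhds 0] fun t : ℝ =>
      pd i (pd j u) (x + t • e) / (u (x + t • e) * slopeW u (x + t • e)) +
      ((if i = j then 1 else 0) + pd i u (x + t • e) * pd j u (x + t • e)) /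
        (u (x + t • e) ^ 2 * slopeW u (x + t • e)) := by
    have : ∀ᶠ t in nhds (0 : ℝ), u (x + t • e) ≠ 0 :=
      h1.continuousAt.eventually_ne (by simpa using h0)
    filter_upwards [this] with t ht using secondForm_apply ht i j
  refine HasDerivAt.congr_of_eventuallyEq (h2.congr_deriv ?_) hev
  simp only [zero_smul, add_zero]
  generalize (∑ k, pd k u x * fderiv ℝ (pd k u) x e) / slopeW u x = W
  field_simp
  ring

theorem pd_eta (c : ℝ) (hu : ContDiffOn ℝ ∞ u s) (hs : IsOpen s) (hx : x ∈ s) (h0 : u x ≠ 0)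
    (j : Fin n) : pd j (eta c u) x =
      -(c - 1 / slopeW u x) * pd j u x / u x ^ 2
        + (∑ k, pd k u x * pd j (pd k u) x) / (slopeW u x ^ 3 * u x) := by
  have hw := (slopeW_pos u x).ne'
  have hd := hu.differentiableAt_of_isOpen hs hx
  have h1 := hasDerivAt_pd hd j
  have hW := hasDerivAt_line_slopeW hu hs hx (EuclideanSpace.single j 1)
  have hdiff : DifferentiableAt ℝ (eta c u) x := by
    have : DifferentiableAt ℝ (fun z => (c - (slopeW u z)⁻¹) * (u z)⁻¹) x :=
      (((differentiableAt_slopeW hu hs hx).fun_inv hw).const_sub c).fun_mul (hd.fun_inv h0)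
    convert this using 2 with z
    rw [eta_eq, one_div, div_eq_mul_inv]
  refine pd_eq_of_hasDerivAt hdiff ?_
  simp only [eta_eq, one_div]
  have h2 := ((hW.fun_inv (by simpa using hw)).const_sub c).fun_div h1 (by simpa using h0)
  refine h2.congr_deriv ?_
  simp only [zero_smul, add_zero, pd]
  field_simp
  ring

theorem pd_pd_eta (c : ℝ) (hu : ContDiffOn ℝ ∞ u s) (hs : IsOpen s) (hx : x ∈ s)
    (h0 : ∀ z ∈ s, u z ≠ 0) (i j : Fin n) : pd i (pd j (eta c u)) x =
      (c - 1 / slopeW u x) * (-(pd i (pd j u) x) / u x ^ 2 + 2 * pd i u x * pd j u x / u x ^ 3)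
        - ((∑ k, pd k u x * pd i (pd k u) x) * pd j u x
            + pd i u x * (∑ k, pd k u x * pd j (pd k u) x)) / (slopeW u x ^ 3 * u x ^ 2)
        + (∑ k, pd i (pd k u) x * pd j (pd k u) x + ∑ k, pd k u x * pd i (pd j (pd k u)) x)
            / (slopeW u x ^ 3 * u x)
        - 3 * ((∑ k, pd k u x * pd i (pd k u) x) * (∑ k, pd k u x * pd j (pd k u) x))
            / (slopeW u x ^ 5 * u x) := by
  have hw := (slopeW_pos u x).ne'
  have hd := hu.differentiableAt_of_isOpen hs hx
  have hux := h0 x hx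
  have hdiff : DifferentiableAt ℝ (pd j (eta c u)) x :=
    ((contDiffOn_eta c hu hs h0).pd hs j).differentiableAt_of_isOpen hs hx
  refine pd_eq_of_hasDerivAt hdiff ?_
  have h1 := hasDerivAt_pd hd i
  have hW := hasDerivAt_line_slopeW hu hs hx (EuclideanSpace.single i 1)
  have hj := hasDerivAt_pd ((hu.pd hs j).differentiableAt_of_isOpen hs hx) i
  have hq : HasDerivAt (fun t : ℝ => ∑ k, pd k u (x + t • EuclideanSpace.single i 1) *
      pd j (pd k u) (x + t • EuclideanSpace.single i 1))
      (∑ k, (pd i (pd k u) x * pd j (pd k u) x + pd k u x * pd i (pd j (pd k u)) x)) 0 := by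
    refine HasDerivAt.fun_sum fun k _ => ?_
    have ha := hasDerivAt_pd ((hu.pd hs k).differentiableAt_of_isOpen hs hx) i
    have hb := hasDerivAt_pd (((hu.pd hs k).pd hs j).differentiableAt_of_isOpen hs hx) i
    simpa using ha.fun_mul hb
  have h2 := ((((hW.fun_inv (by simpa using hw)).const_sub c).fun_neg.fun_mul hj).fun_div
    (h1.fun_pow 2) (by simpa using hux)).fun_add
    (hq.fun_div ((hW.fun_pow 3).fun_mul h1) (by simpa using ⟨hw, hux⟩))
  refine (h2.congr_deriv ?_).congr_of_eventuallyEq ?_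
  · simp only [zero_smul, add_zero, Finset.sum_add_distrib]
    have hpd : ∀ v : Euc n → ℝ, fderiv ℝ v x (EuclideanSpace.single i 1) = pd i v x := fun _ => rfl
    simp only [hpd]
    generalize ∑ k, pd k u x * pd i (pd k u) x = qi
    generalize ∑ k, pd k u x * pd j (pd k u) x = qj
    generalize (∑ k, pd i (pd k u) x * pd j (pd k u) x) = A
    generalize ∑ k, pd k u x * pd i (pd j (pd k u)) x = B
    field_simp
    ring
  · have hc0 : Filter.Tendsto (fun t : ℝ => x + t • EuclideanSpace.single i (1 : ℝ)) (nhds 0)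
        (nhds x) := by
      have : Continuous (fun t : ℝ => x + t • EuclideanSpace.single i (1 : ℝ)) := by fun_prop
      simpa using this.tendsto 0
    filter_upwards [hc0.eventually (hs.mem_nhds hx)] with t ht
    have := pd_eta c hu hs ht (h0 _ ht) j
    rw [one_div] at this
    exact this

/-- The induced metric is conformal, with factor `u⁻²`, to the Euclidean metric of the graph; the
first term is the Euclidean Christoffel symbol and the others come from the conformal factor. -/
theorem christoffel_firstForm (hu : ContDiffOn ℝ ∞ u s) (hs : IsOpen s) (hx : x ∈ s)
    (h0 : u x ≠ 0) (k i j : Fin n) : christoffel (firstForm u) x k i j =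
      pd k u x * pd i (pd j u) x / slopeW u x ^ 2
        - ((if k = i then pd j u x else 0) + (if k = j then pd i u x else 0)) / u x
        + ((if i = j then 1 else 0) + pd i u x * pd j u x) * pd k u x
            / (slopeW u x ^ 2 * u x) := by
  have hw := (slopeW_pos u x).ne'
  have hg : ∀ a b c : Fin n, pd a (fun z => firstForm u z b c) x =
      (pd a (pd b u) x * pd c u x + pd b u x * pd a (pd c u) x) / u x ^ 2
        - 2 * pd a u x * ((if b = c then 1 else 0) + pd b u x * pd c u x) / u x ^ 3 := by
    intro a b c
    refine pd_eq_of_hasDerivAt ?_ (hasDerivAt_line_firstForm hu hs hx h0 _ b c)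
    simp only [firstForm_apply, div_eq_mul_inv]
    have hd := hu.differentiableAt_of_isOpen hs hx
    have hb := (hu.pd hs b).differentiableAt_of_isOpen hs hx
    have hc := (hu.pd hs c).differentiableAt_of_isOpen hs hx
    exact ((hb.fun_mul hc).const_add _).fun_mul ((hd.fun_pow 2).fun_inv (by simpa using h0))
  have hS := slopeW_sq u x
  have hl : ∀ l, (pd i (fun z => firstForm u z j l) x + pd j (fun z => firstForm u z i l) x
      - pd l (fun z => firstForm u z i j) x) =
      (2 * pd i (pd j u) x / u x ^ 2 - 2 * pd i u x * pd j u x / u x ^ 3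
        + 2 * (if i = j then 1 else 0) / u x ^ 3) * pd l u x
        - (if j = l then 2 * pd i u x / u x ^ 3 else 0)
        - (if i = l then 2 * pd j u x / u x ^ 3 else 0) := by
    intro l
    rw [hg, hg, hg, pd_comm hu hs hx j i, pd_comm hu hs hx l i, pd_comm hu hs hx l j]
    split_ifs <;> field_simp <;> ring
  simp only [christoffel, hl, firstForm_inv h0, Matrix.smul_apply, Matrix.sub_apply,
    Matrix.one_apply, Matrix.vecMulVec_apply, gradVec, smul_eq_mul]
  generalize hA : (2 * pd i (pd j u) x / u x ^ 2 - 2 * pd i u x * pd j u x / u x ^ 3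
        + 2 * (if i = j then 1 else 0) / u x ^ 3) = A
  rw [Finset.sum_congr rfl fun l _ => show _ =
    (if k = l then u x ^ 2 * (A * pd l u x - (if j = l then 2 * pd i u x / u x ^ 3 else 0)
        - (if i = l then 2 * pd j u x / u x ^ 3 else 0)) else 0)
      - u x ^ 2 / slopeW u x ^ 2 * pd k u x * A * (pd l u x * pd l u x)
      + (if j = l then 2 * pd i u x / (u x * slopeW u x ^ 2) * pd k u x * pd l u x else 0)
      + (if i = l then 2 * pd j u x / (u x * slopeW u x ^ 2) * pd k u x * pd l u x else 0) by
    split_ifs <;> field_simp <;> ring]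
  simp only [Finset.sum_add_distrib, Finset.sum_sub_distrib, Finset.sum_ite_eq, Finset.mem_univ,
    if_true, ← Finset.mul_sum]
  rw [show ∑ l, pd l u x * pd l u x = slopeW u x ^ 2 - 1 by linarith]
  simp only [eq_comm (a := k)]
  rw [← hA]
  split_ifs <;> field_simp <;> ring

end Smooth

section CovHess

variable {n : ℕ} {u : Euc n → ℝ} {s : Set (Euc n)} {x : Euc n}

theorem gradVec_eta (c : ℝ) (hu : ContDiffOn ℝ ∞ u s) (hs : IsOpen s) (hx : x ∈ s)
    (h0 : u x ≠ 0) : gradVec (eta c u) x =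
      (-(c - 1 / slopeW u x) / u x ^ 2) • gradVec u x
        + (1 / (slopeW u x ^ 3 * u x)) • (hessMat u x *ᵥ gradVec u x) := by
  ext j
  simp only [gradVec, pd_eta c hu hs hx h0, Pi.add_apply, Pi.smul_apply, smul_eq_mul,
    Matrix.mulVec, dotProduct, hessMat, Matrix.of_apply]
  simp only [mul_comm (pd _ u x)]
  ring

theorem hessMat_eta (c : ℝ) (hu : ContDiffOn ℝ ∞ u s) (hs : IsOpen s) (hx : x ∈ s)
    (h0 : ∀ z ∈ s, u z ≠ 0) : hessMat (eta c u) x =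
      (c - 1 / slopeW u x) • ((-(1 / u x ^ 2)) • hessMat u x
          + (2 / u x ^ 3) • Matrix.vecMulVec (gradVec u x) (gradVec u x))
        - (1 / (slopeW u x ^ 3 * u x ^ 2)) •
            (Matrix.vecMulVec (hessMat u x *ᵥ gradVec u x) (gradVec u x)
              + Matrix.vecMulVec (gradVec u x) (hessMat u x *ᵥ gradVec u x))
        + (1 / (slopeW u x ^ 3 * u x)) • (hessMat u x * hessMat u x + hessGradMat u x)
        - (3 / (slopeW u x ^ 5 * u x)) •
            Matrix.vecMulVec (hessMat u x *ᵥ gradVec u x) (hessMat u x *ᵥ gradVec u x) := by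
  have hq : ∀ i, (hessMat u x *ᵥ gradVec u x) i = ∑ k, pd k u x * pd i (pd k u) x := fun i => by
    simp only [Matrix.mulVec, dotProduct, hessMat, Matrix.of_apply, gradVec]
    simp only [mul_comm (pd _ u x)]
  have hHH : ∀ i j, (hessMat u x * hessMat u x) i j =
      ∑ k, pd i (pd k u) x * pd j (pd k u) x := fun i j => by
    simp only [Matrix.mul_apply, hessMat, Matrix.of_apply]
    exact Finset.sum_congr rfl fun k _ => by rw [pd_comm hu hs hx k j]
  have hT : ∀ i j, hessGradMat u x i j = ∑ k, pd k u x * pd i (pd j (pd k u)) x := fun i j => by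
    simp only [hessGradMat, Matrix.of_apply, gradVec]
    exact Finset.sum_congr rfl fun k _ => by rw [pd_pd_pd_comm hu hs hx i j k]
  ext i j
  simp only [Matrix.add_apply, Matrix.sub_apply, Matrix.smul_apply, smul_eq_mul,
    Matrix.vecMulVec_apply, hq, hHH, hT]
  simp only [hessMat, Matrix.of_apply, gradVec, pd_pd_eta c hu hs hx h0]
  ring

theorem covHess_firstForm (hu : ContDiffOn ℝ ∞ u s) (hs : IsOpen s) (hx : x ∈ s)
    (h0 : u x ≠ 0) (v : Euc n → ℝ) : covHess (firstForm u) v x =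
      hessMat v x - ((gradVec u x ⬝ᵥ gradVec v x) / slopeW u x ^ 2) • hessMat u x
        + (1 / u x) • (Matrix.vecMulVec (gradVec v x) (gradVec u x)
            + Matrix.vecMulVec (gradVec u x) (gradVec v x))
        - ((gradVec u x ⬝ᵥ gradVec v x) * u x / slopeW u x ^ 2) • firstForm u x := by
  have hw := (slopeW_pos u x).ne'
  ext i j
  simp only [Matrix.add_apply, Matrix.sub_apply, Matrix.smul_apply, smul_eq_mul,
    Matrix.vecMulVec_apply, covHess, Matrix.of_apply, christoffel_firstForm hu hs hx h0,
    firstForm_apply, hessMat, gradVec, dotProduct]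
  rw [Finset.sum_congr rfl fun k _ => show _ =
    (pd i (pd j u) x / slopeW u x ^ 2 + ((if i = j then 1 else 0) + pd i u x * pd j u x)
      / (slopeW u x ^ 2 * u x)) * (pd k u x * pd k v x)
      - (if k = i then pd j u x * pd k v x / u x else 0)
      - (if k = j then pd i u x * pd k v x / u x else 0) by
    split_ifs <;> field_simp <;> ring]
  simp only [Finset.sum_sub_distrib, Finset.sum_ite_eq', Finset.mem_univ,
    if_true, ← Finset.mul_sum]
  field_simp
  ring

theorem hessMat_transpose (hu : ContDiffOn ℝ ∞ u s) (hs : IsOpen s) (hx : x ∈ s) :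
    (hessMat u x)ᵀ = hessMat u x := by
  ext i j
  simp only [Matrix.transpose_apply, hessMat, Matrix.of_apply]
  exact pd_comm hu hs hx j i

/-- The derivative of the first fundamental form along `∇u`. -/
theorem fderiv_firstForm_gradVec {τ : Fin n → ℝ} {D : Matrix (Fin n) (Fin n) ℝ}
    (hu : ContDiffOn ℝ ∞ u s) (hs : IsOpen s) (hx : x ∈ s) (h0 : u x ≠ 0)
    (hD : ∀ i j, HasDerivAt (fun t : ℝ => firstForm u (x + t • WithLp.toLp 2 (gradVec u x)) i j)
      (D i j) 0) :
    quad τ D = 2 * (τ ⬝ᵥ gradVec u x) * (τ ⬝ᵥ hessMat u x *ᵥ gradVec u x) / u x ^ 2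
      - 2 * (gradVec u x ⬝ᵥ gradVec u x) / u x * quad τ (firstForm u x) := by
  have hp : ∀ k, fderiv ℝ (pd k u) x (WithLp.toLp 2 (gradVec u x)) =
      (hessMat u x *ᵥ gradVec u x) k := fun k => by
    rw [fderiv_apply_eq_sum]
    simp only [Matrix.mulVec, dotProduct, hessMat, Matrix.of_apply]
    exact Finset.sum_congr rfl fun i _ => by rw [pd_comm hu hs hx i k, mul_comm]
  have hp0 : fderiv ℝ u x (WithLp.toLp 2 (gradVec u x)) = gradVec u x ⬝ᵥ gradVec u x := by
    rw [fderiv_apply_eq_sum]; rfl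
  have : D = (1 / u x ^ 2) • (Matrix.vecMulVec (hessMat u x *ᵥ gradVec u x) (gradVec u x)
      + Matrix.vecMulVec (gradVec u x) (hessMat u x *ᵥ gradVec u x))
      - (2 * (gradVec u x ⬝ᵥ gradVec u x) / u x) • firstForm u x := by
    ext i j
    rw [(hD i j).unique (hasDerivAt_line_firstForm hu hs hx h0 _ i j)]
    simp only [hp, hp0, Matrix.add_apply, Matrix.sub_apply, Matrix.smul_apply, smul_eq_mul,
      Matrix.vecMulVec_apply, firstForm_apply]
    simp only [gradVec]
    field_simp
  rw [this]
  simp only [map_sub, map_add, map_smul, quad_vecMulVec, smul_eq_mul]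
  ring

/-- The derivative of the second fundamental form along `∇u`. -/
theorem fderiv_secondForm_gradVec {τ : Fin n → ℝ} {D : Matrix (Fin n) (Fin n) ℝ}
    (hu : ContDiffOn ℝ ∞ u s) (hs : IsOpen s) (hx : x ∈ s) (h0 : u x ≠ 0)
    (hD : ∀ i j, HasDerivAt (fun t : ℝ => secondForm u (x + t • WithLp.toLp 2 (gradVec u x)) i j)
      (D i j) 0) :
    quad τ D = quad τ (hessGradMat u x) / (u x * slopeW u x)
      - quad τ (hessMat u x) * ((gradVec u x ⬝ᵥ gradVec u x) * slopeW u x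
          + u x * ((gradVec u x ⬝ᵥ hessMat u x *ᵥ gradVec u x) / slopeW u x))
          / (u x * slopeW u x) ^ 2
      + 2 * (τ ⬝ᵥ gradVec u x) * (τ ⬝ᵥ hessMat u x *ᵥ gradVec u x) / (u x ^ 2 * slopeW u x)
      - quad τ (firstForm u x) *
          (2 * u x * (gradVec u x ⬝ᵥ gradVec u x) * slopeW u x
            + u x ^ 2 * ((gradVec u x ⬝ᵥ hessMat u x *ᵥ gradVec u x) / slopeW u x))
          / (u x * slopeW u x) ^ 2 := by
  have hw := (slopeW_pos u x).ne'
  have hp : ∀ k, fderiv ℝ (pd k u) x (WithLp.toLp 2 (gradVec u x)) =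
      (hessMat u x *ᵥ gradVec u x) k := fun k => by
    rw [fderiv_apply_eq_sum]
    simp only [Matrix.mulVec, dotProduct, hessMat, Matrix.of_apply]
    exact Finset.sum_congr rfl fun i _ => by rw [pd_comm hu hs hx i k, mul_comm]
  have hp0 : fderiv ℝ u x (WithLp.toLp 2 (gradVec u x)) = gradVec u x ⬝ᵥ gradVec u x := by
    rw [fderiv_apply_eq_sum]; rfl
  have hr : ∑ k, pd k u x * (hessMat u x *ᵥ gradVec u x) k =
      gradVec u x ⬝ᵥ hessMat u x *ᵥ gradVec u x := rfl
  have hT : ∀ i j, fderiv ℝ (pd i (pd j u)) x (WithLp.toLp 2 (gradVec u x)) =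
      hessGradMat u x i j := fun i j => by
    rw [fderiv_apply_eq_sum]; rfl
  have : D = (1 / (u x * slopeW u x)) • hessGradMat u x
      - (((gradVec u x ⬝ᵥ gradVec u x) * slopeW u x
          + u x * ((gradVec u x ⬝ᵥ hessMat u x *ᵥ gradVec u x) / slopeW u x))
          / (u x * slopeW u x) ^ 2) • hessMat u x
      + (1 / (u x ^ 2 * slopeW u x)) •
          (Matrix.vecMulVec (hessMat u x *ᵥ gradVec u x) (gradVec u x)
          + Matrix.vecMulVec (gradVec u x) (hessMat u x *ᵥ gradVec u x))
      - ((2 * u x * (gradVec u x ⬝ᵥ gradVec u x) * slopeW u x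
            + u x ^ 2 * ((gradVec u x ⬝ᵥ hessMat u x *ᵥ gradVec u x) / slopeW u x))
          / (u x * slopeW u x) ^ 2) • firstForm u x := by
    ext i j
    rw [(hD i j).unique (hasDerivAt_line_secondForm hu hs hx h0 _ i j)]
    simp only [hp, hp0, hT, hr, Matrix.add_apply, Matrix.sub_apply, Matrix.smul_apply, smul_eq_mul,
      Matrix.vecMulVec_apply, firstForm_apply]
    generalize gradVec u x ⬝ᵥ hessMat u x *ᵥ gradVec u x = r
    generalize gradVec u x ⬝ᵥ gradVec u x = S
    simp only [gradVec, hessMat, Matrix.of_apply]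
    field_simp
  rw [this]
  simp only [map_sub, map_add, map_smul, quad_vecMulVec, smul_eq_mul]
  ring

/-- The Hessian of `(c - ν) / u` on a unit principal vector `τ`. The eigenvector equation reads
`D²u τ = k (τ + ⟨τ, ∇u⟩ ∇u)` with `k = (w κ - 1) / u`, which turns both sides into rational
functions of a few scalars; the third derivatives of `u` enter only through the derivative `Dh` of
the second fundamental form along `∇u`, which is `-w²` times the intrinsic gradient of `1 / u`. -/
theorem quad_covHess_eta {τ : Fin n → ℝ} {κ c : ℝ} {Dg Dh : Matrix (Fin n) (Fin n) ℝ}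
    (hu : ContDiffOn ℝ ∞ u s) (hs : IsOpen s) (hx : x ∈ s) (h0 : ∀ z ∈ s, u z ≠ 0)
    (hDg : ∀ i j, HasDerivAt
      (fun t : ℝ => firstForm u (x + t • WithLp.toLp 2 (gradVec u x)) i j) (Dg i j) 0)
    (hDh : ∀ i j, HasDerivAt
      (fun t : ℝ => secondForm u (x + t • WithLp.toLp 2 (gradVec u x)) i j) (Dh i j) 0)
    (hτ : quad τ (firstForm u x) = 1)
    (hκ : secondForm u x *ᵥ τ = κ • firstForm u x *ᵥ τ) :
    quad τ (covHess (firstForm u) (eta c u) x) =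
      (c * (1 - κ / slopeW u x) - (κ - κ ^ 2 / slopeW u x)) / u x
        + (quad τ Dh - κ * quad τ Dg) / slopeW u x ^ 2 := by
  have hux := h0 x hx
  have hw := (slopeW_pos u x).ne'
  have hS : gradVec u x ⬝ᵥ gradVec u x = slopeW u x ^ 2 - 1 := by
    linarith [slopeW_sq' u x]
  set a := τ ⬝ᵥ gradVec u x with ha
  set w := slopeW u x with hwdef
  set k := (w * κ - 1) / u x with hk
  have hκk : κ = (1 + u x * k) / w := by
    rw [hk]; field_simp; ring
  -- the eigenvector equation, solved for the Euclidean Hessian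
  have hgτ : firstForm u x *ᵥ τ = (1 / u x ^ 2) • (τ + a • gradVec u x) := by
    rw [firstForm_eq, Matrix.smul_mulVec, Matrix.add_mulVec, Matrix.one_mulVec,
      Matrix.vecMulVec_mulVec, op_smul_eq_smul, dotProduct_comm _ τ]
  have hHτ : hessMat u x *ᵥ τ = k • (τ + a • gradVec u x) := by
    have h1 : (1 / (u x * w)) • (hessMat u x *ᵥ τ) =
        (κ - 1 / w) • firstForm u x *ᵥ τ := by
      rw [sub_smul, ← hκ, secondForm_eq hux, Matrix.add_mulVec, Matrix.smul_mulVec,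
        Matrix.smul_mulVec, ← hwdef, add_sub_cancel_right]
    have h2 : hessMat u x *ᵥ τ = (u x * w) • (1 / (u x * w)) • (hessMat u x *ᵥ τ) := by
      rw [smul_smul, mul_one_div_cancel (mul_ne_zero hux hw), one_smul]
    rw [h2, h1, hgτ, smul_smul, smul_smul, hκk]
    congr 1
    field_simp
    ring
  have hm : τ ⬝ᵥ τ = u x ^ 2 - a ^ 2 := by
    have : quad τ (firstForm u x) = (1 / u x ^ 2) * (τ ⬝ᵥ τ + a * a) := by
      rw [firstForm_eq]
      simp only [map_add, map_smul, quad_vecMulVec, quad_one, smul_eq_mul, ha]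
    rw [hτ] at this
    field_simp at this
    linarith
  have hsymm : ∀ v, τ ⬝ᵥ hessMat u x *ᵥ v = (hessMat u x *ᵥ τ) ⬝ᵥ v := fun v => by
    rw [Matrix.dotProduct_mulVec, ← Matrix.mulVec_transpose, hessMat_transpose hu hs hx]
  have hb : τ ⬝ᵥ hessMat u x *ᵥ gradVec u x = k * a * w ^ 2 := by
    rw [hsymm, hHτ]
    simp only [smul_dotProduct, add_dotProduct, smul_eq_mul, hS, ← ha]
    ring
  have hc : quad τ (hessMat u x) = k * u x ^ 2 := by
    rw [quad_eq_dotProduct, hHτ]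
    simp only [dotProduct_smul, dotProduct_add, smul_eq_mul, hm, ← ha]
    ring
  have hd : quad τ (hessMat u x * hessMat u x) = k ^ 2 * (u x ^ 2 + a ^ 2 * w ^ 2) := by
    rw [quad_eq_dotProduct, ← Matrix.mulVec_mulVec, hsymm, hHτ]
    simp only [dotProduct_smul, dotProduct_add, smul_dotProduct, add_dotProduct, smul_eq_mul, hm,
      hS, ← ha, dotProduct_comm _ τ]
    ring
  rw [covHess_firstForm hu hs hx hux, fderiv_firstForm_gradVec hu hs hx hux hDg,
    fderiv_secondForm_gradVec hu hs hx hux hDh]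
  simp only [hessMat_eta c hu hs hx h0, gradVec_eta c hu hs hx hux]
  simp only [map_sub, map_add, map_smul, quad_vecMulVec, smul_eq_mul, dotProduct_add,
    dotProduct_smul, hb, hc, hd, hτ, hS, ← ha, ← hwdef]
  generalize gradVec u x ⬝ᵥ hessMat u x *ᵥ gradVec u x = r
  generalize quad τ (hessGradMat u x) = e
  rw [hκk]
  field_simp
  ring

end CovHess

/-! ### Concave symmetric functions on the positive cone -/

theorem isOpen_posCone (n : ℕ) : IsOpen (posCone n) := by
  have : posCone n = ⋂ i, {lam : Fin n → ℝ | 0 < lam i} := by ext; simp [posCone]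
  rw [this]
  exact isOpen_iInter_of_finite fun i => isOpen_lt continuous_const (continuous_apply i)

theorem fderiv_eq_sum_fpd {n : ℕ} (f : (Fin n → ℝ) → ℝ) (lam v : Fin n → ℝ) :
    fderiv ℝ f lam v = ∑ i, fpd f i lam * v i := by
  have : v = ∑ i, v i • (Pi.single i (1 : ℝ) : Fin n → ℝ) := by
    ext j
    simp [Finset.sum_apply, Pi.single_apply]
  conv_lhs => rw [this]
  simp [map_sum, fpd, mul_comm]

namespace IsCurvatureFunction

variable {n : ℕ} {f : (Fin n → ℝ) → ℝ} {lam mu : Fin n → ℝ}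

theorem differentiableAt (hf : IsCurvatureFunction f) (hl : lam ∈ posCone n) :
    DifferentiableAt ℝ f lam :=
  (hf.smooth.differentiableOn (by simp)).differentiableAt ((isOpen_posCone n).mem_nhds hl)

theorem continuousAt_fpd (hf : IsCurvatureFunction f) (hl : lam ∈ posCone n) (i : Fin n) :
    ContinuousAt (fpd f i) lam := by
  have h1 : ContinuousAt (fderiv ℝ f) lam :=
    ((hf.smooth.fderiv_of_isOpen (m := ∞) (isOpen_posCone n) (by simp)).continuousOn).continuousAt
      ((isOpen_posCone n).mem_nhds hl)
  exact h1.clm_apply continuousAt_const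

theorem hasDerivAt_comp (hf : IsCurvatureFunction f) {c : ℝ → Fin n → ℝ} {c' : Fin n → ℝ}
    (hc : ∀ i, HasDerivAt (fun t => c t i) (c' i) 0) (hl : c 0 ∈ posCone n) :
    HasDerivAt (fun t => f (c t)) (∑ i, fpd f i (c 0) * c' i) 0 := by
  rw [← fderiv_eq_sum_fpd]
  exact (hf.differentiableAt hl).hasFDerivAt.comp_hasDerivAt 0 (hasDerivAt_pi.2 hc)

/-- A concave function lies below its tangent hyperplanes. -/
theorem le_tangent (hf : IsCurvatureFunction f) (hl : lam ∈ posCone n) (hm : mu ∈ posCone n) :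
    f mu ≤ f lam + ∑ i, fpd f i lam * (mu i - lam i) := by
  have hd : HasDerivAt (fun t : ℝ => f (lam + t • (mu - lam)))
      (∑ i, fpd f i lam * (mu i - lam i)) 0 := by
    have := hf.hasDerivAt_comp (c := fun t => lam + t • (mu - lam)) (c' := mu - lam)
      (fun i => by
        simpa using ((hasDerivAt_id (0 : ℝ)).mul_const (mu i - lam i)).const_add (lam i))
      (by simpa using hl)
    simpa using this
  have h1 := hd.tendsto_slope_zero_right
  have h2 : f mu - f lam ≤ ∑ i, fpd f i lam * (mu i - lam i) := by
    refine ge_of_tendsto h1 ?_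
    filter_upwards [Ioo_mem_nhdsGT (show (0 : ℝ) < 1 by norm_num)] with t ht
    have hc := hf.concave.2 hl hm (show 0 ≤ 1 - t by linarith [ht.2]) ht.1.le (by ring)
    have he : (1 - t) • lam + t • mu = lam + t • (mu - lam) := by module
    rw [he] at hc
    simp only [smul_eq_mul, zero_add, zero_smul, add_zero] at hc ⊢
    rw [inv_mul_eq_div, le_div_iff₀ ht.1]
    linarith
  linarith

theorem sum_fpd_mul_self (hf : IsCurvatureFunction f) (hl : lam ∈ posCone n) :
    ∑ i, fpd f i lam * lam i = f lam := by
  have h1 := hf.hasDerivAt_comp (c := fun t => lam + t • lam) (c' := lam)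
      (fun i => by simpa using ((hasDerivAt_id (0 : ℝ)).mul_const (lam i)).const_add (lam i))
      (by simpa using hl)
  have h2 : HasDerivAt (fun t : ℝ => (1 + t) * f lam) (f lam) 0 := by
    simpa using ((hasDerivAt_id (0 : ℝ)).const_add 1).mul_const (f lam)
  have h3 : (fun t : ℝ => f (lam + t • lam)) =ᶠ[nhds 0] fun t => (1 + t) * f lam := by
    filter_upwards [lt_mem_nhds (show (-1 : ℝ) < 0 by norm_num)] with t ht
    rw [← hf.homogeneous (1 + t) (by linarith) lam hl, add_smul, one_smul]
  have h4 := (h2.congr_of_eventuallyEq h3).unique h1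
  simpa using h4.symm

theorem one_mem_posCone : (fun _ => 1 : Fin n → ℝ) ∈ posCone n := fun _ => one_pos

theorem apply_const (hf : IsCurvatureFunction f) {t : ℝ} (ht : 0 < t) : f (fun _ => t) = t := by
  have := hf.homogeneous t ht _ one_mem_posCone
  rw [hf.normalized, mul_one] at this
  convert this using 2
  ext; simp

/-- Concavity and `f (1, …, 1) = 1`, with Euler's relation, give `∑ fᵢ ≥ 1`. -/
theorem one_le_sum_fpd (hf : IsCurvatureFunction f) (hl : lam ∈ posCone n) :
    1 ≤ ∑ i, fpd f i lam := by
  have h1 := hf.le_tangent hl one_mem_posCone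
  rw [hf.normalized] at h1
  simp only [mul_sub, mul_one, Finset.sum_sub_distrib, hf.sum_fpd_mul_self hl] at h1
  linarith

theorem mono (hf : IsCurvatureFunction f) (hl : lam ∈ posCone n) (hm : mu ∈ posCone n)
    (h : ∀ i, lam i ≤ mu i) : f lam ≤ f mu := by
  have h1 := hf.le_tangent hm hl
  have h2 : ∑ i, fpd f i mu * (lam i - mu i) ≤ 0 :=
    Finset.sum_nonpos fun i _ =>
      mul_nonpos_of_nonneg_of_nonpos (hf.fpd_pos mu hm i).le (by linarith [h i])
  linarith

theorem comp_perm_mem (hl : lam ∈ posCone n) (π : Equiv.Perm (Fin n)) :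
    (fun i => lam (π i)) ∈ posCone n := fun i => hl (π i)

theorem fpd_comp_perm (hf : IsCurvatureFunction f) (hl : lam ∈ posCone n)
    (π : Equiv.Perm (Fin n)) (i : Fin n) :
    fpd f i (fun j => lam (π j)) = fpd f (π i) lam := by
  have h1 := hf.hasDerivAt_comp (c := fun t => lam + t • (Pi.single (π i) 1 : Fin n → ℝ))
      (c' := Pi.single (π i) 1)
      (fun k => by
        simpa using ((hasDerivAt_id (0 : ℝ)).mul_const
          ((Pi.single (π i) 1 : Fin n → ℝ) k)).const_add (lam k))
      (by simpa using hl)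
  have h2 := hf.hasDerivAt_comp
      (c := fun t j => (lam + t • (Pi.single (π i) 1 : Fin n → ℝ)) (π j))
      (c' := fun j => (Pi.single (π i) 1 : Fin n → ℝ) (π j))
      (fun k => by
        simpa using ((hasDerivAt_id (0 : ℝ)).mul_const
          ((Pi.single (π i) 1 : Fin n → ℝ) (π k))).const_add (lam (π k)))
      (by simpa using comp_perm_mem hl π)
  have hc : ContinuousAt (fun t : ℝ => lam + t • (Pi.single (π i) 1 : Fin n → ℝ)) 0 := by
    fun_prop
  have h3 : ∀ᶠ t in nhds (0 : ℝ), lam + t • (Pi.single (π i) 1 : Fin n → ℝ) ∈ posCone n :=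
    hc.eventually_mem ((isOpen_posCone n).mem_nhds (by simpa using hl))
  have h4 := h1.unique (h2.congr_of_eventuallyEq (h3.mono fun t ht => (hf.symmetric π _ ht).symm))
  simpa [Pi.single_apply, eq_comm] using h4.symm

theorem sum_fpd_comp_perm (hf : IsCurvatureFunction f) (hl : lam ∈ posCone n)
    (π : Equiv.Perm (Fin n)) : ∑ i, fpd f i (fun j => lam (π j)) = ∑ i, fpd f i lam := by
  simp only [hf.fpd_comp_perm hl]
  exact Equiv.sum_comp π fun i => fpd f i lam

theorem fpd_eq_of_eq (hf : IsCurvatureFunction f) (hl : lam ∈ posCone n) {i j : Fin n}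
    (h : lam i = lam j) : fpd f i lam = fpd f j lam := by
  have h1 := hf.fpd_comp_perm hl (Equiv.swap i j) i
  rw [Equiv.swap_apply_left] at h1
  rw [← h1]
  congr 1
  ext k
  rcases eq_or_ne k i with rfl | hki
  · simp [h]
  rcases eq_or_ne k j with rfl | hkj
  · simp [h]
  · rw [Equiv.swap_apply_of_ne_of_ne hki hkj]

/-- A symmetric concave function does not decrease under doubly stochastic averaging: by Birkhoff's
theorem the average is a convex combination of permutations. -/
theorem le_mulVec_doublyStochastic (hf : IsCurvatureFunction f) (hl : lam ∈ posCone n)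
    {D : Matrix (Fin n) (Fin n) ℝ} (hD : D ∈ doublyStochastic ℝ (Fin n)) :
    D *ᵥ lam ∈ posCone n ∧ f lam ≤ f (D *ᵥ lam) := by
  have hsub : (doublyStochastic ℝ (Fin n) : Set (Matrix (Fin n) (Fin n) ℝ)) ⊆
      {D | D *ᵥ lam ∈ posCone n ∧ f lam ≤ f (D *ᵥ lam)} := by
    rw [doublyStochastic_eq_convexHull_permMatrix]
    refine convexHull_min ?_ ?_
    · rintro _ ⟨π, rfl⟩
      have : π.permMatrix ℝ *ᵥ lam = fun i => lam (π i) := by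
        rw [Matrix.permMatrix_mulVec]; rfl
      simp only [Set.mem_ofPred_eq, this]
      exact ⟨comp_perm_mem hl π, (hf.symmetric π lam hl).ge⟩
    · have := hf.concave.convex_ge (f lam)
      have h2 := this.linear_preimage (Matrix.mulVecBilin ℝ ℝ |>.flip lam)
      exact h2
  exact hsub hD

end IsCurvatureFunction

/-! ### Diagonalization of symmetric matrices -/

section Diagonalization

variable {n : ℕ}

/-- Tuples with the same characteristic polynomial agree up to a permutation. -/
theorem exists_perm_of_prod_eq {κ lam : Fin n → ℝ}
    (h : ∀ t, ∏ i, (κ i - t) = ∏ i, (lam i - t)) :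
    ∃ π : Equiv.Perm (Fin n), κ = fun i => lam (π i) := by
  have hp : ∏ i, (Polynomial.X - Polynomial.C (κ i)) =
      ∏ i, (Polynomial.X - Polynomial.C (lam i)) := by
    apply Polynomial.funext
    intro t
    simp only [Polynomial.eval_prod, Polynomial.eval_sub, Polynomial.eval_X, Polynomial.eval_C]
    have h1 : ∀ v : Fin n → ℝ, ∏ i, (t - v i) = (-1) ^ n * ∏ i, (v i - t) := fun v => by
      have h2 : (-1 : ℝ) ^ n = ∏ _i : Fin n, (-1 : ℝ) := by simp
      rw [h2, ← Finset.prod_mul_distrib]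
      exact Finset.prod_congr rfl fun i _ => by ring
    rw [h1, h1, h]
  have hm : Multiset.map κ Finset.univ.val = Multiset.map lam Finset.univ.val := by
    have := congrArg Polynomial.roots hp
    rw [Polynomial.roots_prod _ _ (Finset.prod_ne_zero_iff.2 fun i _ => Polynomial.X_sub_C_ne_zero _),
      Polynomial.roots_prod _ _ (Finset.prod_ne_zero_iff.2 fun i _ => Polynomial.X_sub_C_ne_zero _)]
      at this
    simpa using this
  -- both tuples become the same increasing tuple when sorted
  have hs : κ ∘ Tuple.sort κ = lam ∘ Tuple.sort lam := by
    apply List.ofFn_injective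
    refine List.Perm.eq_of_sortedLE (Tuple.monotone_sort κ).sortedLE_ofFn
      (Tuple.monotone_sort lam).sortedLE_ofFn ?_
    refine (Equiv.Perm.ofFn_comp_perm _ _).trans (List.Perm.trans ?_
      (Equiv.Perm.ofFn_comp_perm _ _).symm)
    rwa [Fin.univ_val_map, Fin.univ_val_map, Multiset.coe_eq_coe] at hm
  refine ⟨(Tuple.sort κ).symm.trans (Tuple.sort lam), funext fun i => ?_⟩
  simpa using congrFun hs ((Tuple.sort κ).symm i)

/-- `A` is orthogonally diagonalized by `U`, with eigenvalues `lam`. -/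
structure IsDiagonalization (A U : Matrix (Fin n) (Fin n) ℝ) (lam : Fin n → ℝ) : Prop where
  orthogonal : Uᵀ * U = 1
  eq : A = U * Matrix.diagonal lam * Uᵀ

namespace IsDiagonalization

variable {A U V : Matrix (Fin n) (Fin n) ℝ} {lam mu : Fin n → ℝ}

theorem orthogonal' (h : IsDiagonalization A U lam) : U * Uᵀ = 1 :=
  mul_eq_one_comm.1 h.orthogonal

theorem isSymm (h : IsDiagonalization A U lam) : A.IsSymm := by
  rw [Matrix.IsSymm, h.eq]
  simp [Matrix.transpose_mul, Matrix.mul_assoc]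

theorem conj (h : IsDiagonalization A U lam) : Uᵀ * A * U = Matrix.diagonal lam := by
  calc Uᵀ * A * U = (Uᵀ * U) * Matrix.diagonal lam * (Uᵀ * U) := by
        rw [h.eq]; simp only [Matrix.mul_assoc]
    _ = _ := by simp [h.orthogonal]

theorem det_sub (h : IsDiagonalization A U lam) (t : ℝ) :
    (A - t • (1 : Matrix (Fin n) (Fin n) ℝ)).det = ∏ i, (lam i - t) := by
  have h1 : A - t • (1 : Matrix (Fin n) (Fin n) ℝ) =
      U * Matrix.diagonal (fun i => lam i - t) * Uᵀ := by
    have h2 : Matrix.diagonal (fun i => lam i - t) =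
        Matrix.diagonal lam - t • (1 : Matrix (Fin n) (Fin n) ℝ) := by
      ext i j
      by_cases hij : i = j
      · subst hij; simp
      · simp [hij]
    rw [h2, Matrix.mul_sub, Matrix.sub_mul, ← h.eq, Matrix.mul_smul, Matrix.smul_mul,
      Matrix.mul_one, h.orthogonal']
  have h3 : U.det * Uᵀ.det = 1 := by rw [← Matrix.det_mul, h.orthogonal', Matrix.det_one]
  rw [h1, Matrix.det_mul, Matrix.det_mul, Matrix.det_diagonal, mul_right_comm, h3, one_mul]

theorem exists_perm (h : IsDiagonalization A U lam) (h' : IsDiagonalization A V mu) :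
    ∃ π : Equiv.Perm (Fin n), mu = fun i => lam (π i) :=
  exists_perm_of_prod_eq fun t => by rw [← h.det_sub, ← h'.det_sub]

theorem eigenvectorUnitary (hH : A.IsHermitian) :
    IsDiagonalization A hH.eigenvectorUnitary hH.eigenvalues where
  orthogonal := by
    have := Unitary.coe_star_mul_self hH.eigenvectorUnitary
    rwa [Matrix.star_eq_conjTranspose, Matrix.conjTranspose_eq_transpose_of_trivial] at this
  eq := by
    have := hH.spectral_theorem
    rw [Unitary.conjStarAlgAut_apply, Matrix.star_eq_conjTranspose,
      Matrix.conjTranspose_eq_transpose_of_trivial] at this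
    exact this

theorem exists_of_isSymm (hA : A.IsSymm) : ∃ U lam, IsDiagonalization A U lam :=
  ⟨_, _, eigenvectorUnitary (Matrix.isHermitian_iff_isSymm.2 hA)⟩

theorem spectralF_eq {f : (Fin n → ℝ) → ℝ} (hf : IsCurvatureFunction f)
    (h : IsDiagonalization A U lam) (hl : lam ∈ posCone n) : spectralF f A = f lam := by
  have hH := Matrix.isHermitian_iff_isSymm.2 h.isSymm
  obtain ⟨π, hπ⟩ := h.exists_perm (eigenvectorUnitary hH)
  rw [spectralF, dif_pos hH]
  have := hf.symmetric π lam hl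
  rw [← hπ] at this
  exact this

end IsDiagonalization

end Diagonalization

/-! ### The derivative of a symmetric function of the eigenvalues -/

section SpectralDerivative

variable {n : ℕ} {f : (Fin n → ℝ) → ℝ} {A S U V R : Matrix (Fin n) (Fin n) ℝ} {lam mu : Fin n → ℝ}

theorem quad_col (U X : Matrix (Fin n) (Fin n) ℝ) (a : Fin n) :
    quad (fun i => U i a) X = (Uᵀ * X * U) a a := by
  simp only [quad_apply, Matrix.mul_apply, Matrix.transpose_apply, Finset.sum_mul]
  rw [Finset.sum_comm]
  exact Finset.sum_congr rfl fun i _ => Finset.sum_congr rfl fun j _ => by ring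

/-- Schur's inequality: the diagonal of `A` in any orthonormal basis is a doubly stochastic average
of the eigenvalues, hence a symmetric concave function is at least as large there. -/
theorem IsDiagonalization.le_diag (hf : IsCurvatureFunction f) (h : IsDiagonalization A U lam)
    (hl : lam ∈ posCone n) (hR : Rᵀ * R = 1) :
    (fun i => (Rᵀ * A * R) i i) ∈ posCone n ∧ f lam ≤ f (fun i => (Rᵀ * A * R) i i) := by
  set O := Rᵀ * U with hO
  have h1 : O * Oᵀ = 1 := by
    rw [hO, Matrix.transpose_mul, Matrix.transpose_transpose, Matrix.mul_assoc,
      ← Matrix.mul_assoc U, h.orthogonal', Matrix.one_mul, hR]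
  have h2 : Oᵀ * O = 1 := mul_eq_one_comm.1 h1
  have hD : (Matrix.of fun i j => O i j ^ 2) ∈ doublyStochastic ℝ (Fin n) := by
    rw [mem_doublyStochastic_iff_sum]
    refine ⟨fun i j => by simp only [Matrix.of_apply]; positivity, fun i => ?_, fun j => ?_⟩
    · have := congrFun (congrFun h1 i) i
      simpa [Matrix.mul_apply, sq] using this
    · have := congrFun (congrFun h2 j) j
      simpa [Matrix.mul_apply, sq] using this
  have hdiag : (Matrix.of fun i j => O i j ^ 2) *ᵥ lam = fun i => (Rᵀ * A * R) i i := by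
    ext i
    have : Rᵀ * A * R = O * Matrix.diagonal lam * Oᵀ := by
      rw [h.eq, hO, Matrix.transpose_mul, Matrix.transpose_transpose]
      simp only [Matrix.mul_assoc]
    rw [this, Matrix.mul_apply]
    simp only [Matrix.mul_diagonal, Matrix.transpose_apply, Matrix.mulVec, dotProduct,
      Matrix.of_apply]
    exact Finset.sum_congr rfl fun j _ => by ring
  rw [← hdiag]
  exact hf.le_mulVec_doublyStochastic hl hD

/-- The matrix `U diag(fᵢ(λ)) Uᵀ`, which is the gradient of `F` at `U diag(λ) Uᵀ`. -/
noncomputable def specGrad (f : (Fin n → ℝ) → ℝ) (U : Matrix (Fin n) (Fin n) ℝ)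
    (lam : Fin n → ℝ) : Matrix (Fin n) (Fin n) ℝ :=
  U * Matrix.diagonal (fun a => fpd f a lam) * Uᵀ

theorem specGrad_isSymm (f : (Fin n → ℝ) → ℝ) (U : Matrix (Fin n) (Fin n) ℝ)
    (lam : Fin n → ℝ) : (specGrad f U lam).IsSymm := by
  simp [Matrix.IsSymm, specGrad, Matrix.transpose_mul, Matrix.mul_assoc]

theorem sum_specGrad_mul (f : (Fin n → ℝ) → ℝ) (U X : Matrix (Fin n) (Fin n) ℝ)
    (lam : Fin n → ℝ) : ∑ i, ∑ j, specGrad f U lam i j * X i j =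
      ∑ a, fpd f a lam * quad (fun i => U i a) X := by
  have he : ∀ i j, specGrad f U lam i j = ∑ a, U i a * fpd f a lam * U j a := fun i j => by
    rw [specGrad, Matrix.mul_apply]
    simp only [Matrix.mul_diagonal, Matrix.transpose_apply]
  simp only [he, quad_apply, Finset.sum_mul, Finset.mul_sum]
  conv_rhs => rw [Finset.sum_comm]
  refine Finset.sum_congr rfl fun i _ => ?_
  conv_rhs => rw [Finset.sum_comm]
  exact Finset.sum_congr rfl fun j _ => Finset.sum_congr rfl fun a _ => by ring

/-- The gradient matrix does not depend on the choice of the eigenbasis, because `fᵢ(λ) = fⱼ(λ)`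
whenever `λᵢ = λⱼ`. -/
theorem IsDiagonalization.specGrad_eq (hf : IsCurvatureFunction f)
    (h : IsDiagonalization A U lam) (h' : IsDiagonalization A V mu) (hl : lam ∈ posCone n) :
    specGrad f U lam = specGrad f V mu := by
  obtain ⟨π, hπ⟩ := h.exists_perm h'
  have h1 : Matrix.diagonal lam * (Uᵀ * V) = (Uᵀ * V) * Matrix.diagonal mu := by
    calc Matrix.diagonal lam * (Uᵀ * V) = Uᵀ * U * Matrix.diagonal lam * (Uᵀ * V) := by
          rw [h.orthogonal, Matrix.one_mul]
      _ = Uᵀ * (U * Matrix.diagonal lam * Uᵀ) * V := by simp only [Matrix.mul_assoc]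
      _ = Uᵀ * (V * Matrix.diagonal mu * Vᵀ) * V := by rw [← h.eq, ← h'.eq]
      _ = Uᵀ * V * Matrix.diagonal mu * (Vᵀ * V) := by simp only [Matrix.mul_assoc]
      _ = _ := by rw [h'.orthogonal, Matrix.mul_one]
  have h2 : Matrix.diagonal (fun a => fpd f a lam) * (Uᵀ * V) =
      (Uᵀ * V) * Matrix.diagonal (fun a => fpd f a mu) := by
    ext i j
    have h3 := congrFun (congrFun h1 i) j
    rw [Matrix.diagonal_mul, Matrix.mul_diagonal] at h3 ⊢
    rcases eq_or_ne ((Uᵀ * V) i j) 0 with h0 | h0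
    · simp [h0]
    · have h4 : lam i = lam (π j) := by
        have : lam i = mu j := mul_right_cancel₀ h0 (by linarith)
        rw [this, hπ]
      rw [hπ, hf.fpd_comp_perm hl, hf.fpd_eq_of_eq hl h4, mul_comm]
  calc specGrad f U lam = U * (Matrix.diagonal (fun a => fpd f a lam) * (Uᵀ * V)) * Vᵀ := by
        rw [specGrad]
        simp only [Matrix.mul_assoc]
        rw [h'.orthogonal', Matrix.mul_one]
    _ = (U * Uᵀ) * V * Matrix.diagonal (fun a => fpd f a mu) * Vᵀ := by
        rw [h2]; simp only [Matrix.mul_assoc]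
    _ = specGrad f V mu := by rw [h.orthogonal', Matrix.one_mul, specGrad]

theorem isCompact_orthogonal : IsCompact {U : Matrix (Fin n) (Fin n) ℝ | Uᵀ * U = 1} := by
  have h1 : IsCompact (Set.pi Set.univ fun _ : Fin n => Set.pi Set.univ fun _ : Fin n =>
      Set.Icc (-1 : ℝ) 1) :=
    isCompact_univ_pi fun _ => isCompact_univ_pi fun _ => isCompact_Icc
  refine IsCompact.of_isClosed_subset h1 ?_ ?_
  · exact isClosed_eq (by fun_prop) continuous_const
  · intro U hU i _ j _
    have h2 := congrFun (congrFun (show Uᵀ * U = 1 from hU) j) j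
    rw [Matrix.mul_apply, Matrix.one_apply_eq] at h2
    have h3 : U i j * U i j ≤ ∑ k, Uᵀ j k * U k j :=
      Finset.single_le_sum (f := fun k => Uᵀ j k * U k j)
        (fun k _ => mul_self_nonneg (U k j)) (Finset.mem_univ i)
    rw [h2] at h3
    exact abs_le.1 (abs_le_one_iff_mul_self_le_one.2 h3)

/-- Eigenbases of `A + t S` accumulate, as `t → 0`, at eigenbases of `A`. -/
theorem exists_tendsto_isDiagonalization {V : ℝ → Matrix (Fin n) (Fin n) ℝ}
    {Λ : ℝ → Fin n → ℝ} (hV : ∀ t, IsDiagonalization (A + t • S) (V t) (Λ t))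
    {G : Ultrafilter ℝ} (hG : (G : Filter ℝ) ≤ nhds 0) :
    ∃ V₀ lam₀, IsDiagonalization A V₀ lam₀ ∧ Filter.Tendsto V G (nhds V₀) ∧
      Filter.Tendsto Λ G (nhds lam₀) := by
  obtain ⟨V₀, hV₀, hlim⟩ := isCompact_orthogonal.ultrafilter_le_nhds (G.map V)
    (Filter.le_principal_iff.2 (Filter.mem_map.2 (Filter.univ_mem' fun t => (hV t).orthogonal)))
  have hVt : Filter.Tendsto V G (nhds V₀) := hlim
  have hAt : Filter.Tendsto (fun t : ℝ => A + t • S) G (nhds A) := by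
    have : Continuous (fun t : ℝ => A + t • S) := by fun_prop
    simpa using (this.tendsto 0).mono_left hG
  have hT : Filter.Tendsto (fun t => Matrix.diagonal (Λ t)) G (nhds (V₀ᵀ * A * V₀)) := by
    have hc : Continuous (fun p : Matrix (Fin n) (Fin n) ℝ × Matrix (Fin n) (Fin n) ℝ =>
        p.1ᵀ * p.2 * p.1) := by fun_prop
    refine ((hc.tendsto (V₀, A)).comp (hVt.prodMk_nhds hAt)).congr fun t => ?_
    exact (hV t).conj
  have hΛ : Filter.Tendsto Λ G (nhds fun i => (V₀ᵀ * A * V₀) i i) := by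
    have hc : Continuous (fun X : Matrix (Fin n) (Fin n) ℝ => fun i => X i i) := by fun_prop
    refine ((hc.tendsto _).comp hT).congr fun t => ?_
    ext i
    simp
  have hdiag : V₀ᵀ * A * V₀ = Matrix.diagonal fun i => (V₀ᵀ * A * V₀) i i := by
    have hc : Continuous (fun v : Fin n → ℝ => Matrix.diagonal v) := by fun_prop
    exact tendsto_nhds_unique hT ((hc.tendsto _).comp hΛ)
  have hV₀' : V₀ᵀ * V₀ = 1 := hV₀
  have hV₀'' : V₀ * V₀ᵀ = 1 := mul_eq_one_comm.1 hV₀'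
  refine ⟨V₀, _, ⟨hV₀', ?_⟩, hVt, hΛ⟩
  rw [← hdiag]
  calc A = (V₀ * V₀ᵀ) * A * (V₀ * V₀ᵀ) := by rw [hV₀'', Matrix.one_mul, Matrix.mul_one]
    _ = _ := by simp only [Matrix.mul_assoc]

/-- The increment `F(A + tS) - F(A)` lies between `t ∑ fₐ(λₜ) S(τₐ(t), τₐ(t))`, with the
eigenvalues `λₜ` and eigenvectors `τₐ(t)` of `A + tS`, and the increment of
`f(λ + t diag(Uᵀ S U))`. -/
theorem IsDiagonalization.hasDerivAt_spectralF (hf : IsCurvatureFunction f)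
    (h : IsDiagonalization A U lam) (hl : lam ∈ posCone n) (hS : S.IsSymm) :
    HasDerivAt (fun t : ℝ => spectralF f (A + t • S))
      (∑ i, ∑ j, specGrad f U lam i j * S i j) 0 := by
  have hsymm : ∀ t : ℝ, (A + t • S).IsSymm := fun t => h.isSymm.add (hS.smul t)
  choose V Λ hV using fun t => IsDiagonalization.exists_of_isSymm (hsymm t)
  have hcone : ∀ V₀ lam₀, IsDiagonalization A V₀ lam₀ → lam₀ ∈ posCone n := by
    intro V₀ lam₀ h₀
    obtain ⟨π, hπ⟩ := h.exists_perm h₀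
    rw [hπ]
    exact IsCurvatureFunction.comp_perm_mem hl π
  have hΛpos : ∀ᶠ t in nhds (0 : ℝ), Λ t ∈ posCone n := by
    rw [Filter.eventually_iff, Filter.mem_iff_ultrafilter]
    intro G hG
    obtain ⟨V₀, lam₀, h₀, -, hΛ⟩ := exists_tendsto_isDiagonalization hV hG
    exact hΛ ((isOpen_posCone n).mem_nhds (hcone _ _ h₀))
  set D := ∑ i, ∑ j, specGrad f U lam i j * S i j with hD
  -- the derivative computed with the eigenbasis at `t` converges to the one at `0`
  have hDt : Filter.Tendsto (fun t => ∑ a, fpd f a (Λ t) * quad (fun i => V t i a) S)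
      (nhds 0) (nhds D) := by
    rw [Filter.tendsto_iff_ultrafilter]
    intro G hG
    obtain ⟨V₀, lam₀, h₀, hVt, hΛ⟩ := exists_tendsto_isDiagonalization hV hG
    rw [hD, h.specGrad_eq hf h₀ hl, sum_specGrad_mul]
    refine tendsto_finsetSum _ fun a _ => ?_
    refine ((hf.continuousAt_fpd (hcone _ _ h₀) a).tendsto.comp hΛ).mul ?_
    have hc : Continuous (fun X : Matrix (Fin n) (Fin n) ℝ => quad (fun i => X i a) S) := by
      simp only [quad_apply]
      fun_prop
    exact (hc.tendsto _).comp hVt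
  have h0 : spectralF f (A + (0 : ℝ) • S) = f lam := by
    rw [zero_smul, add_zero, h.spectralF_eq hf hl]
  -- upper bound, from Schur's inequality in the eigenbasis of `A`
  have hup : HasDerivAt (fun t : ℝ => f (fun i => (Uᵀ * (A + t • S) * U) i i)) D 0 := by
    have he : ∀ (t : ℝ) i, (Uᵀ * (A + t • S) * U) i i = lam i + t * (Uᵀ * S * U) i i := by
      intro t i
      rw [Matrix.mul_add, Matrix.add_mul, h.conj]
      simp
    have hc0 : (fun i => (Uᵀ * (A + (0 : ℝ) • S) * U) i i) = lam := by
      funext i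
      rw [he]
      simp
    have := hf.hasDerivAt_comp (c := fun t i => (Uᵀ * (A + t • S) * U) i i)
      (c' := fun i => (Uᵀ * S * U) i i) (fun i => by
        simp only [he]
        simpa using ((hasDerivAt_id (0 : ℝ)).mul_const ((Uᵀ * S * U) i i)).const_add (lam i))
      (by rw [hc0]; exact hl)
    refine this.congr_deriv ?_
    rw [hD, sum_specGrad_mul, hc0]
    simp only [quad_col]
  have hup0 : f (fun i => (Uᵀ * (A + (0 : ℝ) • S) * U) i i) = f lam := by
    rw [zero_smul, add_zero, h.conj]
    simp
  rw [hasDerivAt_iff_isLittleO] at hup ⊢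
  simp only [sub_zero, h0, hup0, smul_eq_mul] at hup ⊢
  have hlow : (fun t : ℝ => t * ((∑ a, fpd f a (Λ t) * quad (fun i => V t i a) S) - D))
      =o[nhds 0] fun t => t := by
    have h1 : (fun t => (∑ a, fpd f a (Λ t) * quad (fun i => V t i a) S) - D)
        =o[nhds 0] fun _ => (1 : ℝ) := by
      rw [Asymptotics.isLittleO_one_iff]
      simpa using hDt.sub_const D
    simpa using (Asymptotics.isBigO_refl (fun t : ℝ => t) (nhds 0)).mul_isLittleO h1
  refine Asymptotics.IsBigO.trans_isLittleO (Asymptotics.IsBigO.of_bound 1 ?_)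
    (hup.norm_left.add hlow.norm_left)
  filter_upwards [hΛpos] with t ht
  have hF : spectralF f (A + t • S) = f (Λ t) := (hV t).spectralF_eq hf ht
  have hu : f (Λ t) ≤ f (fun i => (Uᵀ * (A + t • S) * U) i i) :=
    ((hV t).le_diag hf ht h.orthogonal).2
  have hlo : f lam + t * (∑ a, fpd f a (Λ t) * quad (fun i => V t i a) S) ≤ f (Λ t) := by
    obtain ⟨h1, h2⟩ := h.le_diag hf hl (hV t).orthogonal
    have h3 := hf.le_tangent ht h1
    have h4 : ∀ i, ((V t)ᵀ * A * V t) i i - Λ t i = -(t * quad (fun k => V t k i) S) := by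
      intro i
      have : (V t)ᵀ * A * V t = Matrix.diagonal (Λ t) - t • ((V t)ᵀ * S * V t) := by
        rw [← (hV t).conj, Matrix.mul_add, Matrix.add_mul]
        simp
      rw [this, quad_col]
      simp
    simp only [h4] at h3
    have h5 : ∑ i, fpd f i (Λ t) * -(t * quad (fun k => V t k i) S) =
        -(t * ∑ a, fpd f a (Λ t) * quad (fun i => V t i a) S) := by
      rw [Finset.mul_sum, ← Finset.sum_neg_distrib]
      exact Finset.sum_congr rfl fun i _ => by ring
    linarith
  rw [hF]
  simp only [Real.norm_eq_abs, one_mul]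
  refine le_trans (abs_le.2 ⟨?_, ?_⟩) (le_abs_self _)
  · have := neg_abs_le (t * ((∑ a, fpd f a (Λ t) * quad (fun i => V t i a) S) - D))
    have h6 := abs_nonneg (f (fun i => (Uᵀ * (A + t • S) * U) i i) - f lam - t * D)
    nlinarith
  · have := le_abs_self (f (fun i => (Uᵀ * (A + t • S) * U) i i) - f lam - t * D)
    have h6 := abs_nonneg (t * ((∑ a, fpd f a (Λ t) * quad (fun i => V t i a) S) - D))
    linarith

theorem IsDiagonalization.isFGradient (hf : IsCurvatureFunction f)
    (h : IsDiagonalization A U lam) (hl : lam ∈ posCone n) :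
    IsFGradient f A (specGrad f U lam) :=
  ⟨specGrad_isSymm f U lam, fun _ hS => h.hasDerivAt_spectralF hf hl hS⟩

end SpectralDerivative

/-! ### Principal frames and the linearized curvature equation -/

section PrincipalFrame

variable {n : ℕ} {u : Euc n → ℝ} {s : Set (Euc n)} {x : Euc n}

/-- The columns of `τ` form an orthonormal frame of principal directions, with principal
curvatures `κ`. -/
structure IsPrincipalFrame (u : Euc n → ℝ) (x : Euc n) (τ : Matrix (Fin n) (Fin n) ℝ)
    (κ : Fin n → ℝ) : Prop where
  orthonormal : τᵀ * firstForm u x * τ = 1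
  diagonal : τᵀ * secondForm u x * τ = Matrix.diagonal κ

theorem firstForm_transpose (u : Euc n → ℝ) (x : Euc n) : (firstForm u x)ᵀ = firstForm u x := by
  rw [firstForm_eq]
  simp [Matrix.transpose_vecMulVec]

theorem secondForm_transpose (hu : ContDiffOn ℝ ∞ u s) (hs : IsOpen s) (hx : x ∈ s)
    (h0 : u x ≠ 0) : (secondForm u x)ᵀ = secondForm u x := by
  rw [secondForm_eq h0]
  simp [hessMat_transpose hu hs hx, firstForm_transpose]

/-- The symmetric square root `u (I - ∇u ∇uᵀ / (w (1 + w)))` of the inverse of the first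
fundamental form: its columns are an orthonormal frame that depends smoothly on the point. -/
noncomputable def frameMat (u : Euc n → ℝ) (x : Euc n) : Matrix (Fin n) (Fin n) ℝ :=
  u x • (1 - (1 / (slopeW u x * (1 + slopeW u x))) •
    Matrix.vecMulVec (gradVec u x) (gradVec u x))

theorem frameMat_transpose (u : Euc n → ℝ) (x : Euc n) : (frameMat u x)ᵀ = frameMat u x := by
  simp [frameMat, Matrix.transpose_vecMulVec]

theorem frameMat_mul (h0 : u x ≠ 0) : frameMat u x * firstForm u x * frameMat u x = 1 := by
  have hw := (slopeW_pos u x)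
  have hS : gradVec u x ⬝ᵥ gradVec u x = slopeW u x ^ 2 - 1 := by linarith [slopeW_sq' u x]
  rw [firstForm_eq, frameMat]
  generalize slopeW u x = w at *
  set c := 1 / (w * (1 + w)) with hc
  have hQ : Matrix.vecMulVec (gradVec u x) (gradVec u x) * Matrix.vecMulVec (gradVec u x)
      (gradVec u x) = (w ^ 2 - 1) • Matrix.vecMulVec (gradVec u x) (gradVec u x) := by
    rw [vecMulVec_mul_self, hS]
  generalize Matrix.vecMulVec (gradVec u x) (gradVec u x) = Q at *
  have h1 : (1 - c • Q) * (1 + Q) * (1 - c • Q) =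
      1 + (1 - 2 * c * w ^ 2 + c ^ 2 * (w ^ 2 - 1) * w ^ 2) • Q := by
    simp only [sub_mul, mul_sub, mul_add, one_mul, mul_one, Matrix.smul_mul, Matrix.mul_smul,
      add_mul, hQ, smul_smul]
    module
  have h2 : 1 - 2 * c * w ^ 2 + c ^ 2 * (w ^ 2 - 1) * w ^ 2 = 0 := by
    rw [hc]
    have : 1 + w ≠ 0 := by positivity
    field_simp
    ring
  simp only [Matrix.smul_mul, Matrix.mul_smul, smul_smul]
  rw [h1, h2, zero_smul, add_zero, show u x * (1 / u x ^ 2 * u x) = 1 by field_simp, one_smul]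

theorem IsPrincipalFrame.isPrincipalCurvatures {τ : Matrix (Fin n) (Fin n) ℝ} {κ : Fin n → ℝ}
    (h : IsPrincipalFrame u x τ κ) : IsPrincipalCurvatures u x κ := by
  intro t
  have h1 : τᵀ.det * (firstForm u x).det * τ.det = 1 := by
    rw [← Matrix.det_mul, ← Matrix.det_mul, h.orthonormal, Matrix.det_one]
  have h2 : τᵀ * (secondForm u x - t • firstForm u x) * τ =
      Matrix.diagonal (fun i => κ i - t) := by
    rw [Matrix.mul_sub, Matrix.sub_mul, h.diagonal, Matrix.mul_smul, Matrix.smul_mul,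
      h.orthonormal]
    ext i j
    by_cases hij : i = j
    · subst hij; simp
    · simp [hij]
  have h3 := congrArg Matrix.det h2
  rw [Matrix.det_mul, Matrix.det_mul, Matrix.det_diagonal] at h3
  rw [← h3]
  calc (secondForm u x - t • firstForm u x).det
      = (τᵀ.det * (firstForm u x).det * τ.det) * (secondForm u x - t • firstForm u x).det := by
        rw [h1, one_mul]
    _ = _ := by ring

theorem IsPrincipalFrame.exists_perm {τ : Matrix (Fin n) (Fin n) ℝ} {κ μ : Fin n → ℝ}
    (h : IsPrincipalFrame u x τ κ) (hμ : IsPrincipalCurvatures u x μ) :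
    ∃ π : Equiv.Perm (Fin n), μ = fun i => κ (π i) := by
  have h1 : τᵀ.det * (firstForm u x).det * τ.det = 1 := by
    rw [← Matrix.det_mul, ← Matrix.det_mul, h.orthonormal, Matrix.det_one]
  have h2 : (firstForm u x).det ≠ 0 := fun h0 => by simp [h0] at h1
  exact exists_perm_of_prod_eq fun t =>
    mul_left_cancel₀ h2 ((hμ t).symm.trans (h.isPrincipalCurvatures t))

theorem IsPrincipalFrame.of_isDiagonalization {P U : Matrix (Fin n) (Fin n) ℝ} {κ : Fin n → ℝ}
    (hP : IsOrthonormalFrame u x P)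
    (hU : IsDiagonalization (inFrame P (secondForm u x)) U κ) :
    IsPrincipalFrame u x (P * U) κ where
  orthonormal := by
    calc (P * U)ᵀ * firstForm u x * (P * U) = Uᵀ * (Pᵀ * firstForm u x * P) * U := by
          rw [Matrix.transpose_mul]; simp only [Matrix.mul_assoc]
      _ = 1 := by rw [show Pᵀ * firstForm u x * P = 1 from hP, Matrix.mul_one, hU.orthogonal]
  diagonal := by
    calc (P * U)ᵀ * secondForm u x * (P * U) = Uᵀ * inFrame P (secondForm u x) * U := by
          rw [Matrix.transpose_mul, inFrame]; simp only [Matrix.mul_assoc]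
      _ = _ := hU.conj

theorem inFrame_isSymm {P X : Matrix (Fin n) (Fin n) ℝ} (hX : Xᵀ = X) : (inFrame P X).IsSymm := by
  rw [Matrix.IsSymm, inFrame]
  simp [Matrix.transpose_mul, hX, Matrix.mul_assoc]

theorem isOrthonormalFrame_frameMat (h0 : u x ≠ 0) : IsOrthonormalFrame u x (frameMat u x) := by
  rw [IsOrthonormalFrame, frameMat_transpose, frameMat_mul h0]

theorem exists_isPrincipalFrame (hu : ContDiffOn ℝ ∞ u s) (hs : IsOpen s) (hx : x ∈ s)
    (h0 : u x ≠ 0) : ∃ τ κ, IsPrincipalFrame u x τ κ := by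
  obtain ⟨U, κ, hU⟩ := IsDiagonalization.exists_of_isSymm
    (inFrame_isSymm (P := frameMat u x) (secondForm_transpose hu hs hx h0))
  exact ⟨_, κ, IsPrincipalFrame.of_isDiagonalization (isOrthonormalFrame_frameMat h0) hU⟩

theorem IsPrincipalFrame.quad_firstForm {τ : Matrix (Fin n) (Fin n) ℝ} {κ : Fin n → ℝ}
    (h : IsPrincipalFrame u x τ κ) (a : Fin n) :
    quad (fun i => τ i a) (firstForm u x) = 1 := by
  rw [quad_col, h.orthonormal, Matrix.one_apply_eq]

theorem IsPrincipalFrame.secondForm_mulVec {τ : Matrix (Fin n) (Fin n) ℝ} {κ : Fin n → ℝ}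
    (h : IsPrincipalFrame u x τ κ) (a : Fin n) :
    secondForm u x *ᵥ (fun i => τ i a) = κ a • firstForm u x *ᵥ (fun i => τ i a) := by
  have h1 : τᵀ * (firstForm u x * τ) = 1 := by rw [← Matrix.mul_assoc, h.orthonormal]
  have h2 : (firstForm u x * τ) * τᵀ = 1 := mul_eq_one_comm.1 h1
  have h3 : secondForm u x * τ = firstForm u x * τ * Matrix.diagonal κ := by
    rw [← h.diagonal]
    calc secondForm u x * τ = (firstForm u x * τ) * τᵀ * (secondForm u x * τ) := by
          rw [h2, Matrix.one_mul]
      _ = _ := by simp only [Matrix.mul_assoc]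
  ext i
  have h4 := congrFun (congrFun h3 i) a
  rw [Matrix.mul_diagonal] at h4
  simpa [Matrix.mul_apply, Matrix.mulVec, dotProduct, mul_comm (κ a)] using h4

/-- The product rule for `X(τ, τ)`, with `X` symmetric at the base point. -/
theorem hasDerivAt_quad {τ : ℝ → Fin n → ℝ} {τ' : Fin n → ℝ}
    {X : ℝ → Matrix (Fin n) (Fin n) ℝ} {X' : Matrix (Fin n) (Fin n) ℝ} {t : ℝ}
    (hτ : ∀ i, HasDerivAt (fun r => τ r i) (τ' i) t)
    (hX : ∀ i j, HasDerivAt (fun r => X r i j) (X' i j) t) (hsymm : (X t)ᵀ = X t) :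
    HasDerivAt (fun r => quad (τ r) (X r)) (2 * (τ' ⬝ᵥ X t *ᵥ τ t) + quad (τ t) X') t := by
  have h1 : HasDerivAt (fun r => quad (τ r) (X r))
      (∑ i, ∑ j, ((τ' i * τ t j + τ t i * τ' j) * X t i j + τ t i * τ t j * X' i j)) t := by
    simp only [quad_apply]
    exact HasDerivAt.fun_sum fun i _ => HasDerivAt.fun_sum fun j _ =>
      ((hτ i).fun_mul (hτ j)).fun_mul (hX i j)
  refine h1.congr_deriv ?_
  have h2 : τ' ⬝ᵥ X t *ᵥ τ t = ∑ i, ∑ j, τ' i * τ t j * X t i j := by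
    simp only [dotProduct, Matrix.mulVec, Finset.mul_sum]
    exact Finset.sum_congr rfl fun i _ => Finset.sum_congr rfl fun j _ => by ring
  have h3 : τ' ⬝ᵥ X t *ᵥ τ t = ∑ i, ∑ j, τ t i * τ' j * X t i j := by
    rw [h2, Finset.sum_comm]
    refine Finset.sum_congr rfl fun i _ => Finset.sum_congr rfl fun j _ => ?_
    rw [show X t j i = X t i j from congrFun (congrFun hsymm i) j]
    ring
  rw [two_mul]
  conv_rhs => rw [h2]
  rw [← h2]
  conv_rhs => rw [h2]; enter [1, 2]; rw [← h2, h3]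
  simp only [add_mul, Finset.sum_add_distrib, quad_apply]

theorem differentiableAt_frameMat (hu : ContDiffOn ℝ ∞ u s) (hs : IsOpen s) (hx : x ∈ s)
    (i j : Fin n) : DifferentiableAt ℝ (fun z => frameMat u z i j) x := by
  have hw := slopeW_pos u x
  have hW := differentiableAt_slopeW hu hs hx
  have hd := hu.differentiableAt_of_isOpen hs hx
  have hp := fun k => (hu.pd hs k).differentiableAt_of_isOpen hs hx
  simp only [frameMat, Matrix.smul_apply, Matrix.sub_apply, Matrix.vecMulVec_apply, gradVec,
    smul_eq_mul, one_div]
  exact hd.fun_mul ((((hW.fun_mul (hW.const_add 1)).fun_inv (by positivity)).fun_mul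
    ((hp i).fun_mul (hp j))).const_sub _)

end PrincipalFrame

namespace IsConvexGraph

variable {n : ℕ} {u : Euc n → ℝ} {Ω : Set (Euc n)} {x : Euc n} {f : (Fin n → ℝ) → ℝ} {σ : ℝ}
  {τ : Matrix (Fin n) (Fin n) ℝ} {κ : Fin n → ℝ}

theorem ne_zero (hu : IsConvexGraph f σ Ω u) : ∀ z ∈ Ω, u z ≠ 0 := fun z hz => (hu.pos z hz).ne'

theorem mem_posCone (hu : IsConvexGraph f σ Ω u) (hx : x ∈ Ω) (h : IsPrincipalFrame u x τ κ) :
    κ ∈ posCone n := hu.convex x hx κ h.isPrincipalCurvatures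

theorem apply_eq (hu : IsConvexGraph f σ Ω u) (hx : x ∈ Ω) (h : IsPrincipalFrame u x τ κ) :
    f κ = σ := hu.curvature_eq x hx κ h.isPrincipalCurvatures

/-- The equation `f(κ) = σ`, differentiated along a line. In an orthonormal frame that moves
smoothly, Schur's inequality bounds `f` of the diagonal of the second fundamental form below by
`f(κ) = σ`, with equality where the frame is principal; so the derivative vanishes there. -/
theorem sum_fpd_mul_deriv_eq_zero (hf : IsCurvatureFunction f) (hΩ : IsOpen Ω)
    (hu : IsConvexGraph f σ Ω u) (hx : x ∈ Ω) (h : IsPrincipalFrame u x τ κ) {e : Euc n}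
    {Dg Dh : Matrix (Fin n) (Fin n) ℝ}
    (hDg : ∀ i j, HasDerivAt (fun t : ℝ => firstForm u (x + t • e) i j) (Dg i j) 0)
    (hDh : ∀ i j, HasDerivAt (fun t : ℝ => secondForm u (x + t • e) i j) (Dh i j) 0) :
    ∑ a, fpd f a κ * (quad (fun i => τ i a) Dh - κ a * quad (fun i => τ i a) Dg) = 0 := by
  have hx0 := hu.ne_zero x hx
  set B := frameMat u x with hB
  set g := firstForm u x with hg
  have hBgB : B * g * B = 1 := frameMat_mul hx0
  set N := g * B * τ with hN
  set P : ℝ → Matrix (Fin n) (Fin n) ℝ := fun t => frameMat u (x + t • e) * N with hP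
  have hNN : Nᵀ * N = 1 := by
    have h1 : B * (g * B) = 1 := by rw [← Matrix.mul_assoc, hBgB]
    have h2 : g * B * B = 1 := mul_eq_one_comm.1 h1
    have h3 : g * B = B * g := by
      calc g * B = g * B * (B * g * B) := by rw [hBgB, Matrix.mul_one]
        _ = (g * B * B) * (g * B) := by simp only [Matrix.mul_assoc]
        _ = (B * g * B) * (g * B) := by rw [h2, hBgB]
        _ = B * g * (B * g * B) := by simp only [Matrix.mul_assoc]
        _ = B * g := by rw [hBgB, Matrix.mul_one]
    have h4 : Nᵀ = τᵀ * (B * g) := by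
      rw [hN, Matrix.transpose_mul, Matrix.transpose_mul, hB, hg, frameMat_transpose,
        firstForm_transpose]
    calc Nᵀ * N = τᵀ * (B * g * (g * B)) * τ := by rw [h4, hN]; simp only [Matrix.mul_assoc]
      _ = τᵀ * (B * g * B * g) * τ := by rw [h3]; simp only [Matrix.mul_assoc]
      _ = 1 := by rw [hBgB, Matrix.one_mul, h.orthonormal]
  have hP0 : P 0 = τ := by
    simp only [hP, zero_smul, add_zero, hN]
    calc frameMat u x * (g * B * τ) = (B * g * B) * τ := by simp only [Matrix.mul_assoc, hB]
      _ = τ := by rw [hBgB, Matrix.one_mul]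
  have hmem : ∀ᶠ t in nhds (0 : ℝ), x + t • e ∈ Ω := by
    have hc : ContinuousAt (fun t : ℝ => x + t • e) 0 := by fun_prop
    exact hc.eventually_mem (hΩ.mem_nhds (by simpa using hx))
  have hortho : ∀ t : ℝ, x + t • e ∈ Ω → IsOrthonormalFrame u (x + t • e) (P t) := by
    intro t ht
    have h1 := frameMat_mul (hu.ne_zero _ ht)
    rw [IsOrthonormalFrame]
    calc (P t)ᵀ * firstForm u (x + t • e) * P t
        = Nᵀ * (frameMat u (x + t • e) * firstForm u (x + t • e) * frameMat u (x + t • e)) * N := by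
          simp only [hP, Matrix.transpose_mul, frameMat_transpose, Matrix.mul_assoc]
      _ = 1 := by rw [h1, Matrix.mul_one, hNN]
  set d : ℝ → Fin n → ℝ := fun t a => quad (fun i => P t i a) (secondForm u (x + t • e)) with hd
  have hd0 : d 0 = κ := by
    ext a
    simp only [hd, hP0, zero_smul, add_zero]
    rw [quad_col, h.diagonal, Matrix.diagonal_apply_eq]
  have hmin : IsLocalMin (fun t => f (d t)) 0 := by
    filter_upwards [hmem] with t ht
    rw [hd0, hu.apply_eq hx h]
    obtain ⟨U, mu, hU⟩ := IsDiagonalization.exists_of_isSymm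
      (inFrame_isSymm (P := P t) (secondForm_transpose hu.smooth hΩ ht (hu.ne_zero _ ht)))
    have hfr := IsPrincipalFrame.of_isDiagonalization (hortho t ht) hU
    have h1 := (hU.le_diag hf (hu.mem_posCone ht hfr) (R := 1) (by simp)).2
    rw [hu.apply_eq ht hfr] at h1
    have h2 : d t = fun a => ((1ᵀ * inFrame (P t) (secondForm u (x + t • e)) * 1 :
        Matrix (Fin n) (Fin n) ℝ)) a a := by
      funext a
      rw [Matrix.transpose_one, Matrix.one_mul, Matrix.mul_one, inFrame]
      exact quad_col _ _ _
    rw [h2]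
    exact h1
  -- derivatives of the frame and of the diagonal entries
  have hPd : ∀ a i, ∃ c, HasDerivAt (fun t => P t i a) c 0 := by
    intro a i
    have h1 : ∀ k, HasDerivAt (fun t : ℝ => frameMat u (x + t • e) i k) _ 0 := fun k =>
      hasDerivAt_line (differentiableAt_frameMat hu.smooth hΩ hx i k) e
    have h2 := HasDerivAt.fun_sum (u := Finset.univ) fun k _ => (h1 k).mul_const (N k a)
    refine ⟨_, h2.congr_of_eventuallyEq (Filter.Eventually.of_forall fun t => ?_)⟩
    simp only [hP, Matrix.mul_apply]
  choose P' hP' using hPd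
  have hdd : ∀ a, HasDerivAt (fun t => d t a)
      (quad (fun i => τ i a) Dh - κ a * quad (fun i => τ i a) Dg) 0 := by
    intro a
    have h1 := hasDerivAt_quad (τ := fun t i => P t i a) (hP' a) hDh
      (by simpa using secondForm_transpose hu.smooth hΩ hx hx0)
    have h2 := hasDerivAt_quad (τ := fun t i => P t i a) (hP' a) hDg
      (by simpa using firstForm_transpose u x)
    have h3 : (fun t => quad (fun i => P t i a) (firstForm u (x + t • e))) =ᶠ[nhds 0]
        fun _ => (1 : ℝ) := by
      filter_upwards [hmem] with t ht
      rw [quad_col, hortho t ht, Matrix.one_apply_eq]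
    have h4 := h2.unique ((hasDerivAt_const (0 : ℝ) (1 : ℝ)).congr_of_eventuallyEq h3)
    refine h1.congr_deriv ?_
    simp only [hP0, zero_smul, add_zero] at h4 ⊢
    rw [h.secondForm_mulVec, dotProduct_smul, smul_eq_mul]
    linear_combination (κ a) * h4
  have h5 := hf.hasDerivAt_comp hdd (by rw [hd0]; exact hu.mem_posCone hx h)
  rw [hd0] at h5
  exact hmin.hasDerivAt_eq_zero h5

theorem exists_hasDerivAt_forms (hΩ : IsOpen Ω) (hu : IsConvexGraph f σ Ω u) (hx : x ∈ Ω)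
    (e : Euc n) : ∃ Dg Dh : Matrix (Fin n) (Fin n) ℝ,
      (∀ i j, HasDerivAt (fun t : ℝ => firstForm u (x + t • e) i j) (Dg i j) 0) ∧
      ∀ i j, HasDerivAt (fun t : ℝ => secondForm u (x + t • e) i j) (Dh i j) 0 :=
  ⟨Matrix.of fun _ _ => _, Matrix.of fun _ _ => _,
    fun i j => hasDerivAt_line_firstForm hu.smooth hΩ hx (hu.ne_zero x hx) e i j,
    fun i j => hasDerivAt_line_secondForm hu.smooth hΩ hx (hu.ne_zero x hx) e i j⟩

/-- The linearized operator applied to `(c - ν) / u`, for an arbitrary constant `c`. -/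
theorem sum_fpd_mul_quad_covHess_eta (hf : IsCurvatureFunction f) (hΩ : IsOpen Ω)
    (hu : IsConvexGraph f σ Ω u) (hx : x ∈ Ω) (h : IsPrincipalFrame u x τ κ) (c : ℝ) :
    ∑ a, fpd f a κ * quad (fun i => τ i a) (covHess (firstForm u) (eta c u) x) =
      (c * (∑ a, fpd f a κ - σ / slopeW u x)
        - (σ - (∑ a, fpd f a κ * κ a ^ 2) / slopeW u x)) / u x := by
  obtain ⟨Dg, Dh, hDg, hDh⟩ := hu.exists_hasDerivAt_forms hΩ hx (WithLp.toLp 2 (gradVec u x))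
  have h1 := hu.sum_fpd_mul_deriv_eq_zero hf hΩ hx h hDg hDh
  have h2 := hf.sum_fpd_mul_self (hu.mem_posCone hx h)
  rw [hu.apply_eq hx h] at h2
  simp only [fun a => quad_covHess_eta (c := c) hu.smooth hΩ hx hu.ne_zero hDg hDh
    (h.quad_firstForm a) (h.secondForm_mulVec a)]
  have h3 : ∀ a, fpd f a κ * ((c * (1 - κ a / slopeW u x) - (κ a - κ a ^ 2 / slopeW u x)) / u x
      + (quad (fun i => τ i a) Dh - κ a * quad (fun i => τ i a) Dg) / slopeW u x ^ 2) =
      c / u x * fpd f a κ - (c / slopeW u x + 1) / u x * (fpd f a κ * κ a)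
        + 1 / (slopeW u x * u x) * (fpd f a κ * κ a ^ 2)
        + 1 / slopeW u x ^ 2 *
          (fpd f a κ * (quad (fun i => τ i a) Dh - κ a * quad (fun i => τ i a) Dg)) := by
    intro a
    have hw := (slopeW_pos u x).ne'
    have hx0 := hu.ne_zero x hx
    field_simp
    ring
  simp only [h3, Finset.sum_add_distrib, Finset.sum_sub_distrib, ← Finset.mul_sum, h1, h2]
  have hw := (slopeW_pos u x).ne'
  have hx0 := hu.ne_zero x hx
  field_simp
  ring

/-- The differential inequality for `η`, in terms of a principal frame. By Cauchy-Schwarz,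
`σ² = (∑ fᵢ κᵢ)² ≤ (∑ fᵢ) (∑ fᵢ κᵢ²)`. -/
theorem le_sum_fpd_mul_quad (hf : IsCurvatureFunction f) (hΩ : IsOpen Ω) (hσ : 0 < σ)
    (hu : IsConvexGraph f σ Ω u) (hx : x ∈ Ω) (h : IsPrincipalFrame u x τ κ) :
    σ * (1 - σ) * ((∑ i, fpd f i κ) - 1) / u x ≤
      ∑ a, fpd f a κ * quad (fun i => τ i a) (covHess (firstForm u) (eta σ u) x) := by
  rw [hu.sum_fpd_mul_quad_covHess_eta hf hΩ hx h]
  have hκ := hu.mem_posCone hx h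
  have h1 := hf.one_le_sum_fpd hκ
  have h2 := hf.sum_fpd_mul_self hκ
  rw [hu.apply_eq hx h] at h2
  have hu0 := hu.pos x hx
  refine div_le_div_of_nonneg_right ?_ hu0.le
  have hcs : σ ^ 2 ≤ (∑ i, fpd f i κ) * ∑ i, fpd f i κ * κ i ^ 2 := by
    rw [← h2]
    refine Finset.sum_sq_le_sum_mul_sum_of_sq_le_mul _ (fun i _ => (hf.fpd_pos κ hκ i).le)
      (fun i _ => mul_nonneg (hf.fpd_pos κ hκ i).le (sq_nonneg _)) fun i _ => le_of_eq (by ring)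
  set T := ∑ i, fpd f i κ
  set Q := ∑ i, fpd f i κ * κ i ^ 2
  have hν0 : 0 < 1 / slopeW u x := one_div_pos.2 (slopeW_pos u x)
  have hν1 : 1 / slopeW u x ≤ 1 := (div_le_one (slopeW_pos u x)).2 (one_le_slopeW u x)
  rw [div_eq_mul_one_div σ, div_eq_mul_one_div Q]
  set ν := 1 / slopeW u x
  have hQ : σ ^ 2 / T ≤ Q := by
    rw [div_le_iff₀ (by linarith)]
    linarith
  have hT : 1 / T ≤ 1 := (div_le_one (by linarith)).2 h1
  have h3 : ν * (σ ^ 2 / T) ≤ ν * Q := mul_le_mul_of_nonneg_left hQ hν0.le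
  have h4 : ν * (σ ^ 2 / T) - ν * σ ^ 2 = -(ν * σ ^ 2 * ((T - 1) / T)) := by
    have : T ≠ 0 := by linarith
    field_simp
    ring
  have h5 : ν * σ ^ 2 * ((T - 1) / T) ≤ σ ^ 2 * (T - 1) := by
    have h6 : (T - 1) / T ≤ T - 1 := div_le_self (by linarith) h1
    have h7 : 0 ≤ (T - 1) / T := div_nonneg (by linarith) (by linarith)
    calc ν * σ ^ 2 * ((T - 1) / T) ≤ 1 * σ ^ 2 * ((T - 1) / T) := by gcongr
      _ ≤ σ ^ 2 * (T - 1) := by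
        rw [one_mul]; gcongr
  nlinarith

end IsConvexGraph

/-! ### The differential inequality and the maximum principle -/

theorem quad_hessMat_nonpos_of_isLocalMax {n : ℕ} {v : Euc n → ℝ} {s : Set (Euc n)}
    (hv : ContDiffOn ℝ ∞ v s) (hs : IsOpen s) {x : Euc n} (hx : x ∈ s) (h : IsLocalMax v x)
    (τ : Fin n → ℝ) : quad τ (hessMat v x) ≤ 0 :=
  sum_pd_pd_nonpos_of_isLocalMax hv hs hx h (WithLp.toLp 2 τ)

namespace IsConvexGraph

variable {n : ℕ} {u : Euc n → ℝ} {Ω : Set (Euc n)} {x : Euc n} {f : (Fin n → ℝ) → ℝ} {σ : ℝ}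

/-- The differential inequality in an arbitrary orthonormal frame. -/
theorem exists_isFGradient (hf : IsCurvatureFunction f) (hΩ : IsOpen Ω) (hσ : 0 < σ)
    (hσ1 : σ < 1) (hu : IsConvexGraph f σ Ω u) (hx : x ∈ Ω) {P : Matrix (Fin n) (Fin n) ℝ}
    (hP : IsOrthonormalFrame u x P) :
    ∃ Φ : Matrix (Fin n) (Fin n) ℝ, IsFGradient f (inFrame P (secondForm u x)) Φ ∧
      ∀ κ : Fin n → ℝ, IsPrincipalCurvatures u x κ →
        σ * (1 - σ) * ((∑ i, fpd f i κ) - 1) / u x ≤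
            ∑ i, ∑ j, Φ i j * inFrame P (covHess (firstForm u) (eta σ u) x) i j ∧
          0 ≤ σ * (1 - σ) * ((∑ i, fpd f i κ) - 1) / u x := by
  obtain ⟨U, lam, hU⟩ := IsDiagonalization.exists_of_isSymm
    (inFrame_isSymm (P := P) (secondForm_transpose hu.smooth hΩ hx (hu.ne_zero x hx)))
  have hfr := IsPrincipalFrame.of_isDiagonalization hP hU
  have hl := hu.mem_posCone hx hfr
  refine ⟨specGrad f U lam, hU.isFGradient hf hl, fun κ hκ => ?_⟩
  obtain ⟨π, rfl⟩ := hfr.exists_perm hκ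
  rw [hf.sum_fpd_comp_perm hl, sum_specGrad_mul]
  have hq : ∀ a X, quad (fun i => U i a) (inFrame P X) = quad (fun i => (P * U) i a) X := by
    intro a X
    rw [quad_col, quad_col, inFrame, Matrix.transpose_mul]
    simp only [Matrix.mul_assoc]
  simp only [hq]
  refine ⟨hu.le_sum_fpd_mul_quad hf hΩ hσ hx hfr, ?_⟩
  have h1 := hf.one_le_sum_fpd hl
  have h2 := hu.pos x hx
  exact div_nonneg (mul_nonneg (mul_nonneg hσ.le (by linarith)) (by linarith)) h2.le

/-- For `c > σ` the function `(c - ν) / u = η + (c - σ) / u` is a strict subsolution, since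
`∑ fᵢ ≥ 1 > σ ν`, and so it has no interior maximum. -/
theorem not_isLocalMax_eta (hf : IsCurvatureFunction f) (hΩ : IsOpen Ω) (hσ : 0 < σ)
    (hσ1 : σ < 1) (hu : IsConvexGraph f σ Ω u) (hx : x ∈ Ω) {c : ℝ} (hc : σ < c) :
    ¬ IsLocalMax (eta c u) x := by
  intro hmax
  have hx0 := hu.ne_zero x hx
  have hux := hu.pos x hx
  have hw := slopeW_pos u x
  have hw1 := one_le_slopeW u x
  obtain ⟨τ, κ, hfr⟩ := exists_isPrincipalFrame hu.smooth hΩ hx hx0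
  have hκ := hu.mem_posCone hx hfr
  have hT := hf.one_le_sum_fpd hκ
  have h1 := hu.le_sum_fpd_mul_quad hf hΩ hσ hx hfr
  rw [hu.sum_fpd_mul_quad_covHess_eta hf hΩ hx hfr] at h1
  have h2 := hu.sum_fpd_mul_quad_covHess_eta hf hΩ hx hfr c
  have h3 : gradVec (eta c u) x = 0 := funext fun i => pd_eq_zero_of_isLocalMax hmax i
  have h4 : ∑ a, fpd f a κ * quad (fun i => τ i a) (covHess (firstForm u) (eta c u) x) ≤ 0 := by
    refine Finset.sum_nonpos fun a _ =>
      mul_nonpos_of_nonneg_of_nonpos (hf.fpd_pos κ hκ a).le ?_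
    rw [covHess_firstForm hu.smooth hΩ hx hx0, h3]
    simpa using quad_hessMat_nonpos_of_isLocalMax (contDiffOn_eta c hu.smooth hΩ hu.ne_zero) hΩ hx
      hmax _
  rw [h2] at h4
  have h5 : 0 ≤ σ * (1 - σ) * ((∑ i, fpd f i κ) - 1) / u x :=
    div_nonneg (mul_nonneg (mul_nonneg hσ.le (by linarith)) (by linarith)) hux.le
  have h6 := (le_div_iff₀ hux).1 (h5.trans h1)
  rw [zero_mul] at h6
  have h7 : σ / slopeW u x ≤ σ := div_le_self hσ.le hw1
  have h8 : 0 < (c - σ) * (∑ a, fpd f a κ - σ / slopeW u x) :=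
    mul_pos (by linarith) (by linarith)
  have h9 := div_pos (a := c * (∑ a, fpd f a κ - σ / slopeW u x)
        - (σ - (∑ a, fpd f a κ * κ a ^ 2) / slopeW u x)) (by linarith) hux
  linarith

/-- The maximum principle for `η`: a bound that holds asymptotically at the boundary holds in the
domain. -/
theorem eta_le_of_frontier (hf : IsCurvatureFunction f) (hΩ : IsOpen Ω) (hσ : 0 < σ)
    (hσ1 : σ < 1) (hu : IsConvexGraph f σ Ω u) (hb : Bornology.IsBounded Ω) {B : ℝ}
    (hB : ∀ x₀ ∈ frontier Ω, ∀ c, B < c → ∀ᶠ x in nhdsWithin x₀ Ω, eta σ u x < c) :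
    ∀ x ∈ Ω, eta σ u x ≤ B := by
  intro x₁ hx₁
  by_contra! hlt
  obtain ⟨c, hBc, hc⟩ := exists_between hlt
  have hcont : ContinuousOn (eta σ u) Ω :=
    (contDiffOn_eta σ hu.smooth hΩ hu.ne_zero).continuousOn
  set K := {x ∈ Ω | c ≤ eta σ u x} with hK
  have hKΩ : K ⊆ Ω := fun x hx => hx.1
  have hKclosed : IsClosed K := by
    rw [← closure_subset_iff_isClosed]
    intro x hx
    rw [mem_closure_iff_frequently] at hx
    have hxΩ : x ∈ Ω := by
      by_contra hn
      have hfr : x ∈ frontier Ω := by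
        rw [hΩ.frontier_eq]
        exact ⟨mem_closure_iff_frequently.2 (hx.mono fun y hy => hy.1), hn⟩
      have h1 := eventually_nhdsWithin_iff.1 (hB x hfr c hBc)
      obtain ⟨y, hy, hy'⟩ := (hx.and_eventually h1).exists
      exact absurd (hy' hy.1) (not_lt.2 hy.2)
    refine ⟨hxΩ, ?_⟩
    by_contra! hn
    have h1 := (hcont.continuousAt (hΩ.mem_nhds hxΩ)).eventually (gt_mem_nhds hn)
    obtain ⟨y, hy, hy'⟩ := (hx.and_eventually h1).exists
    exact absurd hy' (not_lt.2 hy.2)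
  have hKcomp : IsCompact K := Metric.isCompact_of_isClosed_isBounded hKclosed (hb.subset hKΩ)
  obtain ⟨L, hL, hKL, hLΩ⟩ := exists_compact_between hKcomp hΩ hKΩ
  have hx₁L : x₁ ∈ L := interior_subset (hKL ⟨hx₁, hc.le⟩)
  have hinv : ContinuousOn (fun x => (u x)⁻¹) L :=
    (hu.smooth.continuousOn.mono hLΩ).inv₀ fun x hx => hu.ne_zero x (hLΩ hx)
  obtain ⟨M, hM⟩ := hL.bddAbove_image hinv
  have hM' : ∀ x ∈ L, (u x)⁻¹ ≤ M := fun x hx => hM (Set.mem_image_of_mem _ hx)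
  have hMpos : 0 < M := (inv_pos.2 (hu.pos x₁ hx₁)).trans_le (hM' x₁ hx₁L)
  set δ := (eta σ u x₁ - c) / M with hδ
  have hδ0 : 0 < δ := div_pos (by linarith) hMpos
  have hsplit : ∀ x, eta (σ + δ) u x = eta σ u x + δ * (u x)⁻¹ := fun x => by
    rw [eta_eq, eta_eq, div_eq_mul_inv, div_eq_mul_inv]; ring
  obtain ⟨x₂, hx₂L, hx₂⟩ := hL.exists_isMaxOn ⟨x₁, hx₁L⟩
    ((contDiffOn_eta (σ + δ) hu.smooth hΩ hu.ne_zero).continuousOn.mono hLΩ)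
  have h1 : eta (σ + δ) u x₁ ≤ eta (σ + δ) u x₂ := hx₂ hx₁L
  have hx₂K : x₂ ∈ K := by
    refine ⟨hLΩ hx₂L, ?_⟩
    by_contra! hn
    rw [hsplit, hsplit] at h1
    have h2 : δ * (u x₂)⁻¹ ≤ δ * M := mul_le_mul_of_nonneg_left (hM' x₂ hx₂L) hδ0.le
    have h3 : δ * M = eta σ u x₁ - c := by rw [hδ]; field_simp
    have h4 : 0 < δ * (u x₁)⁻¹ := mul_pos hδ0 (inv_pos.2 (hu.pos x₁ hx₁))
    linarith
  exact hu.not_isLocalMax_eta hf hΩ hσ hσ1 (hLΩ hx₂L) (by linarith)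
    (hx₂.isLocalMax (mem_interior_iff_mem_nhds.1 (hKL hx₂K)))

end IsConvexGraph

theorem frontier_nonempty_of_isBounded {n : ℕ} (hn : 1 ≤ n) {Ω : Set (Euc n)}
    (hΩ : Ω.Nonempty) (hb : Bornology.IsBounded Ω) : (frontier Ω).Nonempty := by
  have : Nonempty (Fin n) := ⟨⟨0, hn⟩⟩
  rw [nonempty_frontier_iff]
  refine ⟨hΩ, fun h => ?_⟩
  rw [h] at hb
  exact NormedSpace.unbounded_univ ℝ (Euc n) hb

theorem IsConvexGraph.exists_frontier_isMaxOn {n : ℕ} (hn : 1 ≤ n) {u : Euc n → ℝ}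
    {Ω : Set (Euc n)} {f : (Fin n → ℝ) → ℝ} {σ : ℝ} (hf : IsCurvatureFunction f)
    (hΩ : IsOpen Ω) (hne : Ω.Nonempty) (hσ : 0 < σ) (hσ1 : σ < 1) (hu : IsConvexGraph f σ Ω u)
    (hb : Bornology.IsBounded Ω) {H : Euc n → ℝ} (hH : ContinuousOn H (closure Ω))
    (hHη : Set.EqOn H (eta σ u) Ω) :
    (∃ x₀ ∈ frontier Ω, IsMaxOn H (closure Ω) x₀) ∧
      ∀ x ∈ Ω, eta σ u x ≤ sSup (H '' frontier Ω) := by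
  have hcomp : IsCompact (frontier Ω) :=
    Metric.isCompact_of_isClosed_isBounded isClosed_frontier
      (hb.closure.subset frontier_subset_closure)
  obtain ⟨x₀, hx₀, hmax⟩ := hcomp.exists_isMaxOn (frontier_nonempty_of_isBounded hn hne hb)
    (hH.mono frontier_subset_closure)
  have hle : ∀ x ∈ Ω, eta σ u x ≤ H x₀ := by
    refine hu.eta_le_of_frontier hf hΩ hσ hσ1 hb fun y hy c hc => ?_
    have h1 : H y < c := (show H y ≤ H x₀ from hmax hy).trans_lt hc
    have h2 := ((hH y (frontier_subset_closure hy)).mono subset_closure).eventually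
      (gt_mem_nhds h1)
    filter_upwards [h2, self_mem_nhdsWithin] with x hx hxΩ
    rwa [← hHη hxΩ]
  refine ⟨⟨x₀, hx₀, fun x hx => ?_⟩, fun x hx => (hle x hx).trans ?_⟩
  · by_cases hxΩ : x ∈ Ω
    · exact (hHη hxΩ).trans_le (hle x hxΩ)
    · exact hmax (by rw [hΩ.frontier_eq]; exact ⟨hx, hxΩ⟩)
  · exact le_csSup (hcomp.bddAbove_image (hH.mono frontier_subset_closure))
      (Set.mem_image_of_mem H hx₀)

/-! ### Comparison with spherical caps of constant curvature -/

theorem sq_dist_eq_sum {n : ℕ} (x c : Euc n) : dist x c ^ 2 = ∑ i, (x i - c i) ^ 2 := by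
  rw [EuclideanSpace.dist_eq, Real.sq_sqrt (by positivity)]
  simp [Real.dist_eq, sq_abs]

theorem quad_hessMat_nonneg_of_isLocalMin {n : ℕ} {v : Euc n → ℝ} {s : Set (Euc n)}
    (hv : ContDiffOn ℝ ∞ v s) (hs : IsOpen s) {x : Euc n} (hx : x ∈ s) (h : IsLocalMin v x)
    (τ : Fin n → ℝ) : 0 ≤ quad τ (hessMat v x) := by
  have h1 := quad_hessMat_nonpos_of_isLocalMax (v := fun z => -v z) hv.neg hs hx h.neg τ
  have h2 : hessMat (fun z => -v z) x = -hessMat v x := by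
    have h3 : ∀ (j : Fin n) (g : Euc n → ℝ), pd j (fun z => -g z) = fun z => -pd j g z := by
      intro j g
      ext z
      simp [pd]
    ext i j
    simp [hessMat, h3]
  rw [h2, map_neg] at h1
  linarith

/-- Derivative of `|z - c|² + u² - 2 a u`, the function whose sublevel sets on the graph are cut out
by balls with centre `(c, a)`. -/
theorem pd_sq_dist_add {n : ℕ} {u : Euc n → ℝ} {Ω : Set (Euc n)} {x : Euc n} (hΩ : IsOpen Ω)
    (hu : ContDiffOn ℝ ∞ u Ω) (hx : x ∈ Ω) (c : Euc n) (a : ℝ) (j : Fin n) :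
    pd j (fun z => ∑ i, (z i - c i) ^ 2 + u z ^ 2 - 2 * a * u z) x =
      2 * (x j - c j) + 2 * (u x - a) * pd j u x := by
  have hd := hu.differentiableAt_of_isOpen hΩ hx
  have hz : ∀ i : Fin n, DifferentiableAt ℝ (fun z : Euc n => (z i - c i) ^ 2) x := fun i => by
    fun_prop
  have hdiff : DifferentiableAt ℝ (fun z => ∑ i, (z i - c i) ^ 2 + u z ^ 2 - 2 * a * u z) x :=
    ((DifferentiableAt.fun_sum fun i _ => hz i).fun_add (hd.fun_pow 2)).fun_sub
      (hd.const_mul (2 * a))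
  have h1 := hasDerivAt_pd hd j
  have h2 : HasDerivAt (fun t : ℝ => ∑ i, ((x + t • EuclideanSpace.single j (1 : ℝ)) i - c i) ^ 2)
      (∑ i, 2 * (x i - c i) * if i = j then 1 else 0) 0 := by
    refine HasDerivAt.fun_sum fun i _ => ?_
    have h3 := hasDerivAt_pd (v := fun z : Euc n => z i) (x := x) (by fun_prop) j
    rw [pd_coord] at h3
    simpa using (h3.sub_const (c i)).fun_pow 2
  refine pd_eq_of_hasDerivAt hdiff (((h2.fun_add (h1.fun_pow 2)).fun_sub
    (h1.const_mul (2 * a))).congr_deriv ?_)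
  simp
  ring

theorem hessMat_sq_dist_add {n : ℕ} {u : Euc n → ℝ} {Ω : Set (Euc n)} {x : Euc n} (hΩ : IsOpen Ω)
    (hu : ContDiffOn ℝ ∞ u Ω) (hx : x ∈ Ω) (h0 : u x ≠ 0) (c : Euc n) (a : ℝ) :
    hessMat (fun z => ∑ i, (z i - c i) ^ 2 + u z ^ 2 - 2 * a * u z) x =
      (2 * u x ^ 2) • firstForm u x + (2 * (u x - a)) • hessMat u x := by
  ext i j
  simp only [hessMat, Matrix.of_apply, Matrix.add_apply, Matrix.smul_apply, smul_eq_mul,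
    firstForm_apply]
  rw [pd_congr (v' := fun z => 2 * (z j - c j) + 2 * (u z - a) * pd j u z)]
  · have hd := hu.differentiableAt_of_isOpen hΩ hx
    have hj := (hu.pd hΩ j).differentiableAt_of_isOpen hΩ hx
    have hz : DifferentiableAt ℝ (fun z : Euc n => z j) x := by fun_prop
    have hdiff : DifferentiableAt ℝ
        (fun z : Euc n => 2 * (z j - c j) + 2 * (u z - a) * pd j u z) x :=
      ((hz.sub_const _).const_mul 2).fun_add (((hd.sub_const a).const_mul 2).fun_mul hj)
    have h3 := hasDerivAt_pd hz i
    rw [pd_coord] at h3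
    have h4 := ((h3.sub_const (c j)).const_mul 2).fun_add
      ((((hasDerivAt_pd hd i).sub_const a).const_mul 2).fun_mul (hasDerivAt_pd hj i))
    refine pd_eq_of_hasDerivAt hdiff (h4.congr_deriv ?_)
    simp only [zero_smul, add_zero, eq_comm (a := j)]
    field_simp
    ring
  · filter_upwards [hΩ.mem_nhds hx] with z hz using pd_sq_dist_add hΩ hu hz c a j

/-- Normal curvature of a graph in a principal direction, in terms of the Euclidean Hessian. -/
theorem IsPrincipalFrame.quad_hessMat {n : ℕ} {u : Euc n → ℝ} {x : Euc n}
    {τ : Matrix (Fin n) (Fin n) ℝ} {κ : Fin n → ℝ} (h : IsPrincipalFrame u x τ κ) (h0 : u x ≠ 0)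
    (a : Fin n) :
    quad (fun i => τ i a) (hessMat u x) = u x * (slopeW u x * κ a - 1) := by
  have hw := (slopeW_pos u x).ne'
  have h1 : quad (fun i => τ i a) (secondForm u x) = κ a := by
    rw [quad_col, h.diagonal, Matrix.diagonal_apply_eq]
  rw [secondForm_eq h0, map_add, map_smul, map_smul, h.quad_firstForm] at h1
  simp only [smul_eq_mul, mul_one] at h1
  rw [← h1]
  field_simp
  ring

namespace IsConvexGraph

variable {n : ℕ} {u : Euc n → ℝ} {Ω : Set (Euc n)} {x : Euc n} {f : (Fin n → ℝ) → ℝ} {σ : ℝ}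

/-- At an interior minimum of `u` all principal curvatures are at least `1`, the curvature of the
horosphere that touches the graph from below; hence `f(κ) ≥ 1`. -/
theorem not_isLocalMin (hf : IsCurvatureFunction f) (hΩ : IsOpen Ω) (hσ1 : σ < 1)
    (hu : IsConvexGraph f σ Ω u) (hx : x ∈ Ω) : ¬ IsLocalMin u x := by
  intro hmin
  have hx0 := hu.ne_zero x hx
  have hux := hu.pos x hx
  obtain ⟨τ, κ, hfr⟩ := exists_isPrincipalFrame hu.smooth hΩ hx hx0
  have hκ := hu.mem_posCone hx hfr
  have hp : ∀ i, pd i u x = 0 := fun i => by simp [pd, hmin.fderiv_eq_zero]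
  have hw : slopeW u x = 1 := by simp [slopeW, hp]
  have h1 : ∀ a, 1 ≤ κ a := by
    intro a
    have h2 := quad_hessMat_nonneg_of_isLocalMin hu.smooth hΩ hx hmin (fun i => τ i a)
    rw [hfr.quad_hessMat hx0, hw] at h2
    have := (mul_nonneg_iff_of_pos_left hux).1 h2
    linarith
  have h3 := hf.mono IsCurvatureFunction.one_mem_posCone hκ h1
  rw [hf.normalized, hu.apply_eq hx hfr] at h3
  linarith

theorem le_of_frontier_eq (hf : IsCurvatureFunction f) (hΩ : IsOpen Ω) (hσ1 : σ < 1)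
    (hu : IsConvexGraph f σ Ω u) (hb : Bornology.IsBounded Ω) (hc : ContinuousOn u (closure Ω))
    {ε : ℝ} (hε : ∀ x ∈ frontier Ω, u x = ε) : ∀ x ∈ closure Ω, ε ≤ u x := by
  intro x hx
  have hcomp : IsCompact (closure Ω) := hb.isCompact_closure
  obtain ⟨x₁, hx₁, hmin⟩ := hcomp.exists_isMinOn ⟨x, hx⟩ hc
  by_cases h1 : x₁ ∈ Ω
  · exact absurd (hmin.isLocalMin (Filter.mem_of_superset (hΩ.mem_nhds h1) subset_closure))
      (hu.not_isLocalMin hf hΩ hσ1 h1)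
  · rw [← hε x₁ (by rw [hΩ.frontier_eq]; exact ⟨hx₁, h1⟩)]
    exact hmin hx

/-- The graph cannot touch, from outside, the lower part of a ball of radius `t` centred at height
`s t` with `s < σ`: the boundary sphere has all principal curvatures `s`, so that `f(κ) ≤ s` at the
point of contact. -/
theorem not_touch_lower_cap (hf : IsCurvatureFunction f) (hΩ : IsOpen Ω)
    (hu : IsConvexGraph f σ Ω u) (hx : x ∈ Ω) {c : Euc n} {s t : ℝ} (hs : 0 < s) (hsσ : s < σ)
    (ht : 0 < t)
    (hmin : IsLocalMin (fun z => ∑ i, (z i - c i) ^ 2 + u z ^ 2 - 2 * (s * t) * u z) x)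
    (heq : ∑ i, (x i - c i) ^ 2 + u x ^ 2 - 2 * (s * t) * u x = (1 - s ^ 2) * t ^ 2) :
    s * t ≤ u x := by
  by_contra! hlt
  have hx0 := hu.ne_zero x hx
  have hux := hu.pos x hx
  have hw := slopeW_pos u x
  obtain ⟨τ, κ, hfr⟩ := exists_isPrincipalFrame hu.smooth hΩ hx hx0
  have hκ := hu.mem_posCone hx hfr
  have hgrad : ∀ j, x j - c j = (s * t - u x) * pd j u x := by
    intro j
    have h1 := pd_sq_dist_add hΩ hu.smooth hx c (s * t) j
    rw [show pd j _ x = 0 by rw [pd, hmin.fderiv_eq_zero]; rfl] at h1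
    linarith
  have hsum : ∑ i, (x i - c i) ^ 2 = (s * t - u x) ^ 2 * (slopeW u x ^ 2 - 1) := by
    rw [slopeW_sq, add_sub_cancel_left, Finset.mul_sum]
    exact Finset.sum_congr rfl fun i _ => by rw [hgrad]; ring
  have hwt : (s * t - u x) * slopeW u x = t := by
    have h1 : ((s * t - u x) * slopeW u x) ^ 2 = t ^ 2 := by
      rw [hsum] at heq
      linear_combination heq
    exact (pow_left_inj₀ (mul_pos (by linarith) hw).le ht.le two_ne_zero).1 h1
  have hle : ∀ a, κ a ≤ s := by
    intro a
    have h1 := quad_hessMat_nonneg_of_isLocalMin (v := fun z => ∑ i, (z i - c i) ^ 2 + u z ^ 2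
      - 2 * (s * t) * u z) (s := Ω) (((ContDiffOn.sum fun i _ =>
        (ContDiff.contDiffOn (by fun_prop))).add (hu.smooth.pow 2)).sub
        (contDiffOn_const.mul hu.smooth)) hΩ hx hmin (fun i => τ i a)
    rw [hessMat_sq_dist_add hΩ hu.smooth hx hx0, map_add, map_smul, map_smul, hfr.quad_firstForm,
      hfr.quad_hessMat hx0] at h1
    simp only [smul_eq_mul, mul_one] at h1
    have h2 : 0 ≤ (2 * u x) * (u x + (u x - s * t) * (slopeW u x * κ a - 1)) := by
      linear_combination h1
    have h3 := (mul_nonneg_iff_of_pos_left (by linarith : 0 < 2 * u x)).1 h2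
    have h4 : 0 ≤ t * (s - κ a) := by linear_combination h3 - κ a * hwt
    have h5 := (mul_nonneg_iff_of_pos_left ht).1 h4
    linarith
  have h6 := hf.mono hκ (mu := fun _ => s) (fun _ => hs) hle
  rw [hf.apply_const hs, hu.apply_eq hx hfr] at h6
  linarith

end IsConvexGraph

/-- The radius `t` of the ball centred at `(c, s t)` whose boundary contains a given point at height
`y` and horizontal distance `√D` from `c`: the positive root of
`(1 - s²) t² + 2 s y t = D + y²`. -/
noncomputable def capRadius (s D y : ℝ) : ℝ :=
  (-(s * y) + √(y ^ 2 + (1 - s ^ 2) * D)) / (1 - s ^ 2)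

theorem capRadius_spec {s D y : ℝ} (hs : 0 < s) (hs1 : s < 1) (hD : 0 ≤ D) :
    (1 - s ^ 2) * capRadius s D y ^ 2 + 2 * s * y * capRadius s D y = D + y ^ 2 := by
  have hq : 0 < 1 - s ^ 2 := by nlinarith
  have h1 : √(y ^ 2 + (1 - s ^ 2) * D) ^ 2 = y ^ 2 + (1 - s ^ 2) * D :=
    Real.sq_sqrt (by positivity)
  unfold capRadius
  generalize √(y ^ 2 + (1 - s ^ 2) * D) = m at *
  have hq' := hq.ne'
  field_simp
  linear_combination h1

theorem capRadius_pos {s D y : ℝ} (hs : 0 < s) (hs1 : s < 1) (hD : 0 ≤ D) (hy : 0 < y) :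
    0 < capRadius s D y := by
  have hq : 0 < 1 - s ^ 2 := by nlinarith
  refine div_pos ?_ hq
  have h1 : y ≤ √(y ^ 2 + (1 - s ^ 2) * D) :=
    Real.le_sqrt_of_sq_le (by nlinarith [mul_nonneg hq.le hD])
  nlinarith

theorem one_div_le_of_capRadius {s r ε R : ℝ} (hs : 0 < s) (hs1 : s < 1) (hr : 0 < r)
    (hε : 0 < ε) (hR : 0 < R) (h : (1 - s ^ 2) * R ^ 2 + 2 * s * ε * R = r ^ 2 + ε ^ 2) :
    1 / R ≤ √(1 - s ^ 2) / r + ε * (1 + s) / r ^ 2 := by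
  have hq : 0 < 1 - s ^ 2 := by nlinarith
  have hm := Real.sq_sqrt hq.le
  have hm0 := Real.sqrt_nonneg (1 - s ^ 2)
  generalize √(1 - s ^ 2) = m at *
  have key : r ^ 2 ≤ (m * r + ε * (1 + s)) * R := by
    rw [← hm] at h
    rcases le_total r (m * R) with h1 | h1
    · have : 0 ≤ ε * (1 + s) * R := by positivity
      nlinarith
    · have h2 : 0 ≤ m * R * (r - m * R) := mul_nonneg (by positivity) (by linarith)
      have h3 : 0 ≤ ε * R * (1 - s) := mul_nonneg (by positivity) (by linarith)
      nlinarith [sq_nonneg ε]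
  rw [div_le_iff₀ hR]
  have : (m / r + ε * (1 + s) / r ^ 2) * R = (m * r + ε * (1 + s)) * R / r ^ 2 := by
    field_simp
  rw [this, le_div_iff₀ (by positivity)]
  linarith

/-- The last point outside of `Ω` on a segment that ends in `Ω`. -/
theorem exists_last_exit {n : ℕ} {Ω : Set (Euc n)} (hΩ : IsOpen Ω) {c x : Euc n} (hc : c ∉ Ω)
    (hx : x ∈ Ω) : ∃ s₀ : ℝ, 0 ≤ s₀ ∧ s₀ < 1 ∧ c + s₀ • (x - c) ∈ frontier Ω ∧
      ∀ s ∈ Set.Icc s₀ 1, c + s • (x - c) ∈ closure Ω := by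
  have hγ : Continuous (fun s : ℝ => c + s • (x - c)) := by fun_prop
  have hS : IsCompact (Set.Icc (0 : ℝ) 1 ∩ (fun s : ℝ => c + s • (x - c)) ⁻¹' Ωᶜ) :=
    isCompact_Icc.inter_right (hΩ.isClosed_compl.preimage hγ)
  obtain ⟨s₀, ⟨hs₀, hs₀Ω⟩, hmax⟩ := hS.exists_isGreatest ⟨0, by simp, by simpa using hc⟩
  have hs₀1 : s₀ < 1 := by
    refine lt_of_le_of_ne hs₀.2 fun h => hs₀Ω ?_
    simpa [h] using hx
  have hin : ∀ s, s₀ < s → s ≤ 1 → c + s • (x - c) ∈ Ω := by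
    intro s h1 h2
    by_contra hn
    exact absurd (hmax ⟨⟨hs₀.1.trans h1.le, h2⟩, hn⟩) (not_le.2 h1)
  have hcl : c + s₀ • (x - c) ∈ closure Ω := by
    refine mem_closure_of_tendsto (f := fun s : ℝ => c + s • (x - c))
      (b := nhdsWithin s₀ (Set.Ioi s₀)) ((hγ.tendsto s₀).mono_left nhdsWithin_le_nhds) ?_
    filter_upwards [Ioc_mem_nhdsGT hs₀1] with s hs using hin s hs.1 hs.2
  refine ⟨s₀, hs₀.1, hs₀1, by rw [hΩ.frontier_eq]; exact ⟨hcl, hs₀Ω⟩, fun s hs => ?_⟩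
  rcases hs.1.eq_or_lt with rfl | h
  · exact hcl
  · exact subset_closure (hin s h hs.2)

/-- The comparison principle with spherical caps: the ball centred at `(c, s R)`, `s < σ`, whose
boundary sphere meets the height `ε` over the exterior tangent sphere at `c`, does not meet the
graph. -/
theorem IsConvexGraph.cap_comparison {n : ℕ} {u : Euc n → ℝ} {Ω : Set (Euc n)}
    {f : (Fin n → ℝ) → ℝ} {σ : ℝ} (hf : IsCurvatureFunction f) (hΩ : IsOpen Ω) (hσ1 : σ < 1)
    (hu : IsConvexGraph f σ Ω u) (hb : Bornology.IsBounded Ω) (hc : ContinuousOn u (closure Ω))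
    {ε : ℝ} (hε0 : 0 < ε) (hε : ∀ x ∈ frontier Ω, u x = ε) {c : Euc n} {r : ℝ} (hr : 0 < r)
    (hball : Disjoint (Metric.ball c r) Ω) {s R : ℝ} (hs : 0 < s) (hsσ : s < σ) (hR : 0 < R)
    (hRr : (1 - s ^ 2) * R ^ 2 + 2 * s * ε * R = r ^ 2 + ε ^ 2) (hεs : ε < s * r) :
    ∀ x ∈ Ω, (1 - s ^ 2) * R ^ 2 ≤ ∑ i, (x i - c i) ^ 2 + u x ^ 2 - 2 * (s * R) * u x := by
  intro x hx
  have hs1 : s < 1 := hsσ.trans hσ1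
  have hq : 0 < 1 - s ^ 2 := by nlinarith
  have hupos : ∀ z ∈ closure Ω, 0 < u z := fun z hz =>
    hε0.trans_le (hu.le_of_frontier_eq hf hΩ hσ1 hb hc hε z hz)
  have hDfr : ∀ z ∈ frontier Ω, r ^ 2 ≤ ∑ i, (z i - c i) ^ 2 := by
    intro z hz
    rw [← sq_dist_eq_sum]
    have h1 : z ∉ Metric.ball c r := fun h =>
      Set.disjoint_left.1 (hball.closure_right Metric.isOpen_ball) h (frontier_subset_closure hz)
    rw [Metric.mem_ball, not_lt] at h1
    gcongr
  set D : Euc n → ℝ := fun z => ∑ i, (z i - c i) ^ 2 with hD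
  have hD0 : ∀ z, 0 ≤ D z := fun z => Finset.sum_nonneg fun i _ => sq_nonneg _
  have hDc : Continuous D := by rw [hD]; fun_prop
  have hTc : ContinuousOn (fun z => capRadius s (D z) (u z)) (closure Ω) := by
    unfold capRadius
    refine ContinuousOn.div_const (ContinuousOn.add (continuousOn_const.mul hc).neg ?_) _
    exact ((hc.pow 2).add (continuousOn_const.mul hDc.continuousOn)).sqrt
  obtain ⟨x₁, hx₁, hmin⟩ := hb.isCompact_closure.exists_isMinOn ⟨x, subset_closure hx⟩ hTc
  set T := capRadius s (D x₁) (u x₁) with hT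
  have hT0 : 0 < T := capRadius_pos hs hs1 (hD0 x₁) (hupos x₁ hx₁)
  have hTeq : (1 - s ^ 2) * T ^ 2 + 2 * s * u x₁ * T = D x₁ + u x₁ ^ 2 :=
    capRadius_spec hs hs1 (hD0 x₁)
  -- no point of the graph lies in a ball of radius at most `T`
  have hmono : ∀ z ∈ closure Ω, ∀ t, 0 ≤ t → t ≤ T →
      (1 - s ^ 2) * t ^ 2 ≤ D z + u z ^ 2 - 2 * (s * t) * u z := by
    intro z hz t ht0 htT
    have h1 : t ≤ capRadius s (D z) (u z) := htT.trans (hmin hz)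
    have h2 := capRadius_spec (y := u z) hs hs1 (hD0 z)
    have h3 : (1 - s ^ 2) * t ^ 2 ≤ (1 - s ^ 2) * capRadius s (D z) (u z) ^ 2 := by gcongr
    have h4 : s * u z * t ≤ s * u z * capRadius s (D z) (u z) :=
      mul_le_mul_of_nonneg_left h1 (mul_pos hs (hupos z hz)).le
    linarith
  by_contra! hcon
  have hTR : T < R := by
    by_contra! h
    exact absurd (hmono x (subset_closure hx) R hR.le h) (not_le.2 hcon)
  have hx₁Ω : x₁ ∈ Ω := by
    by_contra hn
    have hfr : x₁ ∈ frontier Ω := by rw [hΩ.frontier_eq]; exact ⟨hx₁, hn⟩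
    have h1 := hDfr x₁ hfr
    rw [hε x₁ hfr] at hTeq
    have h2 : (1 - s ^ 2) * T ^ 2 < (1 - s ^ 2) * R ^ 2 := by gcongr
    have h3 : s * ε * T < s * ε * R := by gcongr
    have : r ^ 2 ≤ D x₁ := h1
    linarith
  have heq : D x₁ + u x₁ ^ 2 - 2 * (s * T) * u x₁ = (1 - s ^ 2) * T ^ 2 := by linarith
  have hlocmin : IsLocalMin (fun z => ∑ i, (z i - c i) ^ 2 + u z ^ 2 - 2 * (s * T) * u z) x₁ := by
    filter_upwards [hΩ.mem_nhds hx₁Ω] with z hz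
    exact heq.trans_le (hmono z (subset_closure hz) T hT0.le le_rfl)
  have hupper := hu.not_touch_lower_cap hf hΩ hx₁Ω hs hsσ hT0 hlocmin heq
  -- on the segment from `c` to `x₁` the graph would have to cross the height `s T` inside the ball
  have hcΩ : c ∉ Ω := Set.disjoint_left.1 hball (Metric.mem_ball_self hr)
  obtain ⟨s₀, hs₀, hs₀1, hfr, hseg⟩ := exists_last_exit hΩ hcΩ hx₁Ω
  have hDγ : ∀ t : ℝ, D (c + t • (x₁ - c)) = t ^ 2 * D x₁ := by
    intro t
    simp only [hD, Finset.mul_sum]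
    refine Finset.sum_congr rfl fun i _ => ?_
    simp
    ring
  have hDx₁ : r ^ 2 ≤ D x₁ := by
    have h1 : r ^ 2 ≤ D (c + s₀ • (x₁ - c)) := hDfr _ hfr
    rw [hDγ] at h1
    have h2 : s₀ ^ 2 ≤ 1 := pow_le_one₀ hs₀ hs₀1.le
    nlinarith [hD0 x₁]
  have hDT : D x₁ = T ^ 2 - (u x₁ - s * T) ^ 2 := by linear_combination heq
  have hrT : r ≤ T := by
    refine (pow_le_pow_iff_left₀ hr.le hT0.le two_ne_zero).1 ?_
    nlinarith [sq_nonneg (u x₁ - s * T)]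
  have hεT : ε < s * T := hεs.trans_le (mul_le_mul_of_nonneg_left hrT hs.le)
  have hcont : ContinuousOn (fun t : ℝ => u (c + t • (x₁ - c))) (Set.Icc s₀ 1) :=
    hc.comp (by fun_prop) hseg
  have hivt := intermediate_value_Icc hs₀1.le hcont
  obtain ⟨t, ht, hut⟩ := hivt (show s * T ∈ _ from
    ⟨by simp only [hε _ hfr]; exact hεT.le, by simpa using hupper⟩)
  have h1 := hmono _ (hseg t ht) T hT0.le le_rfl
  simp only at hut
  rw [hut, hDγ] at h1
  have ht1 : t ^ 2 ≤ 1 := pow_le_one₀ (hs₀.trans ht.1) ht.2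
  have h2 : (u x₁ - s * T) ^ 2 ≤ 0 := by nlinarith [hD0 x₁]
  have h3 : u x₁ - s * T = 0 := by
    have := le_antisymm h2 (sq_nonneg _)
    exact pow_eq_zero_iff two_ne_zero |>.1 this
  have h4 : D x₁ = 0 := by
    simp only [hD]
    refine Finset.sum_eq_zero fun j _ => ?_
    have h5 := pd_sq_dist_add hΩ hu.smooth hx₁Ω c (s * T) j
    rw [show pd j _ x₁ = 0 by rw [pd, hlocmin.fderiv_eq_zero]; rfl, h3] at h5
    have : x₁ j - c j = 0 := by linarith
    rw [this]; ring
  nlinarith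

/-! ### The gradient at the boundary -/

/-- A linear form that is nonnegative on an open half-space is a nonpositive multiple of the form
that defines the half-space. -/
theorem exists_eq_neg_smul_of_nonneg {E : Type*} [AddCommGroup E] [Module ℝ E] {d l : E →ₗ[ℝ] ℝ}
    (hd : d ≠ 0) (h : ∀ v, d v < 0 → 0 ≤ l v) : ∃ a : ℝ, 0 ≤ a ∧ ∀ v, l v = -(a * d v) := by
  obtain ⟨v₁, hv₁⟩ : ∃ v, d v ≠ 0 := by
    by_contra! hn
    exact hd (LinearMap.ext hn)
  set v₀ := (-(d v₁)⁻¹) • v₁ with hv₀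
  have hdv₀ : d v₀ = -1 := by rw [hv₀, map_smul, smul_eq_mul]; field_simp
  have hle : ∀ v, -(l v₀ * d v) ≤ l v := by
    intro v
    refine le_of_forall_pos_le_add fun δ hδ => ?_
    set ρ := δ / (1 + |l v₀|) with hρ
    have h0 : 0 < 1 + |l v₀| := by positivity
    have hρ0 : 0 < ρ := div_pos hδ h0
    have h1 := h (v + (d v + ρ) • v₀) (by
      rw [map_add, map_smul, hdv₀, smul_eq_mul]; linarith)
    rw [map_add, map_smul, smul_eq_mul] at h1
    have h2 : ρ * l v₀ ≤ δ := by
      have h3 : ρ * l v₀ ≤ ρ * (1 + |l v₀|) :=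
        mul_le_mul_of_nonneg_left (by linarith [le_abs_self (l v₀)]) hρ0.le
      rwa [hρ, div_mul_cancel₀ _ h0.ne', ← hρ] at h3
    linarith
  refine ⟨l v₀, h v₀ (by rw [hdv₀]; norm_num), fun v => le_antisymm ?_ (hle v)⟩
  have := hle (-v)
  rw [map_neg, map_neg] at this
  linarith

/-- Directions that point into a domain with smooth boundary. -/
theorem HasSmoothBoundary.exists_inward {n : ℕ} {Ω : Set (Euc n)} (h : HasSmoothBoundary Ω)
    (hΩ : IsOpen Ω) {x₀ : Euc n} (hx₀ : x₀ ∈ frontier Ω) :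
    ∃ d : Euc n →L[ℝ] ℝ, d ≠ 0 ∧
      ∀ v, d v < 0 → ∀ᶠ t in nhdsWithin (0 : ℝ) (Set.Ioi 0), x₀ + t • v ∈ Ω := by
  obtain ⟨U, hU, hx₀U, ρ, hρ, hd, hΩU⟩ := h x₀ hx₀
  refine ⟨fderiv ℝ ρ x₀, hd, fun v hv => ?_⟩
  have hdiff := hρ.differentiableAt_of_isOpen hU hx₀U
  have hmem : ∀ᶠ t in nhds (0 : ℝ), x₀ + t • v ∈ U := by
    have hc : ContinuousAt (fun t : ℝ => x₀ + t • v) 0 := by fun_prop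
    exact hc.eventually_mem (hU.mem_nhds (by simpa using hx₀U))
  have hρ0 : ρ x₀ = 0 := by
    refine le_antisymm ?_ ?_
    · -- `x₀` is a limit of points of `Ω`, where `ρ < 0`
      by_contra! hpos
      have h1 := (hdiff.continuousAt.eventually (lt_mem_nhds hpos)).and (hU.mem_nhds hx₀U)
      obtain ⟨y, hy, hyΩ⟩ := mem_closure_iff_nhds.1 (frontier_subset_closure hx₀) _ h1
      have h2 : y ∈ Ω ∩ U := ⟨hyΩ, hy.2⟩
      rw [hΩU] at h2
      exact absurd hy.1 (not_lt.2 h2.2.le)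
    · by_contra! hneg
      have h2 : x₀ ∈ Ω ∩ U := by rw [hΩU]; exact ⟨hx₀U, hneg⟩
      rw [hΩ.frontier_eq] at hx₀
      exact hx₀.2 h2.1
  have hslope := (hasDerivAt_line hdiff v).tendsto_slope_zero_right
  filter_upwards [hslope.eventually (gt_mem_nhds hv), nhdsWithin_le_nhds hmem,
    self_mem_nhdsWithin] with t ht htU ht0
  have ht0' : 0 < t := ht0
  have h2 : x₀ + t • v ∈ Ω ∩ U := by
    rw [hΩU]
    refine ⟨htU, ?_⟩
    simp only [zero_add, zero_smul, add_zero, hρ0, sub_zero, smul_eq_mul] at ht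
    rw [inv_mul_eq_div] at ht
    exact (div_neg_iff.1 ht).elim (fun h => absurd h.2 (not_lt.2 ht0'.le)) fun h => h.1
  exact h2.1

/-- A function that is smooth up to the boundary has a one-sided derivative at each boundary point,
and it is the limit of the derivatives from inside. -/
theorem ContDiffOn.exists_boundary_fderiv {n : ℕ} {u : Euc n → ℝ} {Ω : Set (Euc n)}
    (hu : ContDiffOn ℝ ∞ u (closure Ω)) (hΩ : IsOpen Ω) {x₀ : Euc n} (hx₀ : x₀ ∈ closure Ω) :
    ∃ L : Euc n →L[ℝ] ℝ, HasFDerivWithinAt u L (closure Ω) x₀ ∧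
      Filter.Tendsto (fderiv ℝ u) (nhdsWithin x₀ Ω) (nhds L) := by
  have h1 : ContDiffWithinAt ℝ (0 + 1) u (closure Ω) x₀ := (hu x₀ hx₀).of_le (by simp)
  obtain ⟨v, hv, -, f', hf', hcont⟩ :=
    (contDiffWithinAt_succ_iff_hasFDerivWithinAt (by simp)).1 h1
  rw [Set.insert_eq_of_mem hx₀] at hv
  have hx₀v : x₀ ∈ v := mem_of_mem_nhdsWithin hx₀ hv
  have hvΩ : v ∈ nhdsWithin x₀ Ω := nhdsWithin_mono x₀ subset_closure hv
  refine ⟨f' x₀, (hf' x₀ hx₀v).mono_of_mem_nhdsWithin hv, ?_⟩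
  have h2 : Filter.Tendsto f' (nhdsWithin x₀ Ω) (nhds (f' x₀)) :=
    hcont.continuousWithinAt.tendsto.mono_left (nhdsWithin_le_of_mem hvΩ)
  refine h2.congr' ?_
  obtain ⟨O, hO, hx₀O, hOv⟩ := mem_nhdsWithin.1 hv
  filter_upwards [self_mem_nhdsWithin, nhdsWithin_le_nhds (hO.mem_nhds hx₀O)] with y hyΩ hyO
  have hyv : v ∈ nhds y := by
    filter_upwards [hΩ.mem_nhds hyΩ, hO.mem_nhds hyO] with z hz hzO
      using hOv ⟨hzO, subset_closure hz⟩
  exact (((hf' y (mem_of_mem_nhds hyv)).hasFDerivAt hyv).fderiv).symm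

theorem HasDerivWithinAt.nonneg_of_eventually {ψ : ℝ → ℝ} {ψ' : ℝ}
    (h : HasDerivWithinAt ψ ψ' (Set.Ioi 0) 0) (h0 : ψ 0 = 0)
    (hp : ∀ᶠ t in nhdsWithin (0 : ℝ) (Set.Ioi 0), 0 ≤ ψ t) : 0 ≤ ψ' := by
  rw [hasDerivWithinAt_iff_tendsto_slope' (by simp)] at h
  refine ge_of_tendsto h ?_
  filter_upwards [hp, self_mem_nhdsWithin] with t ht ht0
  rw [slope_def_field, h0, sub_zero, sub_zero]
  exact div_nonneg ht (le_of_lt ht0)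

theorem hasDerivWithinAt_line_of_eventually {n : ℕ} {u : Euc n → ℝ} {Ω : Set (Euc n)}
    {x₀ v : Euc n} {L : Euc n →L[ℝ] ℝ} (hL : HasFDerivWithinAt u L (closure Ω) x₀)
    (hv : ∀ᶠ t in nhdsWithin (0 : ℝ) (Set.Ioi 0), x₀ + t • v ∈ Ω) :
    HasDerivWithinAt (fun t : ℝ => u (x₀ + t • v)) (L v) (Set.Ioi 0) 0 := by
  have h1 : HasDerivWithinAt (fun t : ℝ => x₀ + t • v) v
      ((fun t : ℝ => x₀ + t • v) ⁻¹' closure Ω) 0 := by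
    have : HasDerivAt (fun t : ℝ => x₀ + t • v) v 0 := by
      simpa using ((hasDerivAt_id (0 : ℝ)).smul_const v).const_add x₀
    exact this.hasDerivWithinAt
  have h2 : HasFDerivWithinAt u L (closure Ω) (x₀ + (0 : ℝ) • v) := by simpa using hL
  have h3 := h2.comp_hasDerivWithinAt 0 h1 (Set.mapsTo_preimage _ _)
  exact h3.mono_of_mem_nhdsWithin (hv.mono fun t ht => subset_closure ht)

namespace IsConvexGraph

variable {n : ℕ} {u : Euc n → ℝ} {Ω : Set (Euc n)} {f : (Fin n → ℝ) → ℝ} {σ ε r : ℝ}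

/-- The spherical cap through a boundary point bounds the gradient of `u` there. -/
theorem boundary_gradient_bound (hf : IsCurvatureFunction f) (hΩ : IsOpen Ω) (hσ1 : σ < 1)
    (hu : IsConvexGraph f σ Ω u) (hb : Bornology.IsBounded Ω) (hsmooth : HasSmoothBoundary Ω)
    (hc : ContinuousOn u (closure Ω)) (hε0 : 0 < ε) (hε : ∀ x ∈ frontier Ω, u x = ε)
    {x₀ c : Euc n} (hx₀ : x₀ ∈ frontier Ω) (hr : 0 < r) (hxc : dist x₀ c = r)
    (hball : Disjoint (Metric.ball c r) Ω) {s R : ℝ} (hs : 0 < s) (hsσ : s < σ) (hR : 0 < R)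
    (hRr : (1 - s ^ 2) * R ^ 2 + 2 * s * ε * R = r ^ 2 + ε ^ 2) (hεs : ε < s * r)
    (hεR : ε < s * R) {L : Euc n →L[ℝ] ℝ} (hL : HasFDerivWithinAt u L (closure Ω) x₀) :
    (s * R - ε) ^ 2 * ∑ i, L (EuclideanSpace.single i 1) ^ 2 ≤ r ^ 2 := by
  have hcap := hu.cap_comparison hf hΩ hσ1 hb hc hε0 hε hr hball hs hsσ hR hRr hεs
  have hlow := hu.le_of_frontier_eq hf hΩ hσ1 hb hc hε
  obtain ⟨d, hd, hin⟩ := hsmooth.exists_inward hΩ hx₀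
  have hux₀ := hε x₀ hx₀
  have hr2 : ∑ i, (x₀ i - c i) ^ 2 = r ^ 2 := by rw [← sq_dist_eq_sum, hxc]
  set N : Euc n →ₗ[ℝ] ℝ := ∑ i, (x₀ i - c i) • (EuclideanSpace.proj i : Euc n →L[ℝ] ℝ).toLinearMap
    with hN
  have hNv : ∀ v, N v = ∑ i, (x₀ i - c i) * v i := fun v => by
    simp [hN, LinearMap.sum_apply]
  have h1 : ∀ v, (d : Euc n →ₗ[ℝ] ℝ) v < 0 → 0 ≤ (L : Euc n →ₗ[ℝ] ℝ) v := by
    intro v hv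
    have h2 := (hasDerivWithinAt_line_of_eventually hL (hin v hv)).sub_const ε
    refine h2.nonneg_of_eventually (by simp [hux₀]) ?_
    filter_upwards [hin v hv] with t ht
    exact sub_nonneg.2 (hlow _ (subset_closure ht))
  have h3 : ∀ v, (d : Euc n →ₗ[ℝ] ℝ) v < 0 →
      0 ≤ (N - (s * R - ε) • (L : Euc n →ₗ[ℝ] ℝ)) v := by
    intro v hv
    have h4 := hasDerivWithinAt_line_of_eventually hL (hin v hv)
    have h5 : HasDerivWithinAt (fun t : ℝ => ∑ i, ((x₀ + t • v) i - c i) ^ 2)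
        (∑ i, 2 * (x₀ i - c i) * v i) (Set.Ioi 0) 0 := by
      refine HasDerivWithinAt.fun_sum fun i _ => ?_
      have h6 : HasDerivAt (fun t : ℝ => (x₀ + t • v) i - c i) (v i) 0 := by
        simpa using (((hasDerivAt_id (0 : ℝ)).mul_const (v i)).const_add (x₀ i)).sub_const (c i)
      simpa using (h6.fun_pow 2).hasDerivWithinAt
    have h7 := ((h5.fun_add (h4.fun_pow 2)).fun_sub (h4.const_mul (2 * (s * R)))).sub_const
      ((1 - s ^ 2) * R ^ 2)
    have h8 := h7.nonneg_of_eventually (by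
      simp only [zero_smul, add_zero, hux₀, hr2]; linarith) (by
      filter_upwards [hin v hv] with t ht
      exact sub_nonneg.2 (hcap _ ht))
    simp only [zero_smul, add_zero, hux₀] at h8
    simp only [LinearMap.sub_apply, LinearMap.smul_apply, hNv, smul_eq_mul]
    have h9 : ∑ i, 2 * (x₀ i - c i) * v i = 2 * ∑ i, (x₀ i - c i) * v i := by
      rw [Finset.mul_sum]
      exact Finset.sum_congr rfl fun i _ => by ring
    rw [h9] at h8
    have h10 : (L : Euc n →ₗ[ℝ] ℝ) v = L v := rfl
    rw [h10]
    norm_num at h8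
    linarith
  have hd' : (d : Euc n →ₗ[ℝ] ℝ) ≠ 0 := fun h => hd (ContinuousLinearMap.coe_injective h)
  obtain ⟨α, hα, hLα⟩ := exists_eq_neg_smul_of_nonneg hd' h1
  obtain ⟨β, hβ, hNβ⟩ := exists_eq_neg_smul_of_nonneg hd' h3
  rw [← hr2, Finset.mul_sum]
  refine Finset.sum_le_sum fun i _ => ?_
  have h11 := hNβ (EuclideanSpace.single i 1)
  have h12 : L (EuclideanSpace.single i 1) = -(α * d (EuclideanSpace.single i 1)) := hLα _
  have h13 : N (EuclideanSpace.single i 1) = x₀ i - c i := by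
    rw [hNv]
    simp
  rw [LinearMap.sub_apply, LinearMap.smul_apply, h13, smul_eq_mul] at h11
  have h14 : x₀ i - c i = -(((s * R - ε) * α + β) * d (EuclideanSpace.single i 1)) := by
    have h15 : (L : Euc n →ₗ[ℝ] ℝ) (EuclideanSpace.single i 1) =
      -(α * d (EuclideanSpace.single i 1)) := hLα _
    have h16 : (d : Euc n →ₗ[ℝ] ℝ) (EuclideanSpace.single i 1) =
      d (EuclideanSpace.single i 1) := rfl
    rw [h15, h16] at h11
    linarith
  rw [h12, h14]
  have h17 : (s * R - ε) * α ≤ (s * R - ε) * α + β := by linarith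
  have h18 : 0 ≤ (s * R - ε) * α := mul_nonneg (by linarith) hα
  have h19 : ((s * R - ε) * α) ^ 2 ≤ ((s * R - ε) * α + β) ^ 2 := by gcongr
  nlinarith [mul_le_mul_of_nonneg_right h19 (sq_nonneg (d (EuclideanSpace.single i 1)))]

/-- The boundary value of `η` that the cap of curvature `s < σ` gives. -/
theorem boundary_eta_le_of_lt (hf : IsCurvatureFunction f) (hΩ : IsOpen Ω) (hσ1 : σ < 1)
    (hu : IsConvexGraph f σ Ω u) (hb : Bornology.IsBounded Ω) (hsmooth : HasSmoothBoundary Ω)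
    (hc : ContinuousOn u (closure Ω)) (hε0 : 0 < ε) (hε : ∀ x ∈ frontier Ω, u x = ε)
    {x₀ c : Euc n} (hx₀ : x₀ ∈ frontier Ω) (hr : 0 < r) (hxc : dist x₀ c = r)
    (hball : Disjoint (Metric.ball c r) Ω) {s : ℝ} (hs : 0 < s) (hsσ : s < σ)
    (hεs : ε < s * r) {L : Euc n →L[ℝ] ℝ} (hL : HasFDerivWithinAt u L (closure Ω) x₀) :
    (s - 1 / √(1 + ∑ i, L (EuclideanSpace.single i 1) ^ 2)) / ε ≤
      √(1 - s ^ 2) / r + ε * (1 + s) / r ^ 2 := by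
  have hs1 : s < 1 := hsσ.trans hσ1
  have hR := capRadius_pos hs hs1 (sq_nonneg r) hε0
  have hRr := capRadius_spec (y := ε) hs hs1 (sq_nonneg r)
  set R := capRadius s (r ^ 2) ε
  have hrR : r ≤ R := by
    by_contra! hlt
    have h1 : s * R < s * r := by gcongr
    have h2 : R ^ 2 < r ^ 2 := by gcongr
    have h3 : R ^ 2 = r ^ 2 + (s * R - ε) ^ 2 := by linear_combination hRr
    nlinarith [sq_nonneg (s * R - ε)]
  have hεR : ε < s * R := hεs.trans_le (mul_le_mul_of_nonneg_left hrR hs.le)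
  have hgrad := hu.boundary_gradient_bound hf hΩ hσ1 hb hsmooth hc hε0 hε hx₀ hr hxc hball hs hsσ
    hR hRr hεs hεR hL
  refine le_trans ?_ (one_div_le_of_capRadius hs hs1 hr hε0 hR hRr)
  set G := ∑ i, L (EuclideanSpace.single i 1) ^ 2 with hG
  have hG0 : 0 ≤ G := Finset.sum_nonneg fun i _ => sq_nonneg _
  have h1 : (s * R - ε) * √(1 + G) ≤ R := by
    refine (pow_le_pow_iff_left₀ (mul_nonneg (by linarith) (Real.sqrt_nonneg _)) hR.le
      two_ne_zero).1 ?_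
    rw [mul_pow, Real.sq_sqrt (by linarith)]
    linarith
  have hw : 0 < √(1 + G) := Real.sqrt_pos.2 (by linarith)
  have h2 : (s * R - ε) / R ≤ 1 / √(1 + G) := by
    rw [div_le_div_iff₀ hR hw]
    linarith
  have h3 : (s * R - ε) / R = s - ε / R := by field_simp
  rw [div_le_iff₀ hε0]
  have h4 : 1 / R * ε = ε / R := by ring
  linarith

/-- The bound for the boundary value of `η`, where `∇u` is the one-sided derivative `L`. -/
theorem boundary_eta_le (hf : IsCurvatureFunction f) (hΩ : IsOpen Ω) (hσ : 0 < σ) (hσ1 : σ < 1)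
    (hu : IsConvexGraph f σ Ω u) (hb : Bornology.IsBounded Ω) (hsmooth : HasSmoothBoundary Ω)
    (hc : ContinuousOn u (closure Ω)) (hε0 : 0 < ε) (hε : ∀ x ∈ frontier Ω, u x = ε)
    {x₀ c : Euc n} (hx₀ : x₀ ∈ frontier Ω) (hr : 0 < r) (hxc : dist x₀ c = r)
    (hball : Disjoint (Metric.ball c r) Ω)
    {L : Euc n →L[ℝ] ℝ} (hL : HasFDerivWithinAt u L (closure Ω) x₀) :
    (σ - 1 / √(1 + ∑ i, L (EuclideanSpace.single i 1) ^ 2)) / ε ≤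
      √(1 - σ ^ 2) / r + ε * (1 + σ) / r ^ 2 := by
  rcases lt_or_ge ε (σ * r) with hlt | hge
  · -- let the curvature of the caps tend to `σ` from below
    have hl : Filter.Tendsto (fun s : ℝ =>
        (s - 1 / √(1 + ∑ i, L (EuclideanSpace.single i 1) ^ 2)) / ε) (nhdsWithin σ (Set.Iio σ))
        (nhds ((σ - 1 / √(1 + ∑ i, L (EuclideanSpace.single i 1) ^ 2)) / ε)) := by
      have : Continuous (fun s : ℝ =>
        (s - 1 / √(1 + ∑ i, L (EuclideanSpace.single i 1) ^ 2)) / ε) := by fun_prop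
      exact (this.tendsto σ).mono_left nhdsWithin_le_nhds
    have hr' : Filter.Tendsto (fun s : ℝ => √(1 - s ^ 2) / r + ε * (1 + s) / r ^ 2)
        (nhdsWithin σ (Set.Iio σ)) (nhds (√(1 - σ ^ 2) / r + ε * (1 + σ) / r ^ 2)) := by
      have : Continuous (fun s : ℝ => √(1 - s ^ 2) / r + ε * (1 + s) / r ^ 2) := by fun_prop
      exact (this.tendsto σ).mono_left nhdsWithin_le_nhds
    refine le_of_tendsto_of_tendsto hl hr' ?_
    have h1 : max 0 (ε / r) < σ := max_lt hσ (by rwa [div_lt_iff₀ hr])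
    filter_upwards [Ioo_mem_nhdsLT h1] with s hs
    exact hu.boundary_eta_le_of_lt hf hΩ hσ1 hb hsmooth hc hε0 hε hx₀ hr hxc hball
      ((le_max_left _ _).trans_lt hs.1) hs.2
      (by rw [← div_lt_iff₀ hr]; exact (le_max_right _ _).trans_lt hs.1) hL
  · -- for `ε ≥ σ r` the bound already follows from `ν > 0`
    have hq : 0 < 1 - σ ^ 2 := by nlinarith
    have hm := Real.sq_sqrt hq.le
    have hm0 := Real.sqrt_nonneg (1 - σ ^ 2)
    have hν : 0 ≤ 1 / √(1 + ∑ i, L (EuclideanSpace.single i 1) ^ 2) := by positivity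
    have h1 : (σ - 1 / √(1 + ∑ i, L (EuclideanSpace.single i 1) ^ 2)) / ε ≤ σ / ε :=
      div_le_div_of_nonneg_right (by linarith) hε0.le
    refine h1.trans ?_
    generalize √(1 - σ ^ 2) = m at *
    have hmσ : 1 ≤ m + σ := by nlinarith [mul_nonneg hm0 hσ.le]
    rw [div_le_iff₀ hε0]
    have h2 : (m / r + ε * (1 + σ) / r ^ 2) * ε = (m * r * ε + (1 + σ) * ε ^ 2) / r ^ 2 := by
      field_simp
    rw [h2, le_div_iff₀ (by positivity)]
    have h3 : r * (σ * r) ≤ r * ε := mul_le_mul_of_nonneg_left hge hr.le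
    have h4 : r * ε * 1 ≤ r * ε * (m + σ) := mul_le_mul_of_nonneg_left hmσ (by positivity)
    have h5 : σ * r * ε ≤ ε * ε := mul_le_mul_of_nonneg_right hge hε0.le
    nlinarith [mul_nonneg hσ.le (sq_nonneg ε)]

/-- The global bound: the boundary estimate and the maximum principle. -/
theorem eta_le_of_exteriorSpheres (hf : IsCurvatureFunction f) (hΩ : IsOpen Ω) (hσ : 0 < σ)
    (hσ1 : σ < 1) (hu : IsConvexGraph f σ Ω u) (hb : Bornology.IsBounded Ω)
    (hsmooth : HasSmoothBoundary Ω) (huc : ContDiffOn ℝ ∞ u (closure Ω)) (hε0 : 0 < ε)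
    (hε : ∀ x ∈ frontier Ω, u x = ε) (hr : 0 < r) (hext : HasExteriorSpheres Ω r) :
    ∀ x ∈ Ω, eta σ u x ≤ √(1 - σ ^ 2) / r + ε * (1 + σ) / r ^ 2 := by
  refine hu.eta_le_of_frontier hf hΩ hσ hσ1 hb fun x₀ hx₀ b hb' => ?_
  obtain ⟨c, hxc, hball⟩ := hext x₀ hx₀
  have hx₀c := frontier_subset_closure hx₀
  obtain ⟨L, hL, hlim⟩ := huc.exists_boundary_fderiv hΩ hx₀c
  have h1 := hu.boundary_eta_le hf hΩ hσ hσ1 hb hsmooth huc.continuousOn hε0 hε hx₀ hr hxc hball hL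
  have hpd : ∀ i, Filter.Tendsto (fun x => pd i u x) (nhdsWithin x₀ Ω)
      (nhds (L (EuclideanSpace.single i 1))) := fun i =>
    ((ContinuousLinearMap.apply ℝ ℝ (EuclideanSpace.single i (1 : ℝ) : Euc n)).continuous.tendsto
      L).comp hlim
  have hw : Filter.Tendsto (slopeW u) (nhdsWithin x₀ Ω)
      (nhds √(1 + ∑ i, L (EuclideanSpace.single i 1) ^ 2)) :=
    ((tendsto_finsetSum _ fun i _ => (hpd i).pow 2).const_add 1).sqrt
  have hu₀ : Filter.Tendsto u (nhdsWithin x₀ Ω) (nhds ε) := by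
    have := (huc.continuousOn x₀ hx₀c).mono subset_closure
    rw [← hε x₀ hx₀]
    exact this
  have hη : Filter.Tendsto (eta σ u) (nhdsWithin x₀ Ω)
      (nhds ((σ - 1 / √(1 + ∑ i, L (EuclideanSpace.single i 1) ^ 2)) / ε)) := by
    have h2 : eta σ u = fun x => (σ - 1 / slopeW u x) / u x := funext fun x => eta_eq σ u x
    rw [h2]
    have hν := tendsto_const_nhds (x := (1 : ℝ)) |>.div hw (Real.sqrt_pos.2 (by positivity)).ne'
    exact (hν.const_sub σ).div hu₀ hε0.ne'
  exact hη.eventually (gt_mem_nhds (h1.trans_lt hb'))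

end IsConvexGraph

theorem theorem3p1 (n : ℕ) (hn : 1 ≤ n) (Ω : Set (Euc n)) (hΩo : IsOpen Ω)
    (hΩc : IsConnected Ω) :
    (∀ (f : (Fin n → ℝ) → ℝ) (σ : ℝ) (u : Euc n → ℝ), IsCurvatureFunction f → 0 < σ → σ < 1 →
      IsConvexGraph f σ Ω u →
      -- the differential inequality, in every orthonormal frame
      (∀ x ∈ Ω, ∀ P : Matrix (Fin n) (Fin n) ℝ, IsOrthonormalFrame u x P →
        ∃ Φ : Matrix (Fin n) (Fin n) ℝ, IsFGradient f (inFrame P (secondForm u x)) Φ ∧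
          ∀ κ : Fin n → ℝ, IsPrincipalCurvatures u x κ →
            σ * (1 - σ) * ((∑ i, fpd f i κ) - 1) / u x ≤
                ∑ i, ∑ j, Φ i j *
                  inFrame P (covHess (firstForm u) (eta σ u) x) i j ∧
              0 ≤ σ * (1 - σ) * ((∑ i, fpd f i κ) - 1) / u x) ∧
      -- the maximum principle
      (Bornology.IsBounded Ω → ∀ H : Euc n → ℝ, ContinuousOn H (closure Ω) →
        Set.EqOn H (eta σ u) Ω →
          (∃ x₀ ∈ frontier Ω, IsMaxOn H (closure Ω) x₀) ∧
          ∀ x ∈ Ω, eta σ u x ≤ sSup (H '' frontier Ω))) ∧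
    -- the estimate for constant boundary height, for every radius of exterior tangent spheres,
    -- hence for the maximal one (and in the limit if the maximal radius is infinite)
    (Bornology.IsBounded Ω → HasSmoothBoundary Ω →
      ∃ ε₀ : ℝ, 0 < ε₀ ∧
        ∀ (f : (Fin n → ℝ) → ℝ) (σ : ℝ) (u : Euc n → ℝ) (ε : ℝ), IsCurvatureFunction f →
          0 < σ → σ < 1 → IsConvexGraph f σ Ω u → ContDiffOn ℝ ∞ u (closure Ω) →
          0 < ε → ε ≤ ε₀ → (∀ x ∈ frontier Ω, u x = ε) →
          ∀ r₁ : ℝ, 0 < r₁ → HasExteriorSpheres Ω r₁ →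
            ∀ x ∈ Ω, eta σ u x ≤ √(1 - σ ^ 2) / r₁ + ε * (1 + σ) / r₁ ^ 2) := by
  refine ⟨fun f σ u hf hσ hσ1 hu => ⟨fun x hx P hP => ?_, fun hb H hH hHη => ?_⟩,
    fun hb hsmooth => ⟨1, one_pos, ?_⟩⟩
  · exact hu.exists_isFGradient hf hΩo hσ hσ1 hx hP
  · exact hu.exists_frontier_isMaxOn hn hf hΩo hΩc.nonempty hσ hσ1 hb hH hHη
  · -- the caps bound the gradient at the boundary for every height `ε`, so any `ε₀ > 0` will do
    intro f σ u ε hf hσ hσ1 hu huc hε0 _ hε r hr hext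
    exact hu.eta_le_of_exteriorSpheres hf hΩo hσ hσ1 hb hsmooth huc hε0 hε hr hext
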